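/- Let $G=(U,V,E)$ and $G'=(U',V',E')$ be finite bipartite graphs, i.e. $U,V$ are disjoint finite sets and $E\subset\{\{u,v\}\mid u\in U,\ v\in V\}$, and similarly for $G'$. Let $C^*(G)$ denote the universal $C^*$-algebra generated by projections $(p_x)_{x\in U\cup V}$ subject to the relations $\sum_{u\in U}p_u=1=\sum_{v\in V}p_v$ and $p_up_v=0$ for all $u\in U$, $v\in V$ with $\{u,v\}\notin E$. For a $C^*$-algebra $A$ let $\mathrm{Spec}(A)$ be the set of unitary equivalence classes of irreducible representations of $A$, with the coarsest topology for which $\pi\mapsto\ker\pi$ is continuous as a map to the space of primitive ideals of $A$ with the hull-kernel topology, and let $\mathrm{Spec}_{\le 2}(A)\subset\mathrm{Spec}(A)$ be the subspace of classes of one- and two-dimensional irreducible representations, with the subspace topology. Then $C^*(G)$ and $C^*(G')$ are $*$-isomorphic if and only if $\mathrm{Spec}_{\le 2}(C^*(G))$ and $\mathrm{Spec}_{\le 2}(C^*(G'))$ are homeomorphic. -/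

import Mathlib

noncomputable section

universe u

/-! ### The free unital `*`-algebra on self-adjoint generators -/

/-- The free unital complex `*`-algebra on a family of self-adjoint generators indexed by `X`:
formal complex linear combinations of words in `X`, where the involution reverses words and
conjugates coefficients. -/
def FreeStarAlgebra (X : Type*) : Type _ := MonoidAlgebra ℂ (FreeMonoid X)

namespace FreeStarAlgebra

variable {X : Type*}

instance : Ring (FreeStarAlgebra X) := inferInstanceAs (Ring (MonoidAlgebra ℂ (FreeMonoid X)))

instance : Algebra ℂ (FreeStarAlgebra X) :=
  inferInstanceAs (Algebra ℂ (MonoidAlgebra ℂ (FreeMonoid X)))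

/-- The monomial `c • w` for a word `w`. -/
def mono (w : FreeMonoid X) (c : ℂ) : FreeStarAlgebra X := MonoidAlgebra.single w c

/-- The generator with index `x`. -/
def gen (x : X) : FreeStarAlgebra X := mono (FreeMonoid.of x) 1

theorem mono_mul (w w' : FreeMonoid X) (c c' : ℂ) :
    mono w c * mono w' c' = mono (w * w') (c * c') :=
  MonoidAlgebra.single_mul_single ..

theorem mono_one : mono (1 : FreeMonoid X) 1 = 1 := rfl

theorem smul_mono (a : ℂ) (w : FreeMonoid X) (c : ℂ) : a • mono w c = mono w (a * c) :=
  MonoidAlgebra.smul_single ..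

theorem induction_mono {P : FreeStarAlgebra X → Prop} (a : FreeStarAlgebra X) (h0 : P 0)
    (hm : ∀ w c, P (mono w c)) (ha : ∀ a b, P a → P b → P (a + b)) : P a :=
  MonoidAlgebra.induction_linear (motive := P) a h0 (fun f g => ha f g) hm

/-- The involution as an additive map. -/
def starHom : FreeStarAlgebra X →+ FreeStarAlgebra X :=
  (Finsupp.liftAddHom (fun w : FreeMonoid X =>
    ({ toFun := fun c => mono (star w) (star c)
       map_zero' := by
         simp only [mono, star_zero]
         exact MonoidAlgebra.single_zero ..
       map_add' := fun c d => by
         simp only [mono, star_add]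
         exact MonoidAlgebra.single_add .. } : ℂ →+ FreeStarAlgebra X))).comp
    (MonoidAlgebra.coeffAddEquiv (R := ℂ) (M := FreeMonoid X)).toAddMonoidHom

theorem starHom_mono (w : FreeMonoid X) (c : ℂ) : starHom (mono w c) = mono (star w) (star c) := by
  show Finsupp.liftAddHom _ (Finsupp.single w c) = _
  rw [Finsupp.liftAddHom_apply_single]
  rfl

instance : StarRing (FreeStarAlgebra X) where
  star := starHom
  star_involutive a := by
    show starHom (starHom a) = a
    induction a using induction_mono with
    | h0 => simp
    | hm w c => simp [starHom_mono]
    | ha a b ha hb => simp [ha, hb]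
  star_mul a b := by
    show starHom (a * b) = starHom b * starHom a
    induction a using induction_mono with
    | h0 => simp
    | hm w c =>
      induction b using induction_mono with
      | h0 => simp
      | hm w' c' => simp [starHom_mono, mono_mul, mul_comm]
      | ha b b' hb hb' => simp [mul_add, add_mul, hb, hb']
    | ha a a' ha ha' => simp [mul_add, add_mul, ha, ha']
  star_add a b := map_add starHom a b

theorem star_mono (w : FreeMonoid X) (c : ℂ) : star (mono w c) = mono (star w) (star c) :=
  starHom_mono w c

instance : StarModule ℂ (FreeStarAlgebra X) where
  star_smul r a := by
    induction a using induction_mono with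
    | h0 => simp
    | hm w c => simp [smul_mono, star_mono]
    | ha a b ha hb => simp [ha, hb]

end FreeStarAlgebra

/-! ### C*-seminorms -/

/-- A C*-seminorm on a unital complex `*`-algebra: a submultiplicative seminorm that satisfies the
C*-identity. -/
structure CStarSeminorm (A : Type*) [Ring A] [StarRing A] [Algebra ℂ A] extends
    Seminorm ℂ A where
  mul_le' : ∀ a b : A, toFun (a * b) ≤ toFun a * toFun b
  star_mul_self' : ∀ a : A, toFun (star a * a) = toFun a ^ 2

namespace CStarSeminorm

variable {A : Type*} [Ring A] [StarRing A] [Algebra ℂ A]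

instance : CoeFun (CStarSeminorm A) (fun _ => A → ℝ) := ⟨fun q => q.toSeminorm⟩

theorem mul_le (q : CStarSeminorm A) (a b : A) : q (a * b) ≤ q a * q b := q.mul_le' a b

theorem star_mul_self (q : CStarSeminorm A) (a : A) : q (star a * a) = q a ^ 2 :=
  q.star_mul_self' a

theorem nonneg (q : CStarSeminorm A) (a : A) : 0 ≤ q a := apply_nonneg q.toSeminorm a

theorem le_star (q : CStarSeminorm A) (a : A) : q a ≤ q (star a) := by
  have h1 := q.mul_le (star a) a
  rw [q.star_mul_self] at h1
  rcases (q.nonneg a).eq_or_lt with h | h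
  · rw [← h]; exact q.nonneg _
  · nlinarith

theorem apply_star (q : CStarSeminorm A) (a : A) : q (star a) = q a :=
  le_antisymm (by simpa using q.le_star (star a)) (q.le_star a)

theorem apply_one_le (q : CStarSeminorm A) : q 1 ≤ 1 := by
  have h := q.star_mul_self 1
  simp only [star_one, mul_one] at h
  nlinarith [q.nonneg 1]

/-- The zero C*-seminorm. -/
instance : Inhabited (CStarSeminorm A) :=
  ⟨{ toSeminorm := 0
     mul_le' := fun a b => by change (0 : ℝ) ≤ 0 * 0; simp
     star_mul_self' := fun a => by change (0 : ℝ) = 0 ^ 2; simp }⟩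

end CStarSeminorm

/-! ### Bipartite graphs and their C*-algebras -/

/-- A bipartite graph with (disjoint) vertex sets `U` and `V`; `G.Adj u v` says that `{u, v}` is an
edge. -/
@[ext] structure BipartiteGraph (U V : Type*) where
  /-- the edge relation -/
  Adj : U → V → Prop

namespace BipartiteGraph

variable {U V : Type*} [Fintype U] [Fintype V]

/-- A C*-seminorm `q` on the free `*`-algebra on `(p_x)`, `x ∈ U ∪ V`, is `G`-admissible if the
following relations hold modulo `q`: every `p_x` is a projection (the generators are self-adjoint
already), `∑ u, p_u = 1 = ∑ v, p_v`, and `p_u p_v = 0` whenever `{u, v}` is not an edge. -/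
structure Admissible (G : BipartiteGraph U V)
    (q : CStarSeminorm (FreeStarAlgebra (U ⊕ V))) : Prop where
  proj : ∀ x : U ⊕ V,
    q (FreeStarAlgebra.gen x * FreeStarAlgebra.gen x - FreeStarAlgebra.gen x) = 0
  sum_left : q (∑ u : U, FreeStarAlgebra.gen (Sum.inl u) - 1) = 0
  sum_right : q (∑ v : V, FreeStarAlgebra.gen (Sum.inr v) - 1) = 0
  orth : ∀ (u : U) (v : V), ¬ G.Adj u v →
    q (FreeStarAlgebra.gen (Sum.inl u) * FreeStarAlgebra.gen (Sum.inr v)) = 0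

variable (G : BipartiteGraph U V)

/-- The index type of all `G`-admissible C*-seminorms. -/
abbrev AdmissibleSeminorm : Type _ :=
  {q : CStarSeminorm (FreeStarAlgebra (U ⊕ V)) // G.Admissible q}

instance : Nonempty G.AdmissibleSeminorm :=
  ⟨⟨default, ⟨fun _ => rfl, rfl, rfl, fun _ _ _ => rfl⟩⟩⟩

variable {G}

theorem Admissible.gen_le {q : CStarSeminorm (FreeStarAlgebra (U ⊕ V))} (hq : G.Admissible q)
    (x : U ⊕ V) : q (FreeStarAlgebra.gen x) ≤ 1 := by
  have h1 := q.star_mul_self (FreeStarAlgebra.gen x)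
  have h2 : star (FreeStarAlgebra.gen x) = FreeStarAlgebra.gen x := by
    simp [FreeStarAlgebra.gen, FreeStarAlgebra.star_mono]
  rw [h2] at h1
  have h3 := map_add_le_add q.toSeminorm
    (FreeStarAlgebra.gen x * FreeStarAlgebra.gen x - FreeStarAlgebra.gen x)
    (FreeStarAlgebra.gen x)
  rw [sub_add_cancel, hq.proj x, h1] at h3
  nlinarith [q.nonneg (FreeStarAlgebra.gen x)]

theorem Admissible.mono_le {q : CStarSeminorm (FreeStarAlgebra (U ⊕ V))} (hq : G.Admissible q)
    (w : FreeMonoid (U ⊕ V)) (c : ℂ) : q (FreeStarAlgebra.mono w c) ≤ ‖c‖ := by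
  have h : q (FreeStarAlgebra.mono w 1) ≤ 1 := by
    induction w using FreeMonoid.recOn with
    | one => exact q.apply_one_le
    | of_mul x w hw =>
      have h1 := q.mul_le (FreeStarAlgebra.gen x) (FreeStarAlgebra.mono w 1)
      rw [FreeStarAlgebra.gen, FreeStarAlgebra.mono_mul, mul_one] at h1
      refine h1.trans (mul_le_one₀ (hq.gen_le x) (q.nonneg _) hw)
  have h1 : FreeStarAlgebra.mono w c = c • FreeStarAlgebra.mono w 1 := by
    rw [FreeStarAlgebra.smul_mono, mul_one]
  rw [h1, map_smul_eq_mul]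
  exact mul_le_of_le_one_right (norm_nonneg _) h

variable (G) in
theorem bddAbove_admissible (a : FreeStarAlgebra (U ⊕ V)) :
    BddAbove (Set.range fun q : G.AdmissibleSeminorm => q.1 a) := by
  induction a using FreeStarAlgebra.induction_mono with
  | h0 =>
    refine ⟨0, ?_⟩
    rintro _ ⟨q, rfl⟩
    simp
  | hm w c =>
    refine ⟨‖c‖, ?_⟩
    rintro _ ⟨q, rfl⟩
    exact q.2.mono_le w c
  | ha a b ha hb =>
    obtain ⟨A, hA⟩ := ha
    obtain ⟨B, hB⟩ := hb
    refine ⟨A + B, ?_⟩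
    rintro _ ⟨q, rfl⟩
    exact (map_add_le_add q.1.toSeminorm a b).trans (add_le_add (hA ⟨q, rfl⟩) (hB ⟨q, rfl⟩))

variable (G) in
/-- The universal C*-seminorm: the supremum of all `G`-admissible C*-seminorms. -/
def universalSeminorm : CStarSeminorm (FreeStarAlgebra (U ⊕ V)) where
  toFun a := ⨆ q : G.AdmissibleSeminorm, q.1 a
  map_zero' := by simp
  add_le' a b := ciSup_le fun q => (map_add_le_add q.1.toSeminorm a b).trans
    (add_le_add (le_ciSup (G.bddAbove_admissible a) q) (le_ciSup (G.bddAbove_admissible b) q))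
  neg' a := by simp
  smul' c a := by
    simp only [map_smul_eq_mul]
    exact (Real.mul_iSup_of_nonneg (norm_nonneg c) _).symm
  mul_le' a b := ciSup_le fun q => (q.1.mul_le a b).trans
    (mul_le_mul (le_ciSup (G.bddAbove_admissible a) q) (le_ciSup (G.bddAbove_admissible b) q)
      (q.1.nonneg b) (Real.iSup_nonneg fun q => q.1.nonneg a))
  star_mul_self' a := by
    simp only [CStarSeminorm.star_mul_self]
    exact (Real.iSup_pow (fun q : G.AdmissibleSeminorm => q.1.nonneg a) 2).symm

/-- The free `*`-algebra on `U ∪ V`, carrying the universal C*-seminorm of `G`. -/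
def PreCStar (_G : BipartiteGraph U V) : Type _ := FreeStarAlgebra (U ⊕ V)

instance instRingPreCStar : Ring G.PreCStar := inferInstanceAs (Ring (FreeStarAlgebra (U ⊕ V)))

instance : StarRing G.PreCStar := inferInstanceAs (StarRing (FreeStarAlgebra (U ⊕ V)))

instance : Algebra ℂ G.PreCStar := inferInstanceAs (Algebra ℂ (FreeStarAlgebra (U ⊕ V)))

instance : StarModule ℂ G.PreCStar := inferInstanceAs (StarModule ℂ (FreeStarAlgebra (U ⊕ V)))

variable (G) in
/-- The identity map, as an isomorphism of `*`-algebras. -/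
def PreCStar.of : FreeStarAlgebra (U ⊕ V) ≃⋆ₐ[ℂ] G.PreCStar :=
  StarAlgEquiv.refl ℂ (FreeStarAlgebra (U ⊕ V))

instance instSeminormedRingPreCStar : SeminormedRing G.PreCStar where
  __ := instRingPreCStar
  __ := (G.universalSeminorm.toSeminorm.toAddGroupSeminorm).toSeminormedAddCommGroup
  norm_mul_le := G.universalSeminorm.mul_le

theorem PreCStar.norm_of (a : FreeStarAlgebra (U ⊕ V)) :
    ‖PreCStar.of G a‖ = G.universalSeminorm a := rfl

instance : NormedAlgebra ℂ G.PreCStar where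
  norm_smul_le c a := (map_smul_eq_mul G.universalSeminorm.toSeminorm c a).le

instance : NormedStarGroup G.PreCStar where
  norm_star_le a := (G.universalSeminorm.apply_star a).le

variable (G) in
/-- The bipartite graph C*-algebra `C*(G)`, i.e. the universal C*-algebra generated by projections
`(p_x)`, `x ∈ U ∪ V`, with `∑ u, p_u = 1 = ∑ v, p_v` and `p_u p_v = 0` for `{u, v}` not an edge:
the Hausdorff completion of the free `*`-algebra in the universal C*-seminorm. -/
def CStar : Type _ := UniformSpace.Completion G.PreCStar

namespace CStar

open UniformSpace

instance instNormedRing : NormedRing G.CStar := inferInstanceAs (NormedRing (Completion G.PreCStar))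

instance : CompleteSpace G.CStar := inferInstanceAs (CompleteSpace (Completion G.PreCStar))

instance : Algebra ℂ G.CStar := inferInstanceAs (Algebra ℂ (Completion G.PreCStar))

instance : NormedAlgebra ℂ G.CStar where
  norm_smul_le := fun c (a : Completion G.PreCStar) => norm_smul_le c a

/-- The canonical map from the free `*`-algebra. -/
def ofPre (a : G.PreCStar) : G.CStar := (a : Completion G.PreCStar)

/-- The generating projection `p_x` of `C*(G)`. -/
def p (x : U ⊕ V) : G.CStar := ofPre (PreCStar.of G (FreeStarAlgebra.gen x))

theorem continuous_ofPre : Continuous (ofPre : G.PreCStar → G.CStar) :=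
  Completion.continuous_coe _

theorem denseRange_ofPre : DenseRange (ofPre : G.PreCStar → G.CStar) :=
  Completion.denseRange_coe

theorem norm_ofPre (a : G.PreCStar) : ‖ofPre a‖ = ‖a‖ := Completion.norm_coe a

theorem ofPre_add (a b : G.PreCStar) : ofPre (a + b) = ofPre a + ofPre b := Completion.coe_add a b

theorem ofPre_mul (a b : G.PreCStar) : ofPre (a * b) = ofPre a * ofPre b := Completion.coe_mul a b

theorem ofPre_smul (c : ℂ) (a : G.PreCStar) : ofPre (c • a) = c • ofPre a :=
  Completion.coe_smul c a

/-- The involution of `C*(G)`, extended by continuity. -/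
instance : Star G.CStar := ⟨Completion.map (star : G.PreCStar → G.PreCStar)⟩

theorem continuous_star' : Continuous (star : G.CStar → G.CStar) := Completion.continuous_map

theorem star_ofPre (a : G.PreCStar) : star (ofPre a) = ofPre (star a) :=
  Completion.map_coe (star_isometry (E := G.PreCStar)).uniformContinuous a

instance : StarRing G.CStar where
  star_involutive a := by
    refine isClosed_property denseRange_ofPre (p := fun a => star (star a) = a)
      (isClosed_eq (continuous_star'.comp continuous_star') continuous_id) (fun a => ?_) a
    simp [star_ofPre]
  star_mul a b := by
    refine isClosed_property2 denseRange_ofPre (p := fun a b => star (a * b) = star b * star a)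
      (isClosed_eq (continuous_star'.comp (continuous_fst.mul continuous_snd))
        ((continuous_star'.comp continuous_snd).mul (continuous_star'.comp continuous_fst)))
      (fun a b => ?_) a b
    simp [star_ofPre, ← ofPre_mul]
  star_add a b := by
    refine isClosed_property2 denseRange_ofPre (p := fun a b => star (a + b) = star a + star b)
      (isClosed_eq (continuous_star'.comp (continuous_fst.add continuous_snd))
        ((continuous_star'.comp continuous_fst).add (continuous_star'.comp continuous_snd)))
      (fun a b => ?_) a b
    simp [star_ofPre, ← ofPre_add]

instance : StarModule ℂ G.CStar where
  star_smul c a := by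
    refine isClosed_property denseRange_ofPre (p := fun a => star (c • a) = star c • star a)
      (isClosed_eq (continuous_star'.comp (continuous_const_smul c))
        (continuous_star'.const_smul (star c))) (fun a => ?_) a
    simp [star_ofPre, ← ofPre_smul]

instance : CStarRing G.CStar where
  norm_mul_self_le a := by
    refine isClosed_property denseRange_ofPre (p := fun a => ‖a‖ * ‖a‖ ≤ ‖star a * a‖)
      (isClosed_le (continuous_norm.mul continuous_norm)
        (continuous_star'.mul continuous_id).norm) (fun a => ?_) a
    rw [star_ofPre, ← ofPre_mul, norm_ofPre, norm_ofPre]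
    exact (((G.universalSeminorm.star_mul_self a).trans (sq _))).ge

instance : CStarAlgebra G.CStar where

end CStar

end BipartiteGraph

/-! ### The spectrum of a C*-algebra -/

/-- An irreducible representation of a unital C*-algebra `A`: a unital `*`-homomorphism into the
bounded operators on a nonzero complex Hilbert space that has no closed invariant subspaces other
than `0` and the whole space. -/
structure IrreducibleRep (A : Type u) [CStarAlgebra A] where
  /-- the Hilbert space -/
  H : Type u
  [normed : NormedAddCommGroup H]
  [inner : InnerProductSpace ℂ H]
  [complete : CompleteSpace H]
  [nontrivial : Nontrivial H]
  /-- the `*`-homomorphism -/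
  hom : A →⋆ₐ[ℂ] (H →L[ℂ] H)
  irreducible : ∀ K : Submodule ℂ H, IsClosed (K : Set H) →
    (∀ a : A, ∀ x ∈ K, hom a x ∈ K) → K = ⊥ ∨ K = ⊤

namespace IrreducibleRep

variable {A : Type u} [CStarAlgebra A]

attribute [instance] normed inner complete nontrivial

/-- Unitary equivalence of irreducible representations. -/
def UnitarilyEquiv (π ρ : IrreducibleRep A) : Prop :=
  ∃ T : π.H ≃ₗᵢ[ℂ] ρ.H, ∀ (a : A) (x : π.H), T (π.hom a x) = ρ.hom a (T x)

instance setoid : Setoid (IrreducibleRep A) where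
  r := UnitarilyEquiv
  iseqv :=
    { refl := fun π => ⟨LinearIsometryEquiv.refl ℂ π.H, fun _ _ => rfl⟩
      symm := fun {π ρ} ⟨T, hT⟩ => ⟨T.symm, fun a x => by
        rw [LinearIsometryEquiv.symm_apply_eq, hT, LinearIsometryEquiv.apply_symm_apply]⟩
      trans := fun {π ρ σ} ⟨T, hT⟩ ⟨S, hS⟩ => ⟨T.trans S, fun a x => by
        simp [hT, hS]⟩ }

/-- The kernel of an irreducible representation. -/
def ker (π : IrreducibleRep A) : Set A := {a | π.hom a = 0}

theorem ker_eq_of_equiv {π ρ : IrreducibleRep A} (h : UnitarilyEquiv π ρ) : π.ker = ρ.ker := by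
  obtain ⟨T, hT⟩ := h
  ext a
  constructor
  · intro (ha : π.hom a = 0)
    show ρ.hom a = 0
    ext y
    have := hT a (T.symm y)
    simpa [ha] using this.symm
  · intro (ha : ρ.hom a = 0)
    show π.hom a = 0
    ext x
    have := hT a x
    simpa [ha] using this

theorem finrank_eq_of_equiv {π ρ : IrreducibleRep A} (h : UnitarilyEquiv π ρ) :
    Module.finrank ℂ π.H = Module.finrank ℂ ρ.H :=
  h.choose.toLinearEquiv.finrank_eq

/-- Kernels of irreducible representations are prime. -/
theorem mem_ker_or_mem_ker (π : IrreducibleRep A) {s t : A}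
    (h : ∀ a : A, s * a * t ∈ π.ker) : s ∈ π.ker ∨ t ∈ π.ker := by
  by_contra! hc
  obtain ⟨hs, ht⟩ := hc
  obtain ⟨x, hx⟩ : ∃ x, π.hom t x ≠ 0 := by
    by_contra! hx
    exact ht (ContinuousLinearMap.ext hx)
  have hmul : ∀ (a b : A) (y : π.H), π.hom (a * b) y = π.hom a (π.hom b y) := fun a b y => by
    rw [map_mul]; rfl
  -- the closed subspace of all `y` with `π(s) π(a) y = 0` for all `a`
  let K : Submodule ℂ π.H := ⨅ a : A, (π.hom (s * a)).ker
  have hK : ∀ y, y ∈ K ↔ ∀ a, π.hom (s * a) y = 0 := fun y => by simp [K, Submodule.mem_iInf]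
  have hcl : IsClosed (K : Set π.H) := by
    have : (K : Set π.H) = ⋂ a : A, {y | π.hom (s * a) y = 0} := by
      ext y; simp [hK]
    rw [this]
    exact isClosed_iInter fun a => isClosed_eq (π.hom (s * a)).continuous continuous_const
  have hinv : ∀ a : A, ∀ y ∈ K, π.hom a y ∈ K := fun a y hy => by
    rw [hK] at hy ⊢
    intro b
    rw [← hmul, mul_assoc]
    exact hy (b * a)
  have hmem : π.hom t x ∈ K := by
    rw [hK]
    intro a
    have : π.hom (s * a * t) = 0 := h a
    rw [← hmul, this]; rfl
  rcases π.irreducible K hcl hinv with hb | htop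
  · rw [hb] at hmem
    exact hx ((Submodule.mem_bot ℂ).1 hmem)
  · refine hs (ContinuousLinearMap.ext fun y => ?_)
    have hy : y ∈ K := htop ▸ Submodule.mem_top
    simpa using (hK y).1 hy 1

end IrreducibleRep

/-- A subset of `A` is a primitive ideal if it is the kernel of an irreducible representation;
`PrimitiveIdeal A` is the set of all primitive ideals of `A`. -/
def PrimitiveIdeal (A : Type u) [CStarAlgebra A] : Type u :=
  {I : Set A // ∃ π : IrreducibleRep A, π.ker = I}

namespace PrimitiveIdeal

variable {A : Type u} [CStarAlgebra A]

/-- The hull of a subset of `A`: the set of all primitive ideals that contain it. -/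
def hull (S : Set A) : Set (PrimitiveIdeal A) := {I | S ⊆ I.1}

/-- The hull-kernel topology: the closed sets are the hulls. -/
instance : TopologicalSpace (PrimitiveIdeal A) :=
  TopologicalSpace.ofClosed (Set.range hull)
    ⟨Set.univ, by
      ext I
      simp only [hull, Set.mem_ofPred_eq, Set.mem_empty_iff_false, iff_false]
      obtain ⟨_, π, rfl⟩ := I
      intro h
      have h1 : π.hom 1 = 0 := h (Set.mem_univ 1)
      rw [map_one] at h1
      exact one_ne_zero h1⟩
    (fun 𝒞 h𝒞 => by
      refine ⟨⋃₀ {S | hull S ∈ 𝒞}, ?_⟩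
      ext I
      simp only [hull, Set.mem_ofPred_eq, Set.mem_sInter, Set.sUnion_subset_iff]
      constructor
      · intro h C hC
        obtain ⟨S, rfl⟩ := h𝒞 hC
        exact h S hC
      · intro h S hS
        exact h _ hS)
    (by
      rintro _ ⟨S, rfl⟩ _ ⟨T, rfl⟩
      refine ⟨{b | ∃ s ∈ S, ∃ a, ∃ t ∈ T, b = s * a * t}, ?_⟩
      ext I
      obtain ⟨_, π, rfl⟩ := I
      show _ ⊆ π.ker ↔ S ⊆ π.ker ∨ T ⊆ π.ker
      constructor
      · intro h
        by_contra hc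
        rw [not_or] at hc
        obtain ⟨s, hs, hs'⟩ := Set.not_subset.1 hc.1
        obtain ⟨t, ht, ht'⟩ := Set.not_subset.1 hc.2
        rcases π.mem_ker_or_mem_ker (s := s) (t := t) fun a => h ⟨s, hs, a, t, ht, rfl⟩ with h | h
        exacts [hs' h, ht' h]
      · rintro (h | h) _ ⟨s, hs, a, t, ht, rfl⟩
        · have : π.hom s = 0 := h hs
          show π.hom (s * a * t) = 0
          simp [this]
        · have : π.hom t = 0 := h ht
          show π.hom (s * a * t) = 0
          simp [this])

end PrimitiveIdeal

/-- The spectrum of a C*-algebra: unitary equivalence classes of irreducible representations. -/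
def CStarSpec (A : Type u) [CStarAlgebra A] : Type (u + 1) :=
  Quotient (IrreducibleRep.setoid (A := A))

namespace CStarSpec

variable {A : Type u} [CStarAlgebra A]

/-- The primitive ideal `ker π` of the class of `π`. -/
def toPrim : CStarSpec A → PrimitiveIdeal A :=
  Quotient.lift (fun π => ⟨π.ker, π, rfl⟩)
    (fun _ _ h => Subtype.ext (IrreducibleRep.ker_eq_of_equiv h))

/-- The dimension of the class of `π`, with the value `0` if it is infinite. -/
def dim : CStarSpec A → ℕ :=
  Quotient.lift (fun π => Module.finrank ℂ π.H)
    (fun _ _ h => IrreducibleRep.finrank_eq_of_equiv h)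

/-- The coarsest topology that makes `π ↦ ker π` continuous. -/
instance : TopologicalSpace (CStarSpec A) := TopologicalSpace.induced toPrim inferInstance

end CStarSpec

/-- The space of (classes of) one- and two-dimensional irreducible representations, with the
subspace topology inherited from the spectrum. -/
abbrev CStarSpecLETwo (A : Type u) [CStarAlgebra A] : Type (u + 1) :=
  {σ : CStarSpec A // σ.dim = 1 ∨ σ.dim = 2}

end

/-! An isomorphism carries irreducible representations and their kernels across, so one direction is
formal. For the converse, `Spec_{≤2}` remembers the edges and the squares of the graph, and these
determine the algebra.

The one-dimensional representations are the edges. The two-dimensional ones are pairs of projections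
in general position in the plane, that is, a square of the graph together with an angle θ in (0,
π/2). As θ tends to 0, the arc of a square converges to two opposite edges at once, and as θ tends
to π/2 to the other two. The norms `lam x y` of p_x p_y p_x serve as coordinates: at points of
dimension at most two this element is a multiple of a projection of rank at most one, so functional
calculus makes {lam ∈ I} open whenever I is open and 0 ∉ I. Hence edge points are exactly those that
are isolated or inseparable from another point (`isIsolatedOrNonseparated_iff`), and squares with
their pairs of opposite edges are read off from connected sets of the remaining points
(`isTopSquare_edgePt_iff`). A homeomorphism thus gives a bijection of edges that respects squares
and opposite edges.

Such a bijection need not come from a graph isomorphism. It labels an edge uv by the two ends a, b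
of its image, and each square either keeps its two sides or has them exchanged. Let I and J be the
two-sided ideals generated by the corners p_u q_v p_u' and q_v p_u q_v' of the kept and of the
flipped squares (`labelIdeal G a b` and `labelIdeal G b a`). Paths that mix the two kinds vanish
(`path_eq_zero`), so I J = 0 (`labelIdeal_mul`) and I ∩ J = 0 by the C*-identity. Modulo J, the sums
of p_u q_v p_u over the edges with left label x and of q_v p_u q_v over the edges with right label y
satisfy the relations of the other graph (`edgeSum_rel`); modulo I the same holds with p and q
exchanged. Modulo I + J all generators commute and the two prescriptions agree, so they glue
(`exists_glue`) to a *-homomorphism. The inverse bijection yields the inverse homomorphism, which is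
checked modulo I and modulo J (`comp_eq_id`). -/

/-! ### Families of idempotents satisfying the relations of a bipartite graph -/

/-- Families `p`, `q` of elements of a ring that satisfy the relations of the bipartite graph with
edge relation `Adj`: both consist of orthogonal idempotents with sum `1`, and `p u` and `q v` are
orthogonal whenever `u` and `v` are not adjacent. -/
structure BipartiteRel {U V R : Type*} [Fintype U] [Fintype V] [Ring R] (Adj : U → V → Prop)
    (p : U → R) (q : V → R) : Prop where
  idem_left : ∀ u, p u * p u = p u
  orth_left : ∀ u u', u ≠ u' → p u * p u' = 0
  sum_left : ∑ u, p u = 1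
  idem_right : ∀ v, q v * q v = q v
  orth_right : ∀ v v', v ≠ v' → q v * q v' = 0
  sum_right : ∑ v, q v = 1
  left_mul_right : ∀ u v, ¬ Adj u v → p u * q v = 0
  right_mul_left : ∀ u v, ¬ Adj u v → q v * p u = 0

namespace BipartiteRel

variable {U V R : Type*} [Fintype U] [Fintype V] [Ring R] {Adj : U → V → Prop}
  {p : U → R} {q : V → R}

theorem swap (h : BipartiteRel Adj p q) : BipartiteRel (flip Adj) q p :=
  ⟨h.idem_right, h.orth_right, h.sum_right, h.idem_left, h.orth_left, h.sum_left,
    fun v u => h.right_mul_left u v, fun v u => h.left_mul_right u v⟩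

theorem map (h : BipartiteRel Adj p q) {S : Type*} [Ring S] (f : R →+* S) :
    BipartiteRel Adj (fun u => f (p u)) (fun v => f (q v)) where
  idem_left u := by rw [← map_mul, h.idem_left]
  orth_left u u' hu := by rw [← map_mul, h.orth_left u u' hu, map_zero]
  sum_left := by rw [← map_sum, h.sum_left, map_one]
  idem_right v := by rw [← map_mul, h.idem_right]
  orth_right v v' hv := by rw [← map_mul, h.orth_right v v' hv, map_zero]
  sum_right := by rw [← map_sum, h.sum_right, map_one]
  left_mul_right u v hu := by rw [← map_mul, h.left_mul_right u v hu, map_zero]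
  right_mul_left u v hu := by rw [← map_mul, h.right_mul_left u v hu, map_zero]

end BipartiteRel

/-- Projections in a C*-algebra with sum `1` are pairwise orthogonal. -/
theorem CStarAlgebra.mul_eq_zero_of_sum_eq_one {A ι : Type*} [CStarAlgebra A] [Fintype ι]
    {p : ι → A} (hp : ∀ i, IsSelfAdjoint (p i)) (hi : ∀ i, p i * p i = p i) (hs : ∑ i, p i = 1)
    (i j : ι) (hij : i ≠ j) : p i * p j = 0 := by
  classical
  let _ := CStarAlgebra.spectralOrder A
  have := CStarAlgebra.spectralOrderedRing A
  -- Removing the term k = j leaves a vanishing sum of positive elements, so each of them is zero.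
  have h1 : ∑ k, p j * p k * p j = p j := by
    rw [← Finset.sum_mul, ← Finset.mul_sum, hs, mul_one, hi]
  rw [← Finset.add_sum_erase _ _ (Finset.mem_univ j), hi, hi, add_eq_left] at h1
  have h2 : ∀ k, p j * p k * p j = star (p k * p j) * (p k * p j) := fun k => by
    rw [star_mul, (hp j).star_eq, (hp k).star_eq, mul_assoc, mul_assoc, ← mul_assoc (p k) (p k),
      hi k]
  have h3 := (Finset.sum_eq_zero_iff_of_nonneg fun k _ => by
    rw [h2]; exact star_mul_self_nonneg _).1 h1 i (Finset.mem_erase.2 ⟨hij, Finset.mem_univ i⟩)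
  rw [h2] at h3
  exact (CStarRing.star_mul_self_eq_zero_iff _).1 h3

/-! ### The universal property of `C*(G)` -/

namespace FreeStarAlgebra

variable {X B : Type*} [Ring B] [StarRing B] [Algebra ℂ B] [StarModule ℂ B]

/-- The algebra homomorphism on the free `*`-algebra with given values on the generators. -/
noncomputable def liftAlgHom (f : X → B) : FreeStarAlgebra X →ₐ[ℂ] B :=
  (MonoidAlgebra.lift ℂ B (FreeMonoid X) (FreeMonoid.lift f) :
    MonoidAlgebra ℂ (FreeMonoid X) →ₐ[ℂ] B)

omit [StarRing B] [StarModule ℂ B] in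
theorem liftAlgHom_mono (f : X → B) (w : FreeMonoid X) (c : ℂ) :
    liftAlgHom f (mono w c) = c • FreeMonoid.lift f w :=
  MonoidAlgebra.lift_single ..

/-- The `*`-homomorphism on the free `*`-algebra with given self-adjoint values on the
generators. -/
noncomputable def lift (f : X → B) (hf : ∀ x, IsSelfAdjoint (f x)) :
    FreeStarAlgebra X →⋆ₐ[ℂ] B where
  __ := liftAlgHom f
  map_star' a := by
    show liftAlgHom f (star a) = star (liftAlgHom f a)
    have hw : ∀ w : FreeMonoid X, FreeMonoid.lift f (star w) = star (FreeMonoid.lift f w) := by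
      intro w
      induction w using FreeMonoid.recOn with
      | one => simp
      | of_mul x w hw => simp [hw, (hf x).star_eq]
    induction a using induction_mono with
    | h0 => simp
    | hm w c => rw [star_mono, liftAlgHom_mono, liftAlgHom_mono, hw, star_smul]
    | ha a b ha hb => rw [star_add, map_add, map_add, ha, hb, star_add]

theorem lift_gen (f : X → B) (hf : ∀ x, IsSelfAdjoint (f x)) (x : X) :
    lift f hf (gen x) = f x :=
  (liftAlgHom_mono f _ _).trans (by simp)

end FreeStarAlgebra

/-- The C*-seminorm induced by a `*`-homomorphism into a C*-algebra. -/
def CStarSeminorm.comap {A B : Type*} [Ring A] [StarRing A] [Algebra ℂ A] [CStarAlgebra B]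
    (f : A →⋆ₐ[ℂ] B) : CStarSeminorm A where
  toFun a := ‖f a‖
  map_zero' := by simp
  add_le' a b := by simpa using norm_add_le (f a) (f b)
  neg' a := by simp
  smul' c a := by simp [norm_smul]
  mul_le' a b := by simpa using norm_mul_le (f a) (f b)
  star_mul_self' a := by
    show ‖f (star a * a)‖ = ‖f a‖ ^ 2
    rw [map_mul, map_star, CStarRing.norm_star_mul_self, sq]

theorem CStarSeminorm.comap_apply {A B : Type*} [Ring A] [StarRing A] [Algebra ℂ A]
    [CStarAlgebra B] (f : A →⋆ₐ[ℂ] B) (a : A) : CStarSeminorm.comap f a = ‖f a‖ := rfl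

namespace BipartiteGraph.CStar

variable {U V : Type*} [Fintype U] [Fintype V] {G : BipartiteGraph U V}

theorem ofPre_of_eq_zero {a : FreeStarAlgebra (U ⊕ V)}
    (h : ∀ q : G.AdmissibleSeminorm, q.1 a = 0) : ofPre (PreCStar.of G a) = 0 := by
  rw [← norm_eq_zero, norm_ofPre, PreCStar.norm_of]
  show (⨆ q : G.AdmissibleSeminorm, q.1 a) = 0
  simp [h]

/-- The canonical map from the free `*`-algebra, as a `*`-homomorphism. -/
noncomputable def ofFree (G : BipartiteGraph U V) : FreeStarAlgebra (U ⊕ V) →⋆ₐ[ℂ] G.CStar where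
  toFun a := ofPre (PreCStar.of G a)
  map_one' := rfl
  map_mul' a b := by rw [map_mul, ofPre_mul]
  map_zero' := rfl
  map_add' a b := by rw [map_add, ofPre_add]
  commutes' c := rfl
  map_star' a := by rw [map_star, star_ofPre]

theorem denseRange_ofFree : DenseRange (ofFree G) := denseRange_ofPre

theorem ofFree_gen (x : U ⊕ V) : ofFree G (FreeStarAlgebra.gen x) = p x := rfl

theorem isSelfAdjoint_p (x : U ⊕ V) : IsSelfAdjoint (p x : G.CStar) := by
  rw [IsSelfAdjoint, ← ofFree_gen, ← map_star]
  simp [FreeStarAlgebra.gen, FreeStarAlgebra.star_mono]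

theorem p_mul_self (x : U ⊕ V) : (p x * p x : G.CStar) = p x := by
  rw [← sub_eq_zero, ← ofFree_gen, ← map_mul, ← map_sub]
  exact ofPre_of_eq_zero fun q => q.2.proj x

theorem sum_p_inl : ∑ u, (p (Sum.inl u) : G.CStar) = 1 := by
  simp only [← ofFree_gen]
  rw [← sub_eq_zero, ← map_sum, ← map_one (ofFree G), ← map_sub]
  exact ofPre_of_eq_zero fun q => q.2.sum_left

theorem sum_p_inr : ∑ v, (p (Sum.inr v) : G.CStar) = 1 := by
  simp only [← ofFree_gen]
  rw [← sub_eq_zero, ← map_sum, ← map_one (ofFree G), ← map_sub]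
  exact ofPre_of_eq_zero fun q => q.2.sum_right

theorem p_inl_mul_p_inr {u : U} {v : V} (h : ¬ G.Adj u v) :
    (p (Sum.inl u) * p (Sum.inr v) : G.CStar) = 0 := by
  rw [← ofFree_gen, ← ofFree_gen, ← map_mul]
  exact ofPre_of_eq_zero fun q => q.2.orth u v h

variable (G) in
theorem bipartiteRel :
    BipartiteRel G.Adj (fun u => (p (Sum.inl u) : G.CStar)) (fun v => p (Sum.inr v)) where
  idem_left u := p_mul_self _
  orth_left := CStarAlgebra.mul_eq_zero_of_sum_eq_one (fun _ => isSelfAdjoint_p _)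
    (fun _ => p_mul_self _) sum_p_inl
  sum_left := sum_p_inl
  idem_right v := p_mul_self _
  orth_right := CStarAlgebra.mul_eq_zero_of_sum_eq_one (fun _ => isSelfAdjoint_p _)
    (fun _ => p_mul_self _) sum_p_inr
  sum_right := sum_p_inr
  left_mul_right _ _ := p_inl_mul_p_inr
  right_mul_left u v h := by
    have := congrArg star (p_inl_mul_p_inr (G := G) h)
    simpa [(isSelfAdjoint_p _).star_eq] using this

/-- Induction on elements of `C*(G)`: a closed property of `1` that is preserved under linear
combinations and under multiplication by generators from the left holds everywhere. -/
theorem induction {P : G.CStar → Prop} (hc : IsClosed {a | P a}) (h1 : P 1)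
    (hadd : ∀ a b, P a → P b → P (a + b)) (hsmul : ∀ (c : ℂ) a, P a → P (c • a))
    (hmul : ∀ x a, P a → P (p x * a)) (a : G.CStar) : P a := by
  refine isClosed_property denseRange_ofFree hc (fun a => ?_) a
  induction a using FreeStarAlgebra.induction_mono with
  | h0 => simpa using hsmul 0 1 h1
  | hm w c =>
    have : FreeStarAlgebra.mono w c = c • FreeStarAlgebra.mono w 1 := by
      rw [FreeStarAlgebra.smul_mono, mul_one]
    rw [this, map_smul]
    refine hsmul _ _ ?_
    induction w using FreeMonoid.recOn with
    | one => rw [FreeStarAlgebra.mono_one, map_one]; exact h1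
    | of_mul x w hw =>
      have : FreeStarAlgebra.mono (FreeMonoid.of x * w) 1 =
          FreeStarAlgebra.gen x * FreeStarAlgebra.mono w 1 := by
        rw [FreeStarAlgebra.gen, FreeStarAlgebra.mono_mul, mul_one]
      rw [this, map_mul, ofFree_gen]
      exact hmul _ _ (hw (by rw [FreeStarAlgebra.smul_mono, mul_one]))
  | ha a b ha hb => rw [map_add]; exact hadd _ _ ha hb

section Lift

variable {B : Type*} [CStarAlgebra B]

theorem continuous_hom {A : Type*} [CStarAlgebra A] (f : A →⋆ₐ[ℂ] B) : Continuous f :=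
  AddMonoidHomClass.continuous_of_bound f 1 fun a => by
    rw [one_mul]; exact NonUnitalStarAlgHom.norm_apply_le f a

/-- Two `*`-homomorphisms on `C*(G)` agree if they agree on the generators. -/
theorem hom_ext {f g : G.CStar →⋆ₐ[ℂ] B} (h : ∀ x, f (p x) = g (p x)) : f = g := by
  ext a
  refine induction (P := fun a => f a = g a) (isClosed_eq (continuous_hom f) (continuous_hom g)) (by simp)
    (fun a b ha hb => by simp [ha, hb]) (fun c a ha => by simp [ha])
    (fun x a ha => by simp [ha, h]) a

variable {P : U → B} {Q : V → B}

/-- The norm pulled back along the lift is an admissible C*-seminorm, and the universal one is the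
supremum of these. -/
theorem norm_lift_le (hP : ∀ u, IsSelfAdjoint (P u)) (hQ : ∀ v, IsSelfAdjoint (Q v))
    (h : BipartiteRel G.Adj P Q) (a : FreeStarAlgebra (U ⊕ V)) :
    ‖FreeStarAlgebra.lift (Sum.elim P Q) (Sum.rec hP hQ) a‖ ≤ ‖PreCStar.of G a‖ := by
  rw [PreCStar.norm_of]
  refine le_ciSup (G.bddAbove_admissible a) ⟨CStarSeminorm.comap
    (FreeStarAlgebra.lift (Sum.elim P Q) (Sum.rec hP hQ)), ?_, ?_, ?_, ?_⟩
  · rintro (u | v) <;> rw [CStarSeminorm.comap_apply, norm_eq_zero] <;>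
      simp [FreeStarAlgebra.lift_gen, h.idem_left, h.idem_right]
  · rw [CStarSeminorm.comap_apply, norm_eq_zero]
    simp [FreeStarAlgebra.lift_gen, h.sum_left]
  · rw [CStarSeminorm.comap_apply, norm_eq_zero]
    simp [FreeStarAlgebra.lift_gen, h.sum_right]
  · intro u v huv
    rw [CStarSeminorm.comap_apply, norm_eq_zero]
    simp [FreeStarAlgebra.lift_gen, h.left_mul_right u v huv]

theorem exists_lift (hP : ∀ u, IsSelfAdjoint (P u)) (hQ : ∀ v, IsSelfAdjoint (Q v))
    (h : BipartiteRel G.Adj P Q) :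
    ∃ f : G.CStar →⋆ₐ[ℂ] B, (∀ u, f (p (Sum.inl u)) = P u) ∧ ∀ v, f (p (Sum.inr v)) = Q v := by
  let φ : FreeStarAlgebra (U ⊕ V) →⋆ₐ[ℂ] B :=
    FreeStarAlgebra.lift (Sum.elim P Q) (Sum.rec hP hQ)
  let ψ : G.PreCStar →+* B := (φ : FreeStarAlgebra (U ⊕ V) →+* B)
  have hψ : Continuous ψ :=
    AddMonoidHomClass.continuous_of_bound ψ 1 fun a => by
      rw [one_mul]; exact norm_lift_le hP hQ h a
  let F : G.CStar →+* B := UniformSpace.Completion.extensionHom ψ hψ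
  have hF : ∀ a, F (ofFree G a) = φ a := fun a =>
    UniformSpace.Completion.extensionHom_coe ψ hψ a
  have hFc : Continuous F := UniformSpace.Completion.continuous_extension
  refine ⟨{ F with
    commutes' := fun c => ?_
    map_star' := fun a => ?_ }, fun u => ?_, fun v => ?_⟩
  · have := hF (algebraMap ℂ _ c)
    rw [AlgHomClass.commutes φ] at this
    exact this
  · refine isClosed_property denseRange_ofFree (p := fun a => F (star a) = star (F a))
      (isClosed_eq (hFc.comp continuous_star) (continuous_star.comp hFc)) (fun a => ?_) a
    rw [← map_star, hF, hF, map_star]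
  · exact (hF _).trans (FreeStarAlgebra.lift_gen ..)
  · exact (hF _).trans (FreeStarAlgebra.lift_gen ..)

/-- The universal property of `C*(G)`: the `*`-homomorphism with given values on the
generators. -/
noncomputable def lift (hP : ∀ u, IsSelfAdjoint (P u)) (hQ : ∀ v, IsSelfAdjoint (Q v))
    (h : BipartiteRel G.Adj P Q) : G.CStar →⋆ₐ[ℂ] B :=
  (exists_lift hP hQ h).choose

@[simp] theorem lift_inl (hP : ∀ u, IsSelfAdjoint (P u)) (hQ : ∀ v, IsSelfAdjoint (Q v))
    (h : BipartiteRel G.Adj P Q) (u : U) : lift hP hQ h (p (Sum.inl u)) = P u :=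
  (exists_lift hP hQ h).choose_spec.1 u

@[simp] theorem lift_inr (hP : ∀ u, IsSelfAdjoint (P u)) (hQ : ∀ v, IsSelfAdjoint (Q v))
    (h : BipartiteRel G.Adj P Q) (v : V) : lift hP hQ h (p (Sum.inr v)) = Q v :=
  (exists_lift hP hQ h).choose_spec.2 v

end Lift

end BipartiteGraph.CStar

/-! ### Edge labels that respect squares -/

/-- Labels `a`, `b` of the edges of a bipartite graph that jointly separate edges and that identify
every square of the graph with a square of the bipartite graph on the labels, with opposite edges
corresponding to opposite edges. -/
structure SquareLabels {U V X Y : Type*} (Adj : U → V → Prop) (a : U → V → X) (b : U → V → Y) :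
    Prop where
  inj : ∀ u v u' v', Adj u v → Adj u' v' → a u v = a u' v' → b u v = b u' v' → u = u' ∧ v = v'
  square : ∀ u u' v v', u ≠ u' → v ≠ v' → Adj u v → Adj u v' → Adj u' v → Adj u' v' →
    (a u v = a u v' ∧ a u' v' = a u' v ∧ b u v = b u' v ∧ b u' v' = b u v' ∧
      a u v ≠ a u' v' ∧ b u v ≠ b u' v') ∨
    (b u v = b u v' ∧ b u' v' = b u' v ∧ a u v = a u' v ∧ a u' v' = a u v' ∧
      a u v ≠ a u' v' ∧ b u v ≠ b u' v')

namespace SquareLabels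

variable {U V X Y : Type*} {Adj : U → V → Prop} {a : U → V → X} {b : U → V → Y}

theorem symm (L : SquareLabels Adj a b) : SquareLabels Adj b a where
  inj u v u' v' h h' hb ha := L.inj u v u' v' h h' ha hb
  square u u' v v' hu hv h1 h2 h3 h4 := by
    have := L.square u u' v v' hu hv h1 h2 h3 h4
    tauto

theorem swap (L : SquareLabels Adj a b) : SquareLabels (flip Adj) (flip a) (flip b) where
  inj v u v' u' h h' ha hb := (L.inj u v u' v' h h' ha hb).symm
  square v v' u u' hv hu h1 h2 h3 h4 := by
    have := L.square u u' v v' hu hv h1 h3 h2 h4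
    simp only [flip]
    tauto

end SquareLabels

/-- The products `p u * q v * p u'` for edges `{u, v}` and `{u', v}` with `u ≠ u'` and the same
label. -/
def cornerGen {U V R Z : Type*} [Ring R] (Adj : U → V → Prop) (p : U → R) (q : V → R)
    (c : U → V → Z) : Set R :=
  {x | ∃ u u' v, u ≠ u' ∧ Adj u v ∧ Adj u' v ∧ c u v = c u' v ∧ p u * q v * p u' = x}

/-- The generators of the ideal attached to the labels `a`, `b`. -/
def labelGen {U V R X Y : Type*} [Ring R] (Adj : U → V → Prop) (p : U → R) (q : V → R)
    (a : U → V → X) (b : U → V → Y) : Set R :=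
  cornerGen Adj p q b ∪ cornerGen (flip Adj) q p (flip a)

theorem labelGen_swap {U V R X Y : Type*} [Ring R] (Adj : U → V → Prop) (p : U → R) (q : V → R)
    (a : U → V → X) (b : U → V → Y) :
    labelGen (flip Adj) q p (flip a) (flip b) = labelGen Adj p q b a :=
  Set.union_comm _ _

/-! ### Corners of the two kinds annihilate each other. -/

namespace BipartiteRel

variable {U V X Y R : Type*} [Fintype U] [Fintype V] [Ring R] {Adj : U → V → Prop}
  {p : U → R} {q : V → R} {a : U → V → X} {b : U → V → Y}

theorem sum_mul_mul (h : BipartiteRel Adj p q) (x y : R) : ∑ v, x * q v * y = x * y := by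
  rw [← Finset.sum_mul, ← Finset.mul_sum, h.sum_right, mul_one]

-- Inserting `∑ w, q w = 1` between the orthogonal `p u` and `p u'` trades a corner at v for the
-- corners at the other vertices.
open Classical in
theorem mul_mul_eq_neg_sum (h : BipartiteRel Adj p q) {u u' : U} (hu : u ≠ u') (v : V) :
    p u * q v * p u' = -∑ w ∈ Finset.univ.erase v, p u * q w * p u' := by
  have := h.sum_mul_mul (p u) (p u')
  rw [h.orth_left u u' hu, ← Finset.add_sum_erase _ _ (Finset.mem_univ v)] at this
  exact eq_neg_of_add_eq_zero_left this

theorem mul_mul_eq_zero_of_not_adj (h : BipartiteRel Adj p q) {u u' : U} {v : V}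
    (hv : ¬ (Adj u v ∧ Adj u' v)) : p u * q v * p u' = 0 := by
  by_cases h1 : Adj u v
  · rw [mul_assoc, h.right_mul_left u' v fun h2 => hv ⟨h1, h2⟩, mul_zero]
  · rw [h.left_mul_right u v h1, zero_mul]

/-- After the trade only common neighbours other than v contribute, so a nonzero corner always lies
in a square. -/
theorem mul_mul_eq_zero_or_exists (h : BipartiteRel Adj p q) {u u' : U} (hu : u ≠ u') (v : V) :
    p u * q v * p u' = 0 ∨ ∃ w, w ≠ v ∧ Adj u w ∧ Adj u' w := by
  classical
  by_contra! hc
  refine hc.1 ?_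
  rw [h.mul_mul_eq_neg_sum hu, neg_eq_zero]
  refine Finset.sum_eq_zero fun w hw => h.mul_mul_eq_zero_of_not_adj fun h1 => ?_
  exact hc.2 w (Finset.ne_of_mem_erase hw) h1.1 h1.2

/-- A path of three edges whose labels agree at one of the labels contributes nothing. -/
theorem path_eq_zero (h : BipartiteRel Adj p q) (L : SquareLabels Adj a b) {u u' : U} {v v' : V}
    (hu : u ≠ u') (hv : v ≠ v') (h1 : Adj u v) (h2 : Adj u' v) (h3 : Adj u' v')
    (hb : b u v = b u' v) (hb' : b u' v = b u' v') : p u * q v * p u' * q v' = 0 := by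
  classical
  -- This edge would complete a square whose corners at v and at u' are of different kinds.
  have huv : ¬ Adj u v' := fun h4 => by
    have := L.square u u' v v' hu hv h1 h4 h2 h3
    grind
  -- The inner projection is replaced by `∑ t, p t = 1`; every term except the one at u' will
  -- vanish.
  have hsum : ∑ t, p u * q v * p t * q v' = 0 := by
    rw [h.swap.sum_mul_mul, mul_assoc, h.orth_right v v' hv, mul_zero]
  rw [← Finset.add_sum_erase _ _ (Finset.mem_univ u'), Finset.sum_eq_zero, add_zero] at hsum
  · exact hsum
  intro t ht
  have htu' := Finset.ne_of_mem_erase ht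
  by_cases h4 : Adj t v'
  swap
  · rw [mul_assoc, h.left_mul_right t v' h4, mul_zero]
  by_cases h5 : Adj t v
  swap
  · rw [mul_assoc (p u), h.right_mul_left t v h5, mul_zero, zero_mul]
  have hut : u ≠ t := fun e => huv (e ▸ h4)
  rcases h.mul_mul_eq_zero_or_exists hut v with h6 | ⟨w, hw, h6, h7⟩
  · rw [h6, zero_mul]
  exfalso
  -- The first square is flipped, so (u', v) and (t, v) share a and differ in b. The second makes
  -- (u, v) and (t, v) share a or b: sharing a identifies (u, v) with (u', v), sharing b contradicts
  -- the first square.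
  have s1 := L.square u' t v v' htu'.symm hv h2 h3 h5 h4
  have s2 := L.square u t v w hut hw.symm h1 h6 h5 h7
  have := L.inj u v u' v h1 h2
  grind

/-- This keeps the left ideal spanned by `labelGen` stable under right multiplication by generators.
For v' = v the corner is first traded for the others; for v' ≠ v the second corner vanishes, or is
of the same kind, or `path_eq_zero` applies. -/
theorem cornerGen_mul_right_mem (h : BipartiteRel Adj p q) (L : SquareLabels Adj a b) {x : R}
    (hx : x ∈ cornerGen Adj p q b) (v' : V) :
    x * q v' ∈ Ideal.span (cornerGen (flip Adj) q p (flip a)) := by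
  classical
  obtain ⟨u, u', v, hu, h1, h2, hb, rfl⟩ := hx
  by_cases h3 : Adj u' v'
  swap
  · rw [mul_assoc, h.left_mul_right u' v' h3, mul_zero]
    exact zero_mem _
  by_cases hv : v = v'
  · subst hv
    rw [h.mul_mul_eq_neg_sum hu, neg_mul, Finset.sum_mul]
    refine neg_mem (sum_mem fun w hw => ?_)
    have hw := Finset.ne_of_mem_erase hw
    by_cases h4 : Adj u w ∧ Adj u' w
    · rw [mul_assoc, mul_assoc, ← mul_assoc (q w)]
      refine Ideal.mul_mem_left _ _ (Ideal.subset_span ⟨w, v, u', hw, h4.2, h2, ?_, rfl⟩)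
      have := L.square u u' v w hu hw.symm h1 h4.1 h2 h4.2
      simp only [flip]
      grind
    · rw [h.mul_mul_eq_zero_of_not_adj h4, zero_mul]
      exact zero_mem _
  · rcases h.swap.mul_mul_eq_zero_or_exists hv u' with h4 | ⟨t, ht, h4, h5⟩
    · rw [mul_assoc, mul_assoc, ← mul_assoc (q v), h4, mul_zero]
      exact zero_mem _
    rcases L.square u' t v v' ht.symm hv h2 h3 h4 h5 with h6 | h6
    · rw [mul_assoc, mul_assoc, ← mul_assoc (q v)]
      exact Ideal.mul_mem_left _ _ (Ideal.subset_span ⟨v, v', u', hv, h2, h3, h6.1, rfl⟩)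
    · rw [h.path_eq_zero L hu hv h1 h2 h3 hb h6.1]
      exact zero_mem _

theorem cornerGen_mul_left (h : BipartiteRel Adj p q) {Z : Type*} {c : U → V → Z} {x : R}
    (hx : x ∈ cornerGen Adj p q c) (t : U) : x * p t = 0 ∨ x * p t = x := by
  obtain ⟨u, u', v, hu, h1, h2, hb, rfl⟩ := hx
  by_cases ht : u' = t
  · subst ht
    right
    rw [mul_assoc, h.idem_left]
  · left
    rw [mul_assoc, h.orth_left u' t ht, mul_zero]

/-- Around the shared vertex the product contains a path of three edges with corners of different
kinds, which `path_eq_zero` kills. If both corners turn at the same v, the first is traded away from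
v beforehand. -/
theorem cornerGen_mul_cornerGen (h : BipartiteRel Adj p q) (L : SquareLabels Adj a b) {x y : R}
    (hx : x ∈ cornerGen Adj p q b) (hy : y ∈ cornerGen Adj p q a) : x * y = 0 := by
  classical
  obtain ⟨u, u', v, hu, h1, h2, hb, rfl⟩ := hx
  obtain ⟨t, t', v', ht, h3, h4, ha, rfl⟩ := hy
  by_cases hut : u' = t
  swap
  · rw [← mul_assoc, ← mul_assoc, mul_assoc _ (p u'), h.orth_left u' t hut]
    simp
  subst hut
  have e : p u * q v * p u' * (p u' * q v' * p t') = p u * q v * p u' * q v' * p t' := by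
    simp only [← mul_assoc]
    rw [mul_assoc _ (p u') (p u'), h.idem_left]
  rw [e]
  by_cases hv : v = v'
  · subst hv
    rw [h.mul_mul_eq_neg_sum hu, neg_mul, neg_mul, Finset.sum_mul, Finset.sum_mul, neg_eq_zero]
    refine Finset.sum_eq_zero fun w hw => ?_
    have hw := Finset.ne_of_mem_erase hw
    by_cases h5 : Adj u w ∧ Adj u' w
    · have e2 : p u * q w * p u' * q v * p t' = p u * (q w * p u' * q v * p t') := by
        simp only [mul_assoc]
      rw [e2, h.swap.path_eq_zero L.swap.symm hw ht h5.2 h2 h4 ?_ ha, mul_zero]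
      have := L.square u u' v w hu hw.symm h1 h5.1 h2 h5.2
      simp only [flip]
      grind
    · rw [h.mul_mul_eq_zero_of_not_adj h5]
      simp
  · rcases h.swap.mul_mul_eq_zero_or_exists hv u' with h5 | ⟨s, hs, h5, h6⟩
    · rw [mul_assoc (p u), mul_assoc (p u), h5]
      simp
    rcases L.square u' s v v' hs.symm hv h2 h3 h5 h6 with h7 | h7
    · have e2 : p u * q v * p u' * q v' * p t' = p u * (q v * p u' * q v' * p t') := by
        simp only [mul_assoc]
      rw [e2, h.swap.path_eq_zero L.swap.symm hv ht h2 h3 h4 h7.1 ha, mul_zero]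
    · rw [h.path_eq_zero L hu hv h1 h2 h3 hb h7.1, zero_mul]

/-- A spare factor `q v`, split off by idempotence, turns the first corner into a left combination
of corners on the other side, which reduces to `cornerGen_mul_cornerGen` for the swapped graph. -/
theorem cornerGen_mul_cornerGen' (h : BipartiteRel Adj p q) (L : SquareLabels Adj a b) {x y : R}
    (hx : x ∈ cornerGen Adj p q b) (hy : y ∈ cornerGen (flip Adj) q p (flip b)) : x * y = 0 := by
  have hy' := hy
  obtain ⟨v, v', u, hv, h1, h2, hb, rfl⟩ := hy
  have e : q v * p u * q v' = q v * (q v * p u * q v') := by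
    rw [← mul_assoc, ← mul_assoc, h.idem_right]
  rw [e, ← mul_assoc]
  have hm := h.cornerGen_mul_right_mem L hx v
  generalize x * q v = z at hm ⊢
  induction hm using Submodule.span_induction with
  | mem z hz => exact h.swap.cornerGen_mul_cornerGen L.swap.symm hz hy'
  | zero => simp
  | add y z _ _ hy hz => rw [add_mul, hy, hz, add_zero]
  | smul r z _ hz => rw [smul_eq_mul, mul_assoc, hz, mul_zero]

theorem labelGen_mul_labelGen (h : BipartiteRel Adj p q) (L : SquareLabels Adj a b) {x y : R}
    (hx : x ∈ labelGen Adj p q a b) (hy : y ∈ labelGen Adj p q b a) : x * y = 0 := by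
  rcases hx with hx | hx <;> rcases hy with hy | hy
  · exact h.cornerGen_mul_cornerGen L hx hy
  · exact h.cornerGen_mul_cornerGen' L hx hy
  · exact h.swap.cornerGen_mul_cornerGen' L.swap.symm hx hy
  · exact h.swap.cornerGen_mul_cornerGen L.swap.symm hx hy

theorem span_labelGen_mul_mem (h : BipartiteRel Adj p q) (L : SquareLabels Adj a b) {x : R}
    (hx : x ∈ Ideal.span (labelGen Adj p q a b)) (s : U ⊕ V) :
    x * Sum.elim p q s ∈ Ideal.span (labelGen Adj p q a b) := by
  induction hx using Submodule.span_induction with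
  | mem x hx =>
    rcases s with u | v <;> rcases hx with hx | hx
    · rcases h.cornerGen_mul_left hx u with h1 | h1
      · simp [h1]
      · rw [Sum.elim_inl, h1]
        exact Ideal.subset_span (Or.inl hx)
    · exact Ideal.span_mono Set.subset_union_left
        (h.swap.cornerGen_mul_right_mem L.swap.symm hx u)
    · exact Ideal.span_mono Set.subset_union_right (h.cornerGen_mul_right_mem L hx v)
    · rcases h.swap.cornerGen_mul_left hx v with h1 | h1
      · simp [h1]
      · rw [Sum.elim_inr, h1]
        exact Ideal.subset_span (Or.inr hx)
  | zero => simp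
  | add y z _ _ hy hz => rw [add_mul]; exact add_mem hy hz
  | smul r z _ hz => rw [smul_eq_mul, mul_assoc]; exact Ideal.mul_mem_left _ _ hz

end BipartiteRel

/-! ### Edge sums when the corners of flipped squares vanish. -/

open Classical in
/-- The sum of the elements `p u * q v * p u` over the edges `{u, v}` with label `x`. -/
noncomputable def edgeSum {U V X R : Type*} [Fintype U] [Fintype V] [Ring R] (Adj : U → V → Prop)
    (p : U → R) (q : V → R) (a : U → V → X) (x : X) : R :=
  ∑ u, ∑ v with Adj u v ∧ a u v = x, p u * q v * p u

open Classical in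
/-- The sum of the `q v` over the neighbours `v` of `u` for which `{u, v}` has label `x`. -/
noncomputable def nbrSum {U V X R : Type*} [Fintype V] [Ring R] (Adj : U → V → Prop)
    (q : V → R) (a : U → V → X) (x : X) (u : U) : R :=
  ∑ v with Adj u v ∧ a u v = x, q v

namespace BipartiteRel

variable {U V X Y R : Type*} [Fintype U] [Fintype V] [Ring R] {Adj : U → V → Prop}
  {p : U → R} {q : V → R} {a : U → V → X} {b : U → V → Y}

theorem edgeSum_eq (p : U → R) (q : V → R) (a : U → V → X) (x : X) :
    edgeSum Adj p q a x = ∑ u, p u * nbrSum Adj q a x u * p u := by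
  simp only [edgeSum, nbrSum, Finset.mul_sum, Finset.sum_mul]

open Classical in
theorem nbrSum_mul (h : BipartiteRel Adj p q) (x : X) (u : U) (v : V) :
    nbrSum Adj q a x u * q v = if Adj u v ∧ a u v = x then q v else 0 := by
  rw [nbrSum, Finset.sum_mul]
  split_ifs with hv
  · rw [Finset.sum_eq_single v]
    · exact h.idem_right v
    · exact fun w _ hw => h.orth_right w v hw
    · exact fun h1 => absurd (Finset.mem_filter.2 ⟨Finset.mem_univ v, hv⟩) h1
  · refine Finset.sum_eq_zero fun w hw => h.orth_right w v ?_
    rintro rfl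
    exact hv (Finset.mem_filter.1 hw).2

open Classical in
theorem nbrSum_mul_nbrSum (h : BipartiteRel Adj p q) (x x' : X) (u : U) :
    nbrSum Adj q a x u * nbrSum Adj q a x' u = if x = x' then nbrSum Adj q a x u else 0 := by
  conv_lhs => rw [nbrSum.eq_def Adj q a x' u, Finset.mul_sum]
  split_ifs with hx
  · subst hx
    rw [nbrSum.eq_def]
    refine Finset.sum_congr rfl fun v hv => ?_
    rw [← nbrSum.eq_def, h.nbrSum_mul, if_pos (Finset.mem_filter.1 hv).2]
  · refine Finset.sum_eq_zero fun v hv => ?_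
    rw [h.nbrSum_mul, if_neg]
    rintro ⟨_, h1⟩
    exact hx (h1.symm.trans (Finset.mem_filter.1 hv).2.2)

section Quotient

variable (h : BipartiteRel Adj p q) (L : SquareLabels Adj a b)
  (hK : ∀ x ∈ labelGen Adj p q b a, x = 0)
include h L hK

/-- Either every corner between u and u' is of the flipped kind and vanishes by `hK`, or all common
neighbours v carry the same label `a u v`. In the latter case the sum contains all common
neighbours, which gives the product of orthogonal `p u` and `p u'`, or none. -/
theorem mul_nbrSum_mul (x : X) {u u' : U} (hu : u ≠ u') :
    p u * nbrSum Adj q a x u * p u' = 0 ∧ p u' * nbrSum Adj q a x u * p u = 0 := by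
  classical
  have key : (∀ v, Adj u v → Adj u' v → a u v = a u' v) ∨
      ∃ x0, ∀ v, Adj u v → Adj u' v → a u v = x0 := by
    -- A common neighbour v0 with `a u v0 ≠ a u' v0` and another one w with `a u w ≠ a u v0` would
    -- span a square of neither kind.
    by_contra! hc
    obtain ⟨⟨v0, h1, h2, h3⟩, h4⟩ := hc
    obtain ⟨w, h5, h6, h7⟩ := h4 (a u v0)
    have := L.square u u' v0 w hu (by grind) h1 h5 h2 h6
    grind
  rw [nbrSum, Finset.mul_sum, Finset.sum_mul, Finset.mul_sum, Finset.sum_mul]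
  rcases key with key | ⟨x0, key⟩
  · constructor
    · refine Finset.sum_eq_zero fun v hv => ?_
      by_cases hv' : Adj u v ∧ Adj u' v
      · exact hK _ (Or.inl ⟨u, u', v, hu, hv'.1, hv'.2, key v hv'.1 hv'.2, rfl⟩)
      · exact h.mul_mul_eq_zero_of_not_adj hv'
    · refine Finset.sum_eq_zero fun v hv => ?_
      by_cases hv' : Adj u v ∧ Adj u' v
      · exact hK _ (Or.inl ⟨u', u, v, hu.symm, hv'.2, hv'.1, (key v hv'.1 hv'.2).symm, rfl⟩)
      · exact h.mul_mul_eq_zero_of_not_adj (by tauto)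
  · by_cases hx : x = x0
    · constructor
      · rw [← h.orth_left u u' hu, ← h.sum_mul_mul]
        refine Finset.sum_subset (Finset.subset_univ _) fun v _ hv => ?_
        refine h.mul_mul_eq_zero_of_not_adj fun h1 => hv ?_
        simp [h1.1, key v h1.1 h1.2, hx]
      · rw [← h.orth_left u' u hu.symm, ← h.sum_mul_mul]
        refine Finset.sum_subset (Finset.subset_univ _) fun v _ hv => ?_
        refine h.mul_mul_eq_zero_of_not_adj fun h1 => hv ?_
        simp [h1.2, key v h1.2 h1.1, hx]
    · constructor <;> refine Finset.sum_eq_zero fun v hv => ?_ <;>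
        refine h.mul_mul_eq_zero_of_not_adj fun h1 => hx ?_
      · rw [← (Finset.mem_filter.1 hv).2.2, key v h1.1 h1.2]
      · rw [← (Finset.mem_filter.1 hv).2.2, key v h1.2 h1.1]

/-- Expanding 1 as `∑ u', p u'` on either side, the off-diagonal parts vanish. This commutation
makes the edge sums idempotent. -/
theorem mul_nbrSum_comm (x : X) (u : U) :
    p u * nbrSum Adj q a x u = nbrSum Adj q a x u * p u := by
  classical
  have h1 : p u * nbrSum Adj q a x u = p u * nbrSum Adj q a x u * p u := by
    conv_lhs => rw [← mul_one (p u * _), ← h.sum_left, Finset.mul_sum]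
    rw [Finset.sum_eq_single u]
    · exact fun u' _ hu' => (h.mul_nbrSum_mul L hK x hu'.symm).1
    · simp
  have h2 : nbrSum Adj q a x u * p u = p u * nbrSum Adj q a x u * p u := by
    conv_lhs => rw [← one_mul (nbrSum Adj q a x u * p u), ← h.sum_left, Finset.sum_mul]
    rw [Finset.sum_eq_single u]
    · rw [mul_assoc]
    · intro u' _ hu'
      rw [← mul_assoc]
      exact (h.mul_nbrSum_mul L hK x hu'.symm).2
    · simp
  rw [h1, h2]

theorem edgeSum_eq' (x : X) :
    edgeSum Adj p q a x = ∑ u, p u * nbrSum Adj q a x u := by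
  rw [edgeSum_eq]
  refine Finset.sum_congr rfl fun u _ => ?_
  rw [mul_assoc, ← h.mul_nbrSum_comm L hK, ← mul_assoc, h.idem_left]

theorem mul_edgeSum (x : X) (u : U) :
    p u * edgeSum Adj p q a x = p u * nbrSum Adj q a x u := by
  rw [h.edgeSum_eq' L hK, Finset.mul_sum, Finset.sum_eq_single u]
  · rw [← mul_assoc, h.idem_left]
  · intro u' _ hu'
    rw [← mul_assoc, h.orth_left u u' hu'.symm, zero_mul]
  · simp

open Classical in
theorem edgeSum_mul_edgeSum (x x' : X) :
    edgeSum Adj p q a x * edgeSum Adj p q a x' = if x = x' then edgeSum Adj p q a x else 0 := by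
  have h1 : edgeSum Adj p q a x = ∑ u, nbrSum Adj q a x u * p u := by
    rw [h.edgeSum_eq' L hK]
    exact Finset.sum_congr rfl fun u _ => h.mul_nbrSum_comm L hK x u
  conv_lhs => rw [h1, Finset.sum_mul]
  have h2 : ∀ u, nbrSum Adj q a x u * p u * edgeSum Adj p q a x' =
      nbrSum Adj q a x u * nbrSum Adj q a x' u * p u := fun u => by
    rw [mul_assoc, h.mul_edgeSum L hK, h.mul_nbrSum_comm L hK, mul_assoc]
  simp only [h2, h.nbrSum_mul_nbrSum]
  split_ifs
  · exact h1.symm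
  · simp

-- Both factors are diagonal sums of commuting products, so only edges with both prescribed labels
-- survive, each contributing `p u * q v`.
open Classical in
theorem edgeSum_mul_edgeSum_flip (x : X) (y : Y) :
    edgeSum Adj p q a x * edgeSum (flip Adj) q p (flip b) y =
      ∑ u, ∑ v, if Adj u v ∧ a u v = x ∧ b u v = y then p u * q v else 0 := by
  have hK' : ∀ x ∈ labelGen (flip Adj) q p (flip a) (flip b), x = 0 := fun x hx =>
    hK x (by rwa [labelGen_swap] at hx)
  rw [h.swap.edgeSum_eq' L.swap.symm hK', h.edgeSum_eq' L hK, Finset.sum_mul]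
  refine Finset.sum_congr rfl fun u _ => ?_
  rw [Finset.mul_sum]
  refine Finset.sum_congr rfl fun v _ => ?_
  rw [← mul_assoc, mul_assoc (p u), h.nbrSum_mul]
  by_cases h1 : Adj u v ∧ a u v = x
  · rw [if_pos h1, mul_assoc, h.swap.mul_nbrSum_comm L.swap.symm hK', ← mul_assoc]
    have h2 : p u * nbrSum (flip Adj) p (flip b) y v =
        if Adj u v ∧ b u v = y then p u else 0 := by
      rw [nbrSum, Finset.mul_sum]
      split_ifs with hv
      · rw [Finset.sum_eq_single u]
        · exact h.idem_left u
        · exact fun w _ hw => h.orth_left u w hw.symm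
        · exact fun h1 => absurd (Finset.mem_filter.2 ⟨Finset.mem_univ u, hv⟩) h1
      · refine Finset.sum_eq_zero fun w hw => h.orth_left u w ?_
        rintro rfl
        exact hv (Finset.mem_filter.1 hw).2
    rw [h2]
    simp [h1.1, h1.2]
  · rw [if_neg h1, if_neg (by tauto)]
    simp

/-- The labels jointly separate edges, so exactly one term of the double sum remains. -/
theorem edgeSum_mul_edgeSum_of_adj {u : U} {v : V} (huv : Adj u v) :
    edgeSum Adj p q a (a u v) * edgeSum (flip Adj) q p (flip b) (b u v) = p u * q v := by
  classical
  rw [h.edgeSum_mul_edgeSum_flip L hK, Finset.sum_eq_single u, Finset.sum_eq_single v]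
  · simp [huv]
  · intro w _ hw
    rw [if_neg]
    exact fun h1 => hw (L.inj u w u v h1.1 huv h1.2.1 h1.2.2).2
  · simp
  · intro w _ hw
    refine Finset.sum_eq_zero fun v' _ => ?_
    rw [if_neg]
    exact fun h1 => hw (L.inj w v' u v h1.1 huv h1.2.1 h1.2.2).1
  · simp

theorem edgeSum_mul_edgeSum_of_not {x : X} {y : Y}
    (hxy : ∀ u v, Adj u v → a u v = x → b u v ≠ y) :
    edgeSum Adj p q a x * edgeSum (flip Adj) q p (flip b) y = 0 := by
  classical
  rw [h.edgeSum_mul_edgeSum_flip L hK]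
  refine Finset.sum_eq_zero fun u _ => Finset.sum_eq_zero fun v _ => if_neg ?_
  exact fun h1 => hxy u v h1.1 h1.2.1 h1.2.2

omit L hK in
theorem sum_edgeSum [Fintype X] : ∑ x, edgeSum Adj p q a x = 1 := by
  classical
  simp only [edgeSum]
  rw [Finset.sum_comm, ← h.sum_left]
  refine Finset.sum_congr rfl fun u _ => ?_
  have h1 : p u = ∑ v, p u * q v * p u := by rw [h.sum_mul_mul, h.idem_left]
  conv_rhs => rw [h1]
  simp only [Finset.sum_filter]
  rw [Finset.sum_comm]
  refine Finset.sum_congr rfl fun v _ => ?_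
  by_cases h2 : Adj u v
  · simp [h2]
  · simp [h2, h.left_mul_right u v h2]

/-- If the generators attached to one of the two kinds of squares vanish, then the edge labels give
rise to families that satisfy the relations of the graph of labels. -/
theorem edgeSum_rel [Fintype X] [Fintype Y] {Adj' : X → Y → Prop}
    (hAdj : ∀ u v, Adj u v → Adj' (a u v) (b u v)) :
    BipartiteRel Adj' (edgeSum Adj p q a) (edgeSum (flip Adj) q p (flip b)) := by
  have hK' : ∀ x ∈ labelGen (flip Adj) q p (flip a) (flip b), x = 0 := fun x hx =>
    hK x (by rwa [labelGen_swap] at hx)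
  refine ⟨fun x => ?_, fun x x' hx => ?_, h.sum_edgeSum, fun y => ?_, fun y y' hy => ?_,
    h.swap.sum_edgeSum, fun x y hxy => ?_, fun x y hxy => ?_⟩
  · rw [h.edgeSum_mul_edgeSum L hK, if_pos rfl]
  · rw [h.edgeSum_mul_edgeSum L hK, if_neg hx]
  · rw [h.swap.edgeSum_mul_edgeSum L.swap.symm hK', if_pos rfl]
  · rw [h.swap.edgeSum_mul_edgeSum L.swap.symm hK', if_neg hy]
  · refine h.edgeSum_mul_edgeSum_of_not L hK fun u v huv hx hy => hxy ?_
    subst hx hy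
    exact hAdj u v huv
  · refine h.swap.edgeSum_mul_edgeSum_of_not L.swap.symm hK' fun v u huv hy hx => hxy ?_
    subst hx hy
    exact hAdj u v huv

end Quotient

end BipartiteRel

/-! ### Corners and edge sums under homomorphisms and the involution. -/

theorem TwoSidedIdeal.mk'_eq_zero_iff {R : Type*} [Ring R] (I : TwoSidedIdeal R) (x : R) :
    I.ringCon.mk' x = 0 ↔ x ∈ I := by
  rw [← TwoSidedIdeal.mem_ker, TwoSidedIdeal.ker_ringCon_mk']

theorem TwoSidedIdeal.mk'_eq_iff {R : Type*} [Ring R] (I : TwoSidedIdeal R) (x y : R) :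
    I.ringCon.mk' x = I.ringCon.mk' y ↔ x - y ∈ I := by
  rw [← I.mk'_eq_zero_iff, map_sub, sub_eq_zero]

theorem map_edgeSum {U V X R S : Type*} [Fintype U] [Fintype V] [Ring R] [Ring S] (f : R →+* S)
    (Adj : U → V → Prop) (p : U → R) (q : V → R) (a : U → V → X) (x : X) :
    f (edgeSum Adj p q a x) = edgeSum Adj (fun u => f (p u)) (fun v => f (q v)) a x := by
  simp [edgeSum]

theorem mem_labelGen_map {U V X Y R S : Type*} [Ring R] [Ring S] (f : R →+* S)
    {Adj : U → V → Prop} {p : U → R} {q : V → R} {a : U → V → X} {b : U → V → Y} {y : S}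
    (hy : y ∈ labelGen Adj (fun u => f (p u)) (fun v => f (q v)) a b) :
    ∃ x ∈ labelGen Adj p q a b, f x = y := by
  rcases hy with ⟨u, u', v, h1, h2, h3, h4, rfl⟩ | ⟨u, u', v, h1, h2, h3, h4, rfl⟩
  · exact ⟨_, Or.inl ⟨u, u', v, h1, h2, h3, h4, rfl⟩, by simp⟩
  · exact ⟨_, Or.inr ⟨u, u', v, h1, h2, h3, h4, rfl⟩, by simp⟩

theorem map_mem_labelGen {U V X Y R S : Type*} [Ring R] [Ring S] (f : R →+* S)
    {Adj : U → V → Prop} {p : U → R} {q : V → R} {a : U → V → X} {b : U → V → Y} {x : R}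
    (hx : x ∈ labelGen Adj p q a b) :
    f x ∈ labelGen Adj (fun u => f (p u)) (fun v => f (q v)) a b := by
  rcases hx with ⟨u, u', v, h1, h2, h3, h4, rfl⟩ | ⟨u, u', v, h1, h2, h3, h4, rfl⟩
  · exact Or.inl ⟨u, u', v, h1, h2, h3, h4, by simp⟩
  · exact Or.inr ⟨u, u', v, h1, h2, h3, h4, by simp⟩

theorem star_mem_labelGen {U V X Y R : Type*} [Ring R] [StarRing R]
    {Adj : U → V → Prop} {p : U → R} {q : V → R} {a : U → V → X} {b : U → V → Y}
    (hp : ∀ u, IsSelfAdjoint (p u)) (hq : ∀ v, IsSelfAdjoint (q v)) {x : R}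
    (hx : x ∈ labelGen Adj p q a b) : star x ∈ labelGen Adj p q a b := by
  rcases hx with ⟨u, u', v, h1, h2, h3, h4, rfl⟩ | ⟨u, u', v, h1, h2, h3, h4, rfl⟩
  · exact Or.inl ⟨u', u, v, h1.symm, h3, h2, h4.symm, by
      simp [(hp _).star_eq, (hq _).star_eq, mul_assoc]⟩
  · exact Or.inr ⟨u', u, v, h1.symm, h3, h2, h4.symm, by
      simp [(hp _).star_eq, (hq _).star_eq, mul_assoc]⟩

theorem TwoSidedIdeal.star_mem_span {R : Type*} [Ring R] [StarRing R] {s : Set R}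
    (hs : ∀ x ∈ s, star x ∈ s) {x : R} (hx : x ∈ TwoSidedIdeal.span s) :
    star x ∈ TwoSidedIdeal.span s := by
  induction hx using TwoSidedIdeal.span_induction with
  | mem x hx => exact TwoSidedIdeal.subset_span (hs x hx)
  | zero => simp
  | add x y _ _ hx hy => rw [star_add]; exact TwoSidedIdeal.add_mem _ hx hy
  | neg x _ hx => rw [star_neg]; exact TwoSidedIdeal.neg_mem _ hx
  | left_absorb a x _ hx => rw [star_mul]; exact TwoSidedIdeal.mul_mem_right _ _ _ hx
  | right_absorb b x _ hx => rw [star_mul]; exact TwoSidedIdeal.mul_mem_left _ _ _ hx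

theorem isSelfAdjoint_edgeSum {U V X R : Type*} [Fintype U] [Fintype V] [Ring R] [StarRing R]
    (Adj : U → V → Prop) {p : U → R} {q : V → R} (hp : ∀ u, IsSelfAdjoint (p u))
    (hq : ∀ v, IsSelfAdjoint (q v)) (a : U → V → X) (x : X) :
    IsSelfAdjoint (edgeSum Adj p q a x) := by
  rw [IsSelfAdjoint, edgeSum]
  simp [(hp _).star_eq, (hq _).star_eq, mul_assoc]

/-! ### Comparing families of projections along labels. -/

namespace BipartiteRel

variable {U V X Y R : Type*} [Fintype U] [Fintype V] [Fintype X] [Fintype Y] [Ring R]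
  {Adj : U → V → Prop} {Adj' : X → Y → Prop}

/-- Meant for the quotients by the two label ideals, whose intersection is zero. -/
theorem of_map {p : U → R} {q : V → R} {S T : Type*} [Ring S] [Ring T] (f : R →+* S) (g : R →+* T)
    (hfg : ∀ x, f x = 0 → g x = 0 → x = 0)
    (hf : BipartiteRel Adj (fun u => f (p u)) (fun v => f (q v)))
    (hg : BipartiteRel Adj (fun u => g (p u)) (fun v => g (q v))) : BipartiteRel Adj p q := by
  have key : ∀ x y, f x = f y → g x = g y → x = y := fun x y h1 h2 =>
    sub_eq_zero.1 (hfg _ (by rw [map_sub, h1, sub_self]) (by rw [map_sub, h2, sub_self]))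
  refine ⟨fun u => key _ _ ?_ ?_, fun u u' hu => key _ _ ?_ ?_, key _ _ ?_ ?_,
    fun u => key _ _ ?_ ?_, fun u u' hu => key _ _ ?_ ?_, key _ _ ?_ ?_,
    fun u v h => key _ _ ?_ ?_, fun u v h => key _ _ ?_ ?_⟩
  · simpa using hf.idem_left u
  · simpa using hg.idem_left u
  · simpa using hf.orth_left u u' hu
  · simpa using hg.orth_left u u' hu
  · simpa using hf.sum_left
  · simpa using hg.sum_left
  · simpa using hf.idem_right u
  · simpa using hg.idem_right u
  · simpa using hf.orth_right u u' hu
  · simpa using hg.orth_right u u' hu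
  · simpa using hf.sum_right
  · simpa using hg.sum_right
  · simpa using hf.left_mul_right u v h
  · simpa using hg.left_mul_right u v h
  · simpa using hf.right_mul_left u v h
  · simpa using hg.right_mul_left u v h

section Transfer

variable {P : U → R} {Q : V → R} {p : X → R} {q : Y → R} {a : U → V → X} {b : U → V → Y}
  (h : BipartiteRel Adj P Q) (h' : BipartiteRel Adj' p q)
  (hPQ : ∀ u v, Adj u v → P u * Q v = p (a u v) * q (b u v))
  (hQP : ∀ u v, Adj u v → Q v * P u = q (b u v) * p (a u v))

include h h' hPQ hQP

/-- Writing P Q P as (P Q)(Q P) turns it into p q p at the labels, so multiplication by `p x` keeps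
only the edge sum at x. Since all edge sums add up to 1, that one equals `p x`. -/
theorem edgeSum_eq_of_mul_eq (x : X) : edgeSum Adj P Q a x = p x := by
  classical
  have h1 : ∀ x', p x * edgeSum Adj P Q a x' = if x' = x then edgeSum Adj P Q a x else 0 := by
    intro x'
    have hterm : ∀ u v, Adj u v → P u * Q v * P u = p (a u v) * (q (b u v) * p (a u v)) :=
      fun u v huv => by
        rw [← h.idem_right v, ← mul_assoc, mul_assoc _ (Q v), hPQ u v huv, hQP u v huv,
          mul_assoc, ← mul_assoc (q _) (q _), h'.idem_right]
    simp only [edgeSum, Finset.mul_sum]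
    split_ifs with hx
    · subst hx
      refine Finset.sum_congr rfl fun u _ => Finset.sum_congr rfl fun v hv => ?_
      obtain ⟨h2, h3⟩ := (Finset.mem_filter.1 hv).2
      rw [hterm u v h2, h3, ← mul_assoc, h'.idem_left]
    · refine Finset.sum_eq_zero fun u _ => Finset.sum_eq_zero fun v hv => ?_
      obtain ⟨h2, h3⟩ := (Finset.mem_filter.1 hv).2
      rw [hterm u v h2, h3, ← mul_assoc, h'.orth_left x x' (Ne.symm hx), zero_mul]
  have h2 := congrArg (fun z => p x * z) (h.sum_edgeSum (a := a))
  simp only [Finset.mul_sum, h1, mul_one] at h2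
  simpa using h2

-- Splitting the middle idempotent exposes two generators whose labels differ, because the other
-- labels agree and the pair of labels is injective on edges.
omit h [Fintype U] [Fintype V] in
theorem labelGen_eq_zero_of_mul_eq (L : SquareLabels Adj a b)
    (hi : ∀ u, P u * P u = P u) (hi' : ∀ v, Q v * Q v = Q v) {x : R}
    (hx : x ∈ labelGen Adj P Q b a) : x = 0 := by
  rcases hx with ⟨u, u', v, h1, h2, h3, h4, rfl⟩ | ⟨v, v', u, h1, h2, h3, h4, rfl⟩
  · rw [← hi' v, ← mul_assoc, mul_assoc _ (Q v), hPQ u v h2, hQP u' v h3, mul_assoc,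
      ← mul_assoc (q _) (q _), h'.orth_right, zero_mul, mul_zero]
    exact fun h5 => h1 (L.inj _ _ _ _ h2 h3 h4 h5).1
  · rw [← hi u, ← mul_assoc, mul_assoc _ (P u), hQP u v h2, hPQ u v' h3, mul_assoc,
      ← mul_assoc (p _) (p _), h'.orth_left, zero_mul, mul_zero]
    exact fun h5 => h1 (L.inj _ _ _ _ h2 h3 h5 h4).2

end Transfer

section Sup

variable {Z : Type*} {p : U → R} {q : V → R} {a : U → V → X} {b : U → V → Y}
  {I J : TwoSidedIdeal R}

-- The commutator is a combination of off-diagonal corners. Each is zero or lies in a square, whose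
-- kind decides between I and J.
omit [Fintype X] [Fintype Y] in
theorem commutator_mem (h : BipartiteRel Adj p q) (L : SquareLabels Adj a b)
    (hI : labelGen Adj p q a b ⊆ I) (hJ : labelGen Adj p q b a ⊆ J) (u : U) (v : V) :
    p u * q v - q v * p u ∈ I ⊔ J := by
  classical
  have key : ∀ u u', u ≠ u' → p u * q v * p u' ∈ I ⊔ J := by
    intro u u' hu
    by_cases h1 : Adj u v ∧ Adj u' v
    swap
    · rw [h.mul_mul_eq_zero_of_not_adj h1]
      exact zero_mem _
    rcases h.mul_mul_eq_zero_or_exists hu v with h2 | ⟨w, hw, h2, h3⟩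
    · rw [h2]
      exact zero_mem _
    rcases L.square u u' v w hu hw.symm h1.1 h2 h1.2 h3 with h4 | h4
    · exact TwoSidedIdeal.mem_sup_left (hI (Or.inl ⟨u, u', v, hu, h1.1, h1.2, h4.2.2.1, rfl⟩))
    · exact TwoSidedIdeal.mem_sup_right (hJ (Or.inl ⟨u, u', v, hu, h1.1, h1.2, h4.2.2.1, rfl⟩))
  have h1 : p u * q v - q v * p u = ∑ u', (p u * q v * p u' - p u' * q v * p u) := by
    rw [Finset.sum_sub_distrib, ← Finset.mul_sum, h.sum_left, mul_one]
    simp only [← Finset.sum_mul]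
    rw [h.sum_left, one_mul]
  rw [h1]
  refine sum_mem fun u' _ => ?_
  by_cases hu : u = u'
  · subst hu
    rw [sub_self]
    exact zero_mem _
  · exact sub_mem (key u u' hu) (key u' u (Ne.symm hu))

-- Term by term, pqp - qpq = [p, q] q - p [p, q] for idempotents.
omit [Fintype X] [Fintype Y] in
theorem edgeSum_sub_mem (h : BipartiteRel Adj p q) (L : SquareLabels Adj a b)
    (hI : labelGen Adj p q a b ⊆ I) (hJ : labelGen Adj p q b a ⊆ J) (c : U → V → Z) (z : Z) :
    edgeSum Adj p q c z - edgeSum (flip Adj) q p (flip c) z ∈ I ⊔ J := by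
  classical
  have h1 : edgeSum (flip Adj) q p (flip c) z =
      ∑ u, ∑ v with Adj u v ∧ c u v = z, q v * p u * q v := by
    rw [edgeSum]
    exact Finset.sum_comm' fun v u => by
      simp only [Finset.mem_filter, Finset.mem_univ, true_and, and_true]; rfl
  rw [h1, edgeSum, ← Finset.sum_sub_distrib]
  refine sum_mem fun u _ => ?_
  rw [← Finset.sum_sub_distrib]
  refine sum_mem fun v _ => ?_
  have h2 : p u * q v * p u - q v * p u * q v =
      (p u * q v - q v * p u) * q v - p u * (p u * q v - q v * p u) := by
    rw [sub_mul, mul_sub, mul_assoc (p u) (q v) (q v), h.idem_right, ← mul_assoc (p u) (p u),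
      h.idem_left, mul_assoc (p u) (q v) (p u)]
    abel
  rw [h2]
  have h3 := h.commutator_mem L hI hJ u v
  exact sub_mem (TwoSidedIdeal.mul_mem_right _ _ _ h3) (TwoSidedIdeal.mul_mem_left _ _ _ h3)

end Sup

end BipartiteRel

/-! ### Gluing along the two label ideals of `C*(G)`. -/

namespace BipartiteGraph.CStar

variable {U V : Type*} [Fintype U] [Fintype V]

/-- The generating projections of `C*(G)` for the left vertices. -/
noncomputable def pl (G : BipartiteGraph U V) (u : U) : G.CStar := p (Sum.inl u)

/-- The generating projections of `C*(G)` for the right vertices. -/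
noncomputable def pr (G : BipartiteGraph U V) (v : V) : G.CStar := p (Sum.inr v)

variable {X Y : Type*} {G : BipartiteGraph U V} {a : U → V → X} {b : U → V → Y}

theorem rel (G : BipartiteGraph U V) : BipartiteRel G.Adj (pl G) (pr G) := bipartiteRel G

theorem isSelfAdjoint_pl (u : U) : IsSelfAdjoint (pl G u) := isSelfAdjoint_p _

theorem isSelfAdjoint_pr (v : V) : IsSelfAdjoint (pr G v) := isSelfAdjoint_p _

variable (G a b) in
/-- The two-sided ideal of `C*(G)` attached to edge labels. -/
noncomputable def labelIdeal : TwoSidedIdeal G.CStar :=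
  TwoSidedIdeal.span (labelGen G.Adj (pl G) (pr G) a b)

theorem labelGen_subset : labelGen G.Adj (pl G) (pr G) a b ⊆ labelIdeal G a b :=
  TwoSidedIdeal.subset_span

theorem star_mem_labelIdeal {x : G.CStar} (hx : x ∈ labelIdeal G a b) :
    star x ∈ labelIdeal G a b :=
  TwoSidedIdeal.star_mem_span
    (fun _ => star_mem_labelGen isSelfAdjoint_pl isSelfAdjoint_pr) hx

/-- The induction on c needs the whole left ideal on the left: prefixing c with a generator moves
that generator onto z, and `span_labelGen_mul_mem` keeps the product in the ideal. For fixed z the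
condition on c is closed, which covers limits. -/
theorem gen_mul_mul_gen (L : SquareLabels G.Adj a b) {x y : G.CStar}
    (hx : x ∈ labelGen G.Adj (pl G) (pr G) a b) (hy : y ∈ labelGen G.Adj (pl G) (pr G) b a)
    (c : G.CStar) : x * c * y = 0 := by
  have key : ∀ z ∈ Ideal.span (labelGen G.Adj (pl G) (pr G) a b), z * y = 0 := by
    intro z hz
    induction hz using Submodule.span_induction with
    | mem z hz => exact (rel G).labelGen_mul_labelGen L hz hy
    | zero => simp
    | add _ _ _ _ h1 h2 => rw [add_mul, h1, h2, add_zero]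
    | smul r z _ hz => rw [smul_eq_mul, mul_assoc, hz, mul_zero]
  have h : ∀ z ∈ Ideal.span (labelGen G.Adj (pl G) (pr G) a b), z * c * y = 0 := by
    refine induction (P := fun c => ∀ z ∈ Ideal.span (labelGen G.Adj (pl G) (pr G) a b),
      z * c * y = 0) ?_ (fun z hz => by rw [mul_one, key z hz]) ?_ ?_ ?_ c
    · simp only [Set.ofPred_forall]
      exact isClosed_iInter fun z => isClosed_iInter fun _ =>
        isClosed_eq (by fun_prop) continuous_const
    · intro c d hc hd z hz
      rw [mul_add, add_mul, hc z hz, hd z hz, add_zero]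
    · intro r c hc z hz
      rw [mul_smul_comm, smul_mul_assoc, hc z hz, smul_zero]
    · intro s c hc z hz
      rw [← mul_assoc]
      refine hc _ ?_
      have := (rel G).span_labelGen_mul_mem L hz s
      rcases s with u | v <;> exact this
  exact h x (Ideal.subset_span hx)

/-- Keeping an arbitrary c between the factors lets the vanishing survive absorption on the inner
sides. -/
theorem labelIdeal_mul (L : SquareLabels G.Adj a b) {x y : G.CStar}
    (hx : x ∈ labelIdeal G a b) (hy : y ∈ labelIdeal G b a) : x * y = 0 := by
  have h1 : ∀ x ∈ labelIdeal G a b, ∀ y ∈ labelGen G.Adj (pl G) (pr G) b a,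
      ∀ c, x * c * y = 0 := by
    intro x hx y hy
    induction hx using TwoSidedIdeal.span_induction with
    | mem x hx => exact gen_mul_mul_gen L hx hy
    | zero => simp
    | add x y _ _ hx hy => intro c; rw [add_mul, add_mul, hx, hy, add_zero]
    | neg x _ hx => intro c; rw [neg_mul, neg_mul, hx, neg_zero]
    | left_absorb a x _ hx => intro c; rw [mul_assoc a, mul_assoc a, hx, mul_zero]
    | right_absorb a x _ hx => intro c; rw [mul_assoc x, hx]
  have h2 : ∀ x ∈ labelIdeal G a b, ∀ c, x * c * y = 0 := by
    induction hy using TwoSidedIdeal.span_induction with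
    | mem y hy => exact fun x hx => h1 x hx y hy
    | zero => simp
    | add y z _ _ hy hz => intro x hx c; rw [mul_add, hy x hx, hz x hx, add_zero]
    | neg y _ hy => intro x hx c; rw [mul_neg, hy x hx, neg_zero]
    | left_absorb a y _ hy => intro x hx c; rw [← mul_assoc, mul_assoc x, hy x hx]
    | right_absorb a y _ hy => intro x hx c; rw [← mul_assoc, hy x hx, zero_mul]
  simpa using h2 x hx 1

/-- Here x x* is a product from the two ideals, hence zero. The ideals are purely algebraic; no
closure is taken. -/
theorem eq_zero_of_mem_labelIdeal (L : SquareLabels G.Adj a b) {x : G.CStar}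
    (hx : x ∈ labelIdeal G a b) (hx' : x ∈ labelIdeal G b a) : x = 0 := by
  have := labelIdeal_mul L hx (star_mem_labelIdeal hx')
  rwa [CStarRing.mul_star_self_eq_zero_iff] at this

/-- The two edge sums differ by an element of the sum of the ideals; moving one summand of a
decomposition across gives an element with the right class in both quotients. -/
theorem exists_glue (L : SquareLabels G.Adj a b) {Z : Type*} (c : U → V → Z) (z : Z) :
    ∃ x : G.CStar, x - edgeSum G.Adj (pl G) (pr G) c z ∈ labelIdeal G b a ∧
      x - edgeSum (flip G.Adj) (pr G) (pl G) (flip c) z ∈ labelIdeal G a b := by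
  obtain ⟨y, hy, w, hw, h⟩ := TwoSidedIdeal.mem_sup.1
    ((rel G).edgeSum_sub_mem L labelGen_subset labelGen_subset c z)
  refine ⟨edgeSum (flip G.Adj) (pr G) (pl G) (flip c) z + y, ?_, ?_⟩
  · have : edgeSum (flip G.Adj) (pr G) (pl G) (flip c) z + y -
        edgeSum G.Adj (pl G) (pr G) c z = -w := by
      rw [← sub_eq_iff_eq_add.2 (h.symm.trans (add_comm _ _))]
      abel
    rw [this]
    exact TwoSidedIdeal.neg_mem _ hw
  · rwa [add_sub_cancel_left]

theorem labelGen_map_eq_zero {y : (labelIdeal G a b).ringCon.Quotient}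
    (hy : y ∈ labelGen G.Adj (fun u => (labelIdeal G a b).ringCon.mk' (pl G u))
      (fun v => (labelIdeal G a b).ringCon.mk' (pr G v)) a b) : y = 0 := by
  obtain ⟨x, hx, rfl⟩ := mem_labelGen_map _ hy
  exact (TwoSidedIdeal.mk'_eq_zero_iff _ _).2 (labelGen_subset hx)

theorem isSelfAdjoint_of_sub_mem (L : SquareLabels G.Adj a b) {x y z : G.CStar}
    (hy : IsSelfAdjoint y) (hz : IsSelfAdjoint z) (hxy : x - y ∈ labelIdeal G b a)
    (hxz : x - z ∈ labelIdeal G a b) : IsSelfAdjoint x := by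
  rw [IsSelfAdjoint, ← sub_eq_zero]
  refine eq_zero_of_mem_labelIdeal L ?_ ?_
  · have := sub_mem (star_mem_labelIdeal hxz) hxz
    rwa [star_sub, hz.star_eq, sub_sub_sub_cancel_right] at this
  · have := sub_mem (star_mem_labelIdeal hxy) hxy
    rwa [star_sub, hy.star_eq, sub_sub_sub_cancel_right] at this

theorem map_eq_of_sub_mem_labelIdeal {B : Type*} [Ring B] (g : G.CStar →+* B)
    (hg : ∀ x ∈ labelGen G.Adj (pl G) (pr G) a b, g x = 0) {x y : G.CStar}
    (hxy : x - y ∈ labelIdeal G a b) : g x = g y := by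
  have h : labelIdeal G a b ≤ TwoSidedIdeal.ker g :=
    TwoSidedIdeal.span_le.2 fun x hx => (TwoSidedIdeal.mem_ker g).2 (hg x hx)
  rw [← sub_eq_zero, ← map_sub]
  exact (TwoSidedIdeal.mem_ker g).1 (h hxy)

variable [Fintype X] [Fintype Y] {H : BipartiteGraph X Y}

/-- A `*`-homomorphism that is given on generators by edge sums, taken from the left modulo one of
the ideals attached to edge labels and from the right modulo the other. -/
structure IsLabelHom (a : U → V → X) (b : U → V → Y) (f : H.CStar →⋆ₐ[ℂ] G.CStar) : Prop where
  left_neg : ∀ x, f (pl H x) - edgeSum G.Adj (pl G) (pr G) a x ∈ labelIdeal G b a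
  left_pos : ∀ x, f (pl H x) - edgeSum (flip G.Adj) (pr G) (pl G) (flip a) x ∈ labelIdeal G a b
  right_neg : ∀ y, f (pr H y) - edgeSum (flip G.Adj) (pr G) (pl G) (flip b) y ∈ labelIdeal G b a
  right_pos : ∀ y, f (pr H y) - edgeSum G.Adj (pl G) (pr G) b y ∈ labelIdeal G a b

/-- In this quotient the flipped squares are trivial, so a left label is realised by sums of p q p.
-/
theorem edgeSum_rel_neg (L : SquareLabels G.Adj a b)
    (hAdj : ∀ u v, G.Adj u v → H.Adj (a u v) (b u v)) :
    BipartiteRel H.Adj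
      (fun x => (labelIdeal G b a).ringCon.mk' (edgeSum G.Adj (pl G) (pr G) a x))
      (fun y => (labelIdeal G b a).ringCon.mk'
        (edgeSum (flip G.Adj) (pr G) (pl G) (flip b) y)) := by
  simp only [map_edgeSum]
  exact ((rel G).map _).edgeSum_rel L (fun y hy => labelGen_map_eq_zero hy) hAdj

/-- Here only flipped squares survive, so a left label is realised by sums of q p q; the swapped
graph reduces this to the other case. -/
theorem edgeSum_rel_pos (L : SquareLabels G.Adj a b)
    (hAdj : ∀ u v, G.Adj u v → H.Adj (a u v) (b u v)) :
    BipartiteRel H.Adj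
      (fun x => (labelIdeal G a b).ringCon.mk'
        (edgeSum (flip G.Adj) (pr G) (pl G) (flip a) x))
      (fun y => (labelIdeal G a b).ringCon.mk' (edgeSum G.Adj (pl G) (pr G) b y)) := by
  simp only [map_edgeSum]
  exact ((rel G).map _).swap.edgeSum_rel L.swap
    (fun y hy => labelGen_map_eq_zero (by rwa [labelGen_swap] at hy)) fun v u => hAdj u v

/-- Self-adjointness and the relations hold for the glued elements in both quotients, hence in the
algebra itself, and the universal property applies. -/
theorem exists_isLabelHom (L : SquareLabels G.Adj a b)
    (hAdj : ∀ u v, G.Adj u v → H.Adj (a u v) (b u v)) :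
    ∃ f : H.CStar →⋆ₐ[ℂ] G.CStar, IsLabelHom a b f := by
  choose P hP1 hP2 using exists_glue L a
  choose Q hQ1 hQ2 using exists_glue L.symm b
  have hPs : ∀ x, IsSelfAdjoint (P x) := fun x => isSelfAdjoint_of_sub_mem L
    (isSelfAdjoint_edgeSum _ isSelfAdjoint_pl isSelfAdjoint_pr _ _)
    (isSelfAdjoint_edgeSum _ isSelfAdjoint_pr isSelfAdjoint_pl _ _) (hP1 x) (hP2 x)
  have hQs : ∀ x, IsSelfAdjoint (Q x) := fun x => isSelfAdjoint_of_sub_mem L.symm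
    (isSelfAdjoint_edgeSum _ isSelfAdjoint_pl isSelfAdjoint_pr _ _)
    (isSelfAdjoint_edgeSum _ isSelfAdjoint_pr isSelfAdjoint_pl _ _) (hQ1 x) (hQ2 x)
  have hrel : BipartiteRel H.Adj P Q := by
    refine BipartiteRel.of_map (labelIdeal G a b).ringCon.mk' (labelIdeal G b a).ringCon.mk'
      (fun x h1 h2 => eq_zero_of_mem_labelIdeal L ((TwoSidedIdeal.mk'_eq_zero_iff _ _).1 h1)
        ((TwoSidedIdeal.mk'_eq_zero_iff _ _).1 h2)) ?_ ?_
    · simp only [(TwoSidedIdeal.mk'_eq_iff _ _ _).2 (hP2 _),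
        (TwoSidedIdeal.mk'_eq_iff _ _ _).2 (hQ1 _)]
      exact edgeSum_rel_pos L hAdj
    · simp only [(TwoSidedIdeal.mk'_eq_iff _ _ _).2 (hP1 _),
        (TwoSidedIdeal.mk'_eq_iff _ _ _).2 (hQ2 _)]
      exact edgeSum_rel_neg L hAdj
  have hl : ∀ x, lift hPs hQs hrel (pl H x) = P x := lift_inl hPs hQs hrel
  have hr : ∀ y, lift hPs hQs hrel (pr H y) = Q y := lift_inr hPs hQs hrel
  exact ⟨lift hPs hQs hrel, fun x => (hl x).symm ▸ hP1 x, fun x => (hl x).symm ▸ hP2 x,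
    fun y => (hr y).symm ▸ hQ2 y, fun y => (hr y).symm ▸ hQ1 y⟩

section Comp

variable {a' : X → Y → U} {b' : X → Y → V}

/-- Composition of label homomorphisms for inverse labels, modulo one of the ideals. -/
theorem comp_sub_mem_neg (L : SquareLabels G.Adj a b) (L' : SquareLabels H.Adj a' b')
    (hAdj : ∀ u v, G.Adj u v → H.Adj (a u v) (b u v))
    (hinv : ∀ u v, G.Adj u v → a' (a u v) (b u v) = u ∧ b' (a u v) (b u v) = v)
    {f : H.CStar →⋆ₐ[ℂ] G.CStar} {f' : G.CStar →⋆ₐ[ℂ] H.CStar}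
    (hf : IsLabelHom a b f) (hf' : IsLabelHom a' b' f') :
    (∀ x, f' (f (pl H x)) - pl H x ∈ labelIdeal H b' a') ∧
    (∀ y, f' (f (pr H y)) - pr H y ∈ labelIdeal H b' a') := by
  let π := (labelIdeal H b' a').ringCon.mk'
  let g : G.CStar →+* (labelIdeal H b' a').ringCon.Quotient := π.comp (f' : G.CStar →+* H.CStar)
  have hgl : ∀ u, g (pl G u) = edgeSum H.Adj (fun x => π (pl H x)) (fun y => π (pr H y)) a' u :=
    fun u => ((TwoSidedIdeal.mk'_eq_iff _ _ _).2 (hf'.left_neg u)).trans (map_edgeSum π ..)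
  have hgr : ∀ v, g (pr G v) =
      edgeSum (flip H.Adj) (fun y => π (pr H y)) (fun x => π (pl H x)) (flip b') v :=
    fun v => ((TwoSidedIdeal.mk'_eq_iff _ _ _).2 (hf'.right_neg v)).trans (map_edgeSum π ..)
  have hH := (rel H).map π
  have hG := (rel G).map g
  have hK : ∀ z ∈ labelGen H.Adj (fun x => π (pl H x)) (fun y => π (pr H y)) b' a', z = 0 :=
    fun z hz => labelGen_map_eq_zero hz
  have hPQ : ∀ u v, G.Adj u v →
      g (pl G u) * g (pr G v) = π (pl H (a u v)) * π (pr H (b u v)) := fun u v huv => by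
    have := hH.edgeSum_mul_edgeSum_of_adj L' hK (hAdj u v huv)
    rwa [(hinv u v huv).1, (hinv u v huv).2, ← hgl, ← hgr] at this
  have hQP : ∀ u v, G.Adj u v →
      g (pr G v) * g (pl G u) = π (pr H (b u v)) * π (pl H (a u v)) := fun u v huv => by
    have := hH.swap.edgeSum_mul_edgeSum_of_adj L'.swap.symm
      (fun z hz => hK z (by rwa [labelGen_swap] at hz)) (hAdj u v huv)
    simp only [flip] at this
    rw [(hinv u v huv).1, (hinv u v huv).2] at this
    rw [hgl, hgr]
    exact this
  -- Since g kills the flipped ideal of G, the values of f may be replaced by their edge sums modulo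
  -- that ideal.
  have hg0 : ∀ x ∈ labelGen G.Adj (pl G) (pr G) b a, g x = 0 := fun x hx =>
    hH.labelGen_eq_zero_of_mul_eq hPQ hQP L hG.idem_left hG.idem_right (map_mem_labelGen g hx)
  constructor
  · intro x
    rw [← TwoSidedIdeal.mk'_eq_iff]
    have h1 := map_eq_of_sub_mem_labelIdeal g hg0 (hf.left_neg x)
    rw [map_edgeSum, hG.edgeSum_eq_of_mul_eq hH hPQ hQP] at h1
    exact h1
  · intro y
    rw [← TwoSidedIdeal.mk'_eq_iff]
    have h1 := map_eq_of_sub_mem_labelIdeal g hg0 (hf.right_neg y)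
    rw [map_edgeSum] at h1
    exact h1.trans (hG.swap.edgeSum_eq_of_mul_eq hH.swap (a := flip b) (b := flip a)
      (fun v u => hQP u v) (fun v u => hPQ u v) y)

/-- The surviving squares exchange sides, so g sends p_u q_v to the generators of H at the image
edge in reversed order; otherwise the argument is that of `comp_sub_mem_neg`. -/
theorem comp_sub_mem_pos (L : SquareLabels G.Adj a b) (L' : SquareLabels H.Adj a' b')
    (hAdj : ∀ u v, G.Adj u v → H.Adj (a u v) (b u v))
    (hinv : ∀ u v, G.Adj u v → a' (a u v) (b u v) = u ∧ b' (a u v) (b u v) = v)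
    {f : H.CStar →⋆ₐ[ℂ] G.CStar} {f' : G.CStar →⋆ₐ[ℂ] H.CStar}
    (hf : IsLabelHom a b f) (hf' : IsLabelHom a' b' f') :
    (∀ x, f' (f (pl H x)) - pl H x ∈ labelIdeal H a' b') ∧
    (∀ y, f' (f (pr H y)) - pr H y ∈ labelIdeal H a' b') := by
  let π := (labelIdeal H a' b').ringCon.mk'
  let g : G.CStar →+* (labelIdeal H a' b').ringCon.Quotient := π.comp (f' : G.CStar →+* H.CStar)
  have hgl : ∀ u, g (pl G u) =
      edgeSum (flip H.Adj) (fun y => π (pr H y)) (fun x => π (pl H x)) (flip a') u :=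
    fun u => ((TwoSidedIdeal.mk'_eq_iff _ _ _).2 (hf'.left_pos u)).trans (map_edgeSum π ..)
  have hgr : ∀ v, g (pr G v) = edgeSum H.Adj (fun x => π (pl H x)) (fun y => π (pr H y)) b' v :=
    fun v => ((TwoSidedIdeal.mk'_eq_iff _ _ _).2 (hf'.right_pos v)).trans (map_edgeSum π ..)
  have hH := (rel H).map π
  have hG := (rel G).map g
  have hK : ∀ z ∈ labelGen H.Adj (fun x => π (pl H x)) (fun y => π (pr H y)) a' b', z = 0 :=
    fun z hz => labelGen_map_eq_zero hz
  have hPQ : ∀ u v, G.Adj u v →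
      g (pl G u) * g (pr G v) = π (pr H (b u v)) * π (pl H (a u v)) := fun u v huv => by
    have := hH.swap.edgeSum_mul_edgeSum_of_adj L'.swap
      (fun z hz => hK z (by rwa [labelGen_swap] at hz)) (hAdj u v huv)
    simp only [flip] at this
    rw [(hinv u v huv).1, (hinv u v huv).2] at this
    rw [hgl, hgr]
    exact this
  have hQP : ∀ u v, G.Adj u v →
      g (pr G v) * g (pl G u) = π (pl H (a u v)) * π (pr H (b u v)) := fun u v huv => by
    have := hH.edgeSum_mul_edgeSum_of_adj L'.symm hK (hAdj u v huv)
    rw [(hinv u v huv).1, (hinv u v huv).2] at this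
    rw [hgl, hgr]
    exact this
  have hg0 : ∀ x ∈ labelGen G.Adj (pl G) (pr G) a b, g x = 0 := fun x hx =>
    hH.swap.labelGen_eq_zero_of_mul_eq hPQ hQP L.symm hG.idem_left hG.idem_right
      (map_mem_labelGen g hx)
  constructor
  · intro x
    rw [← TwoSidedIdeal.mk'_eq_iff]
    have h1 := map_eq_of_sub_mem_labelIdeal g hg0 (hf.left_pos x)
    rw [map_edgeSum] at h1
    exact h1.trans (hG.swap.edgeSum_eq_of_mul_eq hH (a := flip a) (b := flip b)
      (fun v u => hQP u v) (fun v u => hPQ u v) x)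
  · intro y
    rw [← TwoSidedIdeal.mk'_eq_iff]
    have h1 := map_eq_of_sub_mem_labelIdeal g hg0 (hf.right_pos y)
    rw [map_edgeSum] at h1
    exact h1.trans (hG.edgeSum_eq_of_mul_eq hH.swap hPQ hQP y)

theorem comp_eq_id (L : SquareLabels G.Adj a b) (L' : SquareLabels H.Adj a' b')
    (hAdj : ∀ u v, G.Adj u v → H.Adj (a u v) (b u v))
    (hinv : ∀ u v, G.Adj u v → a' (a u v) (b u v) = u ∧ b' (a u v) (b u v) = v)
    {f : H.CStar →⋆ₐ[ℂ] G.CStar} {f' : G.CStar →⋆ₐ[ℂ] H.CStar}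
    (hf : IsLabelHom a b f) (hf' : IsLabelHom a' b' f') (x : H.CStar) : f' (f x) = x := by
  have h : f'.comp f = StarAlgHom.id ℂ H.CStar := by
    have h1 := comp_sub_mem_neg L L' hAdj hinv hf hf'
    have h2 := comp_sub_mem_pos L L' hAdj hinv hf hf'
    refine hom_ext ?_
    rintro (x | y)
    · exact sub_eq_zero.1 (eq_zero_of_mem_labelIdeal L' (h2.1 x) (h1.1 x))
    · exact sub_eq_zero.1 (eq_zero_of_mem_labelIdeal L' (h2.2 y) (h1.2 y))
  exact congrArg (fun g : H.CStar →⋆ₐ[ℂ] H.CStar => g x) h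

/-- Two bipartite graphs with inverse square-preserving edge labels have isomorphic
C*-algebras. -/
theorem nonempty_starAlgEquiv (L : SquareLabels G.Adj a b) (L' : SquareLabels H.Adj a' b')
    (hAdj : ∀ u v, G.Adj u v → H.Adj (a u v) (b u v))
    (hAdj' : ∀ x y, H.Adj x y → G.Adj (a' x y) (b' x y))
    (hinv : ∀ u v, G.Adj u v → a' (a u v) (b u v) = u ∧ b' (a u v) (b u v) = v)
    (hinv' : ∀ x y, H.Adj x y → a (a' x y) (b' x y) = x ∧ b (a' x y) (b' x y) = y) :
    Nonempty (G.CStar ≃⋆ₐ[ℂ] H.CStar) := by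
  obtain ⟨f, hf⟩ := exists_isLabelHom L hAdj
  obtain ⟨f', hf'⟩ := exists_isLabelHom L' hAdj'
  exact ⟨StarAlgEquiv.ofStarAlgHom f' f
    (by ext x; exact comp_eq_id L' L hAdj' hinv' hf' hf x)
    (by ext x; exact comp_eq_id L L' hAdj hinv hf hf' x)⟩

end Comp

end BipartiteGraph.CStar

/-! ### From square-preserving bijections of edges to isomorphisms. -/

namespace BipartiteGraph

/-- The edges of a bipartite graph. -/
abbrev Edge {U V : Type*} (G : BipartiteGraph U V) : Type _ := {e : U × V // G.Adj e.1 e.2}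

/-- The pairs `e`, `f` and `g`, `h` are the pairs of opposite edges of a square. -/
def IsSquare {U V : Type*} (e f g h : U × V) : Prop :=
  e.1 ≠ f.1 ∧ e.2 ≠ f.2 ∧
    ((g = (e.1, f.2) ∧ h = (f.1, e.2)) ∨ (h = (e.1, f.2) ∧ g = (f.1, e.2)))

variable {U V X Y : Type*} {G : BipartiteGraph U V} {H : BipartiteGraph X Y}

open Classical in
/-- The left end of the image of an edge. -/
noncomputable def labelLeft [Nonempty X] (φ : G.Edge → H.Edge) (u : U) (v : V) : X :=
  if h : G.Adj u v then (φ ⟨(u, v), h⟩).1.1 else Classical.arbitrary X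

open Classical in
/-- The right end of the image of an edge. -/
noncomputable def labelRight [Nonempty Y] (φ : G.Edge → H.Edge) (u : U) (v : V) : Y :=
  if h : G.Adj u v then (φ ⟨(u, v), h⟩).1.2 else Classical.arbitrary Y

section Labels

variable [Nonempty X] [Nonempty Y] (φ : G.Edge → H.Edge)

theorem label_eq {u : U} {v : V} (h : G.Adj u v) :
    (labelLeft φ u v, labelRight φ u v) = (φ ⟨(u, v), h⟩).1 := by
  rw [labelLeft, labelRight, dif_pos h, dif_pos h]

theorem adj_label (u : U) (v : V) (h : G.Adj u v) :
    H.Adj (labelLeft φ u v) (labelRight φ u v) := by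
  have := (φ ⟨(u, v), h⟩).2
  rwa [← label_eq φ h] at this

theorem squareLabels {φ : G.Edge → H.Edge} (hφ : Function.Injective φ)
    (hsq : ∀ e f g h : G.Edge, IsSquare e.1 f.1 g.1 h.1 →
      IsSquare (φ e).1 (φ f).1 (φ g).1 (φ h).1) :
    SquareLabels G.Adj (labelLeft φ) (labelRight φ) where
  inj u v u' v' h h' ha hb := by
    have : φ ⟨(u, v), h⟩ = φ ⟨(u', v'), h'⟩ := Subtype.ext (by
      rw [← label_eq φ h, ← label_eq φ h', ha, hb])
    have := congrArg Subtype.val (hφ this)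
    exact ⟨congrArg Prod.fst this, congrArg Prod.snd this⟩
  square u u' v v' hu hv h1 h2 h3 h4 := by
    have := hsq ⟨(u, v), h1⟩ ⟨(u', v'), h4⟩ ⟨(u, v'), h2⟩ ⟨(u', v), h3⟩
      ⟨hu, hv, Or.inl ⟨rfl, rfl⟩⟩
    rw [← label_eq φ h1, ← label_eq φ h2, ← label_eq φ h3, ← label_eq φ h4] at this
    simp only [IsSquare, Prod.mk.injEq] at this
    grind

end Labels

/-- Expanding 1 as the product of the two sums of projections leaves only products over non-edges.
-/
theorem subsingleton_of_isEmpty [Fintype U] [Fintype V] (G : BipartiteGraph U V)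
    (hG : IsEmpty G.Edge) : Subsingleton G.CStar := by
  refine subsingleton_of_zero_eq_one ?_
  have h : (∑ u, CStar.p (Sum.inl u)) * ∑ v, CStar.p (Sum.inr v) = (1 : G.CStar) := by
    rw [CStar.sum_p_inl, CStar.sum_p_inr, one_mul]
  rw [← h, Finset.sum_mul_sum]
  exact (Finset.sum_eq_zero fun u _ => Finset.sum_eq_zero fun v _ =>
    CStar.p_inl_mul_p_inr fun h => hG.false ⟨(u, v), h⟩).symm

theorem nonempty_starAlgEquiv_of_edgeEquiv [Fintype U] [Fintype V] [Fintype X] [Fintype Y]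
    (φ : G.Edge ≃ H.Edge)
    (hφ : ∀ e f g h : G.Edge, IsSquare e.1 f.1 g.1 h.1 ↔
      IsSquare (φ e).1 (φ f).1 (φ g).1 (φ h).1) : Nonempty (G.CStar ≃⋆ₐ[ℂ] H.CStar) := by
  -- Labels take default values off the edges and so need nonempty vertex sets; without edges both
  -- algebras are zero.
  by_cases hE : Nonempty G.Edge
  · have : Nonempty U := hE.map fun e => e.1.1
    have : Nonempty V := hE.map fun e => e.1.2
    have : Nonempty X := hE.map fun e => (φ e).1.1
    have : Nonempty Y := hE.map fun e => (φ e).1.2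
    refine CStar.nonempty_starAlgEquiv (a := labelLeft φ) (b := labelRight φ)
      (a' := labelLeft φ.symm) (b' := labelRight φ.symm)
      (squareLabels φ.injective fun e f g h => (hφ e f g h).1)
      (squareLabels φ.symm.injective fun e f g h hs => (hφ _ _ _ _).2 (by simpa using hs))
      (adj_label φ) (adj_label φ.symm) (fun u v h => ?_) (fun u v h => ?_)
    · have h1 := label_eq φ.symm (adj_label φ u v h)
      have h2 : (⟨_, adj_label φ u v h⟩ : H.Edge) = φ ⟨(u, v), h⟩ := Subtype.ext (label_eq φ h)
      rw [h2, Equiv.symm_apply_apply] at h1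
      exact Prod.mk.inj h1
    · have h1 := label_eq φ (adj_label φ.symm u v h)
      have h2 : (⟨_, adj_label φ.symm u v h⟩ : G.Edge) = φ.symm ⟨(u, v), h⟩ :=
        Subtype.ext (label_eq φ.symm h)
      rw [h2, Equiv.apply_symm_apply] at h1
      exact Prod.mk.inj h1
  · have := subsingleton_of_isEmpty G (not_nonempty_iff.1 hE)
    have := subsingleton_of_isEmpty H (not_nonempty_iff.1 fun h => hE (h.map φ.symm))
    exact ⟨{
      toFun := fun _ => 0
      invFun := fun _ => 0
      left_inv := fun _ => Subsingleton.elim _ _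
      right_inv := fun _ => Subsingleton.elim _ _
      map_mul' := fun _ _ => Subsingleton.elim _ _
      map_add' := fun _ _ => Subsingleton.elim _ _
      map_star' := fun _ => Subsingleton.elim _ _
      map_smul' := fun _ _ => Subsingleton.elim _ _ }⟩

end BipartiteGraph

/-! ### Representations from pairs of orthonormal bases. -/

open InnerProductSpace in
open Classical in
/-- The projections onto the spans of those members of a family of vectors that have a given
index. -/
noncomputable def basisFamily {ι U H : Type*} [Fintype ι] [NormedAddCommGroup H]
    [InnerProductSpace ℂ H] (u : ι → U) (e : ι → H) (x : U) : H →L[ℂ] H :=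
  ∑ i, if u i = x then rankOne ℂ (e i) (e i) else 0

section BasisFamily

open InnerProductSpace

variable {ι U V H : Type*} [Fintype ι] [NormedAddCommGroup H] [InnerProductSpace ℂ H]

theorem OrthonormalBasis.ext_clm {H' : Type*} [NormedAddCommGroup H'] [NormedSpace ℂ H']
    (e : OrthonormalBasis ι ℂ H) {S T : H →L[ℂ] H'} (h : ∀ i, S (e i) = T (e i)) : S = T := by
  refine ContinuousLinearMap.coe_injective (e.toBasis.ext fun i => ?_)
  simpa using h i

open Classical in
theorem basisFamily_apply (u : ι → U) (e : ι → H) (x : U) (z : H) :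
    basisFamily u e x z = ∑ i, if u i = x then inner ℂ (e i) z • e i else 0 := by
  rw [basisFamily, sum_apply]
  refine Finset.sum_congr rfl fun i _ => ?_
  split_ifs <;> simp

open Classical in
theorem basisFamily_apply_self (u : ι → U) {e : ι → H} (he : Orthonormal ℂ e) (x : U) (i : ι) :
    basisFamily u e x (e i) = if u i = x then e i else 0 := by
  rw [basisFamily_apply, Finset.sum_eq_single i]
  · rw [inner_self_eq_norm_sq_to_K, he.1 i]
    simp
  · intro j _ hj
    rw [he.2 hj, zero_smul, ite_self]
  · simp

theorem basisFamily_of_injective {u : ι → U} (hu : Function.Injective u) (e : ι → H) (i : ι) :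
    basisFamily u e (u i) = rankOne ℂ (e i) (e i) := by
  classical
  rw [basisFamily, Finset.sum_eq_single i]
  · rw [if_pos rfl]
  · intro j _ hj
    rw [if_neg fun h => hj (hu h)]
  · simp

theorem basisFamily_of_notMem {u : ι → U} (e : ι → H) {x : U} (hx : ∀ i, u i ≠ x) :
    basisFamily u e x = 0 :=
  Finset.sum_eq_zero fun i _ => if_neg (hx i)

theorem isSelfAdjoint_basisFamily [CompleteSpace H] (u : ι → U) (e : ι → H) (x : U) :
    IsSelfAdjoint (basisFamily u e x) := by
  rw [IsSelfAdjoint, basisFamily, star_sum]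
  refine Finset.sum_congr rfl fun i _ => ?_
  split_ifs
  · rw [ContinuousLinearMap.star_eq_adjoint, adjoint_rankOne]
  · simp

theorem basisFamily_mul_self (e : OrthonormalBasis ι ℂ H) (u : ι → U) (x : U) :
    basisFamily u e x * basisFamily u e x = basisFamily u e x := by
  classical
  refine e.ext_clm fun i => ?_
  rw [mul_apply_eq_comp, basisFamily_apply_self u e.orthonormal]
  split_ifs with h
  · rw [basisFamily_apply_self u e.orthonormal, if_pos h]
  · simp

theorem basisFamily_mul_of_ne (e : OrthonormalBasis ι ℂ H) (u : ι → U) (x x' : U) (hx : x ≠ x') :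
    basisFamily u e x * basisFamily u e x' = 0 := by
  classical
  refine e.ext_clm fun i => ?_
  rw [mul_apply_eq_comp, basisFamily_apply_self u e.orthonormal]
  split_ifs with h
  · rw [basisFamily_apply_self u e.orthonormal, if_neg (by rw [h]; exact hx.symm)]
    rfl
  · simp

theorem sum_basisFamily [Fintype U] (e : OrthonormalBasis ι ℂ H) (u : ι → U) :
    ∑ x, basisFamily u e x = 1 := by
  classical
  refine e.ext_clm fun i => ?_
  rw [sum_apply]
  simp [basisFamily_apply_self u e.orthonormal]

theorem basisFamily_rel [Fintype U] [Fintype V] (e f : OrthonormalBasis ι ℂ H) (u : ι → U)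
    (v : ι → V) {Adj : U → V → Prop} (hadj : ∀ i j, Adj (u i) (v j)) :
    BipartiteRel Adj (basisFamily u e) (basisFamily v f) := by
  classical
  have key : ∀ (x : U) (y : V), ¬ Adj x y → basisFamily u e x = 0 ∨ basisFamily v f y = 0 := by
    intro x y hxy
    by_contra! hc
    obtain ⟨i, hi⟩ : ∃ i, u i = x := by
      by_contra! h
      exact hc.1 (basisFamily_of_notMem _ h)
    obtain ⟨j, hj⟩ : ∃ j, v j = y := by
      by_contra! h
      exact hc.2 (basisFamily_of_notMem _ h)
    exact hxy (hi ▸ hj ▸ hadj i j)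
  refine ⟨basisFamily_mul_self e u, basisFamily_mul_of_ne e u, sum_basisFamily e u,
    basisFamily_mul_self f v, basisFamily_mul_of_ne f v, sum_basisFamily f v, fun x y h => ?_,
    fun x y h => ?_⟩
  · rcases key x y h with h | h <;> simp [h]
  · rcases key x y h with h | h <;> simp [h]

theorem map_basisFamily {H' : Type*} [NormedAddCommGroup H'] [InnerProductSpace ℂ H']
    (T : H →ₗᵢ[ℂ] H') (e : OrthonormalBasis ι ℂ H) (u : ι → U) (x : U) (z : H) :
    T (basisFamily u e x z) = basisFamily u (T ∘ e) x (T z) := by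
  classical
  rw [basisFamily_apply, basisFamily_apply, map_sum]
  refine Finset.sum_congr rfl fun i _ => ?_
  split_ifs
  · simp
  · simp

end BasisFamily

/-- On the spectrum of P, contained in {0, 1}, the function t ↦ f(rt) coincides with t ↦ f(r) t
because `f 0 = 0`. -/
theorem cfc_smul_of_isIdempotentElem {B : Type*} [CStarAlgebra B] {P : B} (hP : IsSelfAdjoint P)
    (hi : P * P = P) (r : ℝ) {f : ℝ → ℝ} (hf : Continuous f) (h0 : f 0 = 0) :
    cfc f (r • P) = f r • P := by
  rw [← cfc_comp_smul r f P]
  have h : Set.EqOn (fun x => f (r • x)) (fun x => f r * x) (spectrum ℝ P) := by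
    intro x hx
    have : x = 0 ∨ x = 1 := by
      have h1 := IsIdempotentElem.spectrum_subset ℝ (show IsIdempotentElem P from hi) hx
      simpa using h1
    rcases this with rfl | rfl <;> simp [h0]
  rw [cfc_congr h, cfc_const_mul_id (f r) P]

namespace BipartiteGraph.CStar

variable {U V : Type*} [Fintype U] [Fintype V] {G : BipartiteGraph U V}

theorem intertwine {H H' : Type*} [NormedAddCommGroup H] [InnerProductSpace ℂ H]
    [CompleteSpace H] [NormedAddCommGroup H'] [InnerProductSpace ℂ H'] [CompleteSpace H']
    (π : G.CStar →⋆ₐ[ℂ] (H →L[ℂ] H)) (ρ : G.CStar →⋆ₐ[ℂ] (H' →L[ℂ] H')) (T : H →L[ℂ] H')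
    (h : ∀ x z, T (π (p x) z) = ρ (p x) (T z)) (a : G.CStar) (z : H) :
    T (π a z) = ρ a (T z) := by
  revert z
  have hπ := continuous_hom π
  have hρ := continuous_hom ρ
  refine induction (P := fun a => ∀ z, T (π a z) = ρ a (T z)) ?_ (by simp) ?_ ?_ ?_ a
  · simp only [Set.ofPred_forall]
    refine isClosed_iInter fun z => isClosed_eq ?_ ?_
    · exact T.continuous.comp (hπ.clm_apply continuous_const)
    · exact hρ.clm_apply continuous_const
  · intro a b ha hb z
    simp [ha, hb]
  · intro c a ha z
    simp [ha]
  · intro x a ha z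
    simp [h, ha]

theorem invariant_of_generators {H : Type*} [NormedAddCommGroup H] [InnerProductSpace ℂ H]
    [CompleteSpace H] (π : G.CStar →⋆ₐ[ℂ] (H →L[ℂ] H)) {K : Submodule ℂ H}
    (hK : IsClosed (K : Set H)) (h : ∀ x, ∀ z ∈ K, π (p x) z ∈ K) (a : G.CStar) :
    ∀ z ∈ K, π a z ∈ K := by
  have hπ := continuous_hom π
  refine induction (P := fun a => ∀ z ∈ K, π a z ∈ K) ?_ (by simp) ?_ ?_ ?_ a
  · simp only [Set.ofPred_forall]
    exact isClosed_iInter fun z => isClosed_iInter fun _ =>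
      hK.preimage (hπ.clm_apply continuous_const)
  · intro a b ha hb z hz
    simpa using K.add_mem (ha z hz) (hb z hz)
  · intro c a ha z hz
    simpa using K.smul_mem c (ha z hz)
  · intro x a ha z hz
    simpa using h x _ (ha z hz)

section BasisHom

variable {ι H : Type*} [Fintype ι] [NormedAddCommGroup H] [InnerProductSpace ℂ H]
  [CompleteSpace H]

/-- The representation of `C*(G)` given by two orthonormal bases whose members are indexed by
pairwise adjacent vertices. -/
noncomputable def basisHom (e f : OrthonormalBasis ι ℂ H) (u : ι → U) (v : ι → V)
    (hadj : ∀ i j, G.Adj (u i) (v j)) : G.CStar →⋆ₐ[ℂ] (H →L[ℂ] H) :=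
  lift (isSelfAdjoint_basisFamily u e) (isSelfAdjoint_basisFamily v f) (basisFamily_rel e f u v hadj)

variable (e f : OrthonormalBasis ι ℂ H) {u : ι → U} {v : ι → V}
  (hadj : ∀ i j, G.Adj (u i) (v j))

theorem basisHom_inl (x : U) : basisHom e f u v hadj (p (Sum.inl x)) = basisFamily u e x :=
  lift_inl ..

theorem basisHom_inr (y : V) : basisHom e f u v hadj (p (Sum.inr y)) = basisFamily v f y :=
  lift_inr ..

-- A nonzero vector of K has a component along some `e i`, so a rank-one projection puts `e i` into
-- K; the nonzero overlaps then put every `f j` into K.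
open InnerProductSpace in
theorem basisHom_irreducible (hu : Function.Injective u) (hv : Function.Injective v)
    (hne : ∀ i j, inner ℂ (f j) (e i) ≠ 0) (K : Submodule ℂ H)
    (hK : ∀ a, ∀ z ∈ K, basisHom e f u v hadj a z ∈ K) : K = ⊥ ∨ K = ⊤ := by
  by_contra! hc
  obtain ⟨z, hz, hz0⟩ := K.exists_mem_ne_zero_of_ne_bot hc.1
  obtain ⟨i, hi⟩ : ∃ i, inner ℂ (e i) z ≠ 0 := by
    by_contra! h
    refine hz0 ?_
    rw [← e.sum_repr' z]
    simp [h]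
  have h1 : e i ∈ K := by
    have := hK (p (Sum.inl (u i))) z hz
    rw [basisHom_inl, basisFamily_of_injective hu, rankOne_apply] at this
    exact (K.smul_mem_iff hi).1 this
  refine hc.2 (eq_top_iff.2 fun w _ => ?_)
  rw [← f.sum_repr' w]
  refine K.sum_mem fun j _ => K.smul_mem _ ?_
  have := hK (p (Sum.inr (v j))) (e i) h1
  rw [basisHom_inr, basisFamily_of_injective hv, rankOne_apply] at this
  exact (K.smul_mem_iff (hne i j)).1 this

/-- The element `p_x p_y p_x` of `C*(G)`. -/
noncomputable def cornerElt (G : BipartiteGraph U V) (x : U) (y : V) : G.CStar :=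
  p (Sum.inl x) * p (Sum.inr y) * p (Sum.inl x)

theorem isSelfAdjoint_cornerElt (x : U) (y : V) : IsSelfAdjoint (cornerElt G x y) := by
  rw [IsSelfAdjoint, cornerElt]
  simp [(isSelfAdjoint_p _).star_eq, mul_assoc]

-- Compressing one rank-one projection by another leaves the squared overlap as a factor. Thus a
-- single number describes this element.
open InnerProductSpace in
theorem basisHom_cornerElt (hu : Function.Injective u) (hv : Function.Injective v) (i j : ι) :
    basisHom e f u v hadj (cornerElt G (u i) (v j)) =
      (‖inner ℂ (e i) (f j)‖ ^ 2) • rankOne ℂ (e i) (e i) := by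
  rw [cornerElt, map_mul, map_mul, basisHom_inl, basisHom_inr, basisFamily_of_injective hu,
    basisFamily_of_injective hv]
  ext z
  have h1 : inner ℂ (f j) (e i) * inner ℂ (e i) (f j) = ((‖inner ℂ (e i) (f j)‖ ^ 2 : ℝ) : ℂ) := by
    rw [← inner_conj_symm, RCLike.conj_mul]
    simp
  simp only [mul_apply_eq_comp, rankOne_apply, inner_smul_right, smul_apply]
  rw [mul_assoc, h1, mul_comm, ← smul_smul]
  rfl

theorem basisHom_cornerElt_of_notMem {x : U} {y : V} (h : (∀ i, u i ≠ x) ∨ ∀ j, v j ≠ y) :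
    basisHom e f u v hadj (cornerElt G x y) = 0 := by
  rw [cornerElt, map_mul, map_mul, basisHom_inl, basisHom_inr]
  rcases h with h | h
  · rw [basisFamily_of_notMem _ h]
    simp
  · rw [basisFamily_of_notMem _ h]
    simp

end BasisHom

end BipartiteGraph.CStar

/-! ### Reflected orthonormal bases of the plane. -/

section RotBasis

variable {H : Type*} [NormedAddCommGroup H] [InnerProductSpace ℂ H]

/-- The reflection of a pair of vectors with matrix entries `c`, `s`. -/
noncomputable def rotVec (e : Fin 2 → H) (c s : ℝ) : Fin 2 → H :=
  ![(c : ℂ) • e 0 + (s : ℂ) • e 1, (s : ℂ) • e 0 - (c : ℂ) • e 1]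

theorem inner_rotVec {e : Fin 2 → H} (he : Orthonormal ℂ e) (c s : ℝ) (i j : Fin 2) :
    inner ℂ (rotVec e c s j) (e i) =
      ((!![c, s; s, -c] : Matrix (Fin 2) (Fin 2) ℝ) j i : ℂ) := by
  have h1 : inner ℂ (e 0) (e 1) = 0 := he.2 (by decide)
  have h2 : inner ℂ (e 1) (e 0) = 0 := he.2 (by decide)
  have h3 := he.1
  fin_cases i <;> fin_cases j <;>
    simp [rotVec, h1, h2, h3]

theorem orthonormal_rotVec {e : Fin 2 → H} (he : Orthonormal ℂ e) {c s : ℝ}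
    (hcs : c * c + s * s = 1) : Orthonormal ℂ (rotVec e c s) := by
  have h := inner_rotVec he c s
  have hc : (c : ℂ) * c + s * s = 1 := by exact_mod_cast hcs
  rw [orthonormal_iff_ite]
  intro i j
  have e1 : rotVec e c s 0 = (c : ℂ) • e 0 + (s : ℂ) • e 1 := rfl
  have e2 : rotVec e c s 1 = (s : ℂ) • e 0 - (c : ℂ) • e 1 := rfl
  fin_cases j
  · simp only [Fin.zero_eta]
    rw [e1, inner_add_right, inner_smul_right, inner_smul_right, h, h]
    fin_cases i
    · simpa using hc
    · simp [mul_comm]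
  · simp only [Fin.mk_one]
    rw [e2, inner_sub_right, inner_smul_right, inner_smul_right, h, h]
    fin_cases i
    · simp [mul_comm]
    · simpa [add_comm] using hc

/-- The reflection of a two-dimensional orthonormal basis with parameter `θ`. -/
noncomputable def rotBasis (e : OrthonormalBasis (Fin 2) ℂ H) (θ : ℝ) :
    OrthonormalBasis (Fin 2) ℂ H :=
  haveI : FiniteDimensional ℂ H := e.toBasis.finiteDimensional_of_finite
  (basisOfOrthonormalOfCardEqFinrank (orthonormal_rotVec (c := Real.cos θ) (s := Real.sin θ)
    e.orthonormal (by rw [← sq, ← sq, Real.cos_sq_add_sin_sq]))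
    (Module.finrank_eq_card_basis e.toBasis).symm).toOrthonormalBasis (by
      rw [coe_basisOfOrthonormalOfCardEqFinrank]
      exact orthonormal_rotVec e.orthonormal (by rw [← sq, ← sq, Real.cos_sq_add_sin_sq]))

theorem coe_rotBasis (e : OrthonormalBasis (Fin 2) ℂ H) (θ : ℝ) :
    ⇑(rotBasis e θ) = rotVec e (Real.cos θ) (Real.sin θ) := by
  simp [rotBasis]

theorem map_rotVec {H' : Type*} [NormedAddCommGroup H'] [InnerProductSpace ℂ H']
    (T : H →ₗ[ℂ] H') (e : Fin 2 → H) (c s : ℝ) : T ∘ rotVec e c s = rotVec (T ∘ e) c s := by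
  funext i
  fin_cases i <;> simp [rotVec]

end RotBasis

/-- The standard complex Hilbert space of dimension `k`, in a given universe. -/
abbrev StdSpace.{w} (k : ℕ) : Type w := EuclideanSpace ℂ (ULift.{w} (Fin k))

/-- The standard orthonormal basis. -/
noncomputable def stdBasis.{w} (k : ℕ) : OrthonormalBasis (Fin k) ℂ (StdSpace.{w} k) :=
  (EuclideanSpace.basisFun (ULift.{w} (Fin k)) ℂ).reindex Equiv.ulift

theorem finrank_stdSpace.{w} (k : ℕ) : Module.finrank ℂ (StdSpace.{w} k) = k := by
  simp [StdSpace]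

/-! ### The representations attached to edges and squares. -/

namespace BipartiteGraph

variable {U V : Type*} [Fintype U] [Fintype V] {G : BipartiteGraph U V}

namespace CStar

/-- The irreducible representation given by an orthonormal basis of the standard Hilbert space in
general position. -/
noncomputable def basisRep {k : ℕ} [NeZero k] (f : OrthonormalBasis (Fin k) ℂ (StdSpace k))
    {u : Fin k → U} {v : Fin k → V} (hu : Function.Injective u) (hv : Function.Injective v)
    (hadj : ∀ i j, G.Adj (u i) (v j)) (hne : ∀ i j, inner ℂ (f j) (stdBasis k i) ≠ 0) :
    IrreducibleRep G.CStar where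
  H := StdSpace k
  hom := basisHom (stdBasis k) f u v hadj
  irreducible K _ hK := basisHom_irreducible _ f hadj hu hv hne K hK

theorem equiv_basisRep (π : IrreducibleRep G.CStar) {k : ℕ} [NeZero k]
    {e f : OrthonormalBasis (Fin k) ℂ π.H} {f' : OrthonormalBasis (Fin k) ℂ (StdSpace k)}
    {u : Fin k → U} {v : Fin k → V} (hu : Function.Injective u) (hv : Function.Injective v)
    (hadj : ∀ i j, G.Adj (u i) (v j)) (hne : ∀ i j, inner ℂ (f' j) (stdBasis k i) ≠ 0)
    (hP : ∀ x, π.hom (p (Sum.inl x)) = basisFamily u e x)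
    (hQ : ∀ y, π.hom (p (Sum.inr y)) = basisFamily v f y)
    (hf : e.equiv (stdBasis k) (Equiv.refl _) ∘ f = f') :
    π ≈ basisRep f' hu hv hadj hne := by
  refine ⟨e.equiv (stdBasis k) (Equiv.refl _), ?_⟩
  refine intertwine π.hom (basisHom (stdBasis k) f' u v hadj)
    (e.equiv (stdBasis k) (Equiv.refl _)).toContinuousLinearEquiv ?_
  rintro (x | y) z
  · rw [hP, basisHom_inl]
    refine (map_basisFamily (e.equiv (stdBasis k) (Equiv.refl _)).toLinearIsometry e u x z).trans ?_
    congr 2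
    funext i
    simp
  · rw [hQ, basisHom_inr]
    refine (map_basisFamily (e.equiv (stdBasis k) (Equiv.refl _)).toLinearIsometry f v y z).trans ?_
    congr 2

end CStar

/-- The squares of a bipartite graph, with an ordering of the vertices on each side. -/
structure Square (G : BipartiteGraph U V) where
  left : Fin 2 → U
  right : Fin 2 → V
  left_inj : Function.Injective left
  right_inj : Function.Injective right
  adj : ∀ i j, G.Adj (left i) (right j)

namespace CStar

/-- The one-dimensional representation given by an edge. -/
noncomputable def edgeRep (e : G.Edge) : IrreducibleRep G.CStar :=
  basisRep (k := 1) (stdBasis 1) (u := fun _ => e.1.1) (v := fun _ => e.1.2)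
    (Function.injective_of_subsingleton _) (Function.injective_of_subsingleton _)
    (fun _ _ => e.2) (fun i j => by
      rw [Subsingleton.elim i j, inner_self_eq_norm_sq_to_K, (stdBasis 1).orthonormal.1]
      simp)

theorem inner_rotBasis_ne_zero {H : Type*} [NormedAddCommGroup H] [InnerProductSpace ℂ H]
    (e : OrthonormalBasis (Fin 2) ℂ H) {θ : ℝ} (hθ : θ ∈ Set.Ioo 0 (Real.pi / 2)) (i j : Fin 2) :
    inner ℂ (rotBasis e θ j) (e i) ≠ 0 := by
  have h1 : Real.cos θ ≠ 0 :=
    (Real.cos_pos_of_mem_Ioo ⟨by linarith [hθ.1, Real.pi_pos], hθ.2⟩).ne'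
  have h2 : Real.sin θ ≠ 0 :=
    (Real.sin_pos_of_pos_of_lt_pi hθ.1 (by linarith [hθ.2, Real.pi_pos])).ne'
  rw [coe_rotBasis, inner_rotVec e.orthonormal, Complex.ofReal_ne_zero]
  fin_cases i <;> fin_cases j
  · simpa using h1
  · simpa using h2
  · simpa using h2
  · simpa using h1

/-- The two-dimensional representation given by a square and an angle. -/
noncomputable def squareRep (s : G.Square) (θ : Set.Ioo 0 (Real.pi / 2)) : IrreducibleRep G.CStar :=
  basisRep (k := 2) (rotBasis (stdBasis 2) θ) s.left_inj s.right_inj s.adj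
    (inner_rotBasis_ne_zero _ θ.2)

end CStar

end BipartiteGraph

theorem injective_pair {W : Type*} {x x' : W} (h : x ≠ x') : Function.Injective ![x, x'] := by
  intro i j hij
  fin_cases i <;> fin_cases j
  · rfl
  · exact absurd hij h
  · exact absurd hij.symm h
  · rfl

/-! ### Classification of irreducible representations of dimension one and two. -/

section Families

variable {W H : Type*} [NormedAddCommGroup H] [InnerProductSpace ℂ H]
  {R : W → H →L[ℂ] H}

open Classical in
theorem apply_eq_ite_of_apply_eq (horth : ∀ x x', x ≠ x' → R x * R x' = 0) {b : H} {y : W}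
    (hb : R y b = b) (x : W) : R x b = if y = x then b else 0 := by
  split_ifs with h
  · rw [← h, hb]
  · rw [← hb, ← mul_apply_eq_comp, horth x y (Ne.symm h)]
    rfl

theorem exists_apply_ne_zero [Fintype W] (hsum : ∑ x, R x = 1) {b : H} (hb : b ≠ 0) : ∃ x, R x b ≠ 0 := by
  by_contra! h
  refine hb ?_
  have := congrArg (fun T : H →L[ℂ] H => T b) hsum
  simpa [h] using this.symm

/-- The idempotents sum to 1, so one eigenvalue on b is nonzero, and idempotence forces it to be 1.
-/
theorem exists_apply_eq_of_forall_smul [Fintype W] (hidem : ∀ x, R x * R x = R x) (hsum : ∑ x, R x = 1)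
    {b : H} (hb : b ≠ 0) (h : ∀ x, ∃ c : ℂ, R x b = c • b) : ∃ x, R x b = b := by
  obtain ⟨x, hx⟩ := exists_apply_ne_zero hsum hb
  obtain ⟨c, hc⟩ := h x
  refine ⟨x, ?_⟩
  have h1 : R x (R x b) = R x b := by rw [← mul_apply_eq_comp, hidem]
  rw [hc, map_smul, hc, smul_smul] at h1
  have h2 : c ≠ 0 := by
    rintro rfl
    exact hx (by rw [hc, zero_smul])
  have h3 : c * c = c := smul_left_injective ℂ hb h1
  rw [hc, mul_right_cancel₀ h2 (h3.trans (one_mul c).symm), one_smul]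

theorem eq_basisFamily {ι : Type*} [Fintype ι] (horth : ∀ x x', x ≠ x' → R x * R x' = 0)
    (e : OrthonormalBasis ι ℂ H) (u : ι → W) (h : ∀ i, R (u i) (e i) = e i) (x : W) :
    R x = basisFamily u e x := by
  classical
  refine e.ext_clm fun i => ?_
  rw [apply_eq_ite_of_apply_eq horth (h i), basisFamily_apply_self u e.orthonormal]

end Families

namespace BipartiteGraph.CStar

variable {U V : Type*} [Fintype U] [Fintype V] {G : BipartiteGraph U V}

theorem rel_hom {H : Type*} [NormedAddCommGroup H] [InnerProductSpace ℂ H] [CompleteSpace H]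
    (π : G.CStar →⋆ₐ[ℂ] (H →L[ℂ] H)) :
    BipartiteRel G.Adj (fun x => π (p (Sum.inl x))) (fun y => π (p (Sum.inr y))) :=
  (bipartiteRel G).map (π : G.CStar →+* (H →L[ℂ] H))

/-- For a non-edge the two projections have orthogonal ranges. -/
theorem adj_of_basisFamily {H : Type*} [NormedAddCommGroup H] [InnerProductSpace ℂ H]
    [CompleteSpace H] (π : G.CStar →⋆ₐ[ℂ] (H →L[ℂ] H)) {x : U} {y : V} {a b : H}
    (ha : π (p (Sum.inl x)) a = a) (hb : π (p (Sum.inr y)) b = b) (hab : inner ℂ b a ≠ 0) :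
    G.Adj x y := by
  by_contra h
  have h1 := (rel_hom π).right_mul_left x y h
  have hs : ContinuousLinearMap.adjoint (π (p (Sum.inr y))) = π (p (Sum.inr y)) := by
    rw [← ContinuousLinearMap.star_eq_adjoint, ← map_star, (isSelfAdjoint_p _).star_eq]
  refine hab ?_
  rw [← hb, ← hs, ContinuousLinearMap.adjoint_inner_left, ← ha, ← mul_apply_eq_comp, h1]
  simp

theorem exists_equiv_edgeRep (π : IrreducibleRep G.CStar) (hπ : Module.finrank ℂ π.H = 1) :
    ∃ e : G.Edge, π ≈ edgeRep e := by
  have : FiniteDimensional ℂ π.H := Module.finite_of_finrank_pos (by omega)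
  let e : OrthonormalBasis (Fin 1) ℂ π.H :=
    (stdOrthonormalBasis ℂ π.H).reindex (finCongr hπ)
  have he : e 0 ≠ 0 := e.orthonormal.ne_zero 0
  have hscal : ∀ T : π.H →L[ℂ] π.H, ∃ c : ℂ, T (e 0) = c • e 0 := fun T => by
    obtain ⟨c, hc⟩ := (finrank_eq_one_iff_of_nonzero' (e 0) he).1 hπ (T (e 0))
    exact ⟨c, hc.symm⟩
  have hr := rel_hom π.hom
  obtain ⟨x, hx⟩ := exists_apply_eq_of_forall_smul hr.idem_left hr.sum_left he fun _ => hscal _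
  obtain ⟨y, hy⟩ := exists_apply_eq_of_forall_smul hr.idem_right hr.sum_right he fun _ => hscal _
  have hadj : G.Adj x y := adj_of_basisFamily π.hom hx hy (by
    rw [inner_self_eq_norm_sq_to_K, e.orthonormal.1]; simp)
  refine ⟨⟨(x, y), hadj⟩, equiv_basisRep π (e := e) (f := e) _ _ _ _
    (eq_basisFamily hr.orth_left e _ ?_) (eq_basisFamily hr.orth_right e _ ?_) ?_⟩
  · intro i
    rw [Subsingleton.elim i 0]
    exact hx
  · intro i
    rw [Subsingleton.elim i 0]
    exact hy
  · funext i
    simp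

theorem not_common_eigenvector (π : IrreducibleRep G.CStar) (hπ : Module.finrank ℂ π.H = 2)
    {w : π.H} (hw : w ≠ 0) (h : ∀ x, ∃ c : ℂ, π.hom (p x) w = c • w) : False := by
  have : FiniteDimensional ℂ π.H := Module.finite_of_finrank_pos (by omega)
  have hcl : IsClosed ((ℂ ∙ w : Submodule ℂ π.H) : Set π.H) := Submodule.closed_of_finiteDimensional _
  rcases π.irreducible (ℂ ∙ w) hcl (invariant_of_generators π.hom hcl fun x z hz => by
    obtain ⟨d, rfl⟩ := Submodule.mem_span_singleton.1 hz
    obtain ⟨c, hc⟩ := h x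
    rw [map_smul, hc]
    exact Submodule.smul_mem _ _ (Submodule.smul_mem _ _ (Submodule.mem_span_singleton_self w)))
    with h1 | h1
  · exact hw (Submodule.span_singleton_eq_bot.1 h1)
  · have := finrank_span_singleton (K := ℂ) hw
    rw [h1, finrank_top] at this
    omega

theorem adjoint_hom_p (π : IrreducibleRep G.CStar) (x : U ⊕ V) (a b : π.H) :
    inner ℂ (π.hom (p x) a) b = inner ℂ a (π.hom (p x) b) := by
  have hs : ContinuousLinearMap.adjoint (π.hom (p x)) = π.hom (p x) := by
    rw [← ContinuousLinearMap.star_eq_adjoint, ← map_star, (isSelfAdjoint_p _).star_eq]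
  conv_lhs => rw [← hs, ContinuousLinearMap.adjoint_inner_left]

/-- Two projections in general position in the plane: a unit vector w fixed by `p_y` splits along
two left projections as c e₀ + s e₁ with c, s > 0, and θ = arccos c. The square can be based at any
corner where the representation does not vanish, which later arguments use repeatedly. -/
theorem exists_equiv_squareRep (π : IrreducibleRep G.CStar) (hπ : Module.finrank ℂ π.H = 2)
    {x : U} {y : V} (hxy : π.hom (p (Sum.inl x) * p (Sum.inr y)) ≠ 0) :
    ∃ (s : G.Square) (θ : Set.Ioo 0 (Real.pi / 2)), s.left 0 = x ∧ s.right 0 = y ∧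
      π ≈ squareRep s θ := by
  classical
  have : FiniteDimensional ℂ π.H := Module.finite_of_finrank_pos (by omega)
  have hr := rel_hom π.hom
  obtain ⟨z, hz⟩ : ∃ z, π.hom (p (Sum.inl x)) (π.hom (p (Sum.inr y)) z) ≠ 0 := by
    by_contra! h
    refine hxy (ContinuousLinearMap.ext fun z => ?_)
    rw [map_mul]
    exact h z
  obtain ⟨w, hw1, hyw, hxw⟩ : ∃ w : π.H, ‖w‖ = 1 ∧ π.hom (p (Sum.inr y)) w = w ∧
      π.hom (p (Sum.inl x)) w ≠ 0 := by
    have hz0 : ‖π.hom (p (Sum.inr y)) z‖ ≠ 0 := by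
      rw [norm_ne_zero_iff]
      intro h
      exact hz (by rw [h, map_zero])
    refine ⟨((‖π.hom (p (Sum.inr y)) z‖⁻¹ : ℝ) : ℂ) • π.hom (p (Sum.inr y)) z, ?_, ?_, ?_⟩
    · rw [norm_smul]
      simp [hz0]
    · rw [map_smul, ← mul_apply_eq_comp, hr.idem_right]
    · rw [map_smul]
      exact smul_ne_zero (by simpa using hz0) hz
  have hw0 : w ≠ 0 := by
    rintro rfl
    simp at hw1
  -- a second left vertex
  obtain ⟨x', hx', hxw'⟩ : ∃ x', x ≠ x' ∧ π.hom (p (Sum.inl x')) w ≠ 0 := by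
    by_contra! h
    have h1 : π.hom (p (Sum.inl x)) w = w := by
      have := congrArg (fun T : π.H →L[ℂ] π.H => T w) hr.sum_left
      rw [sum_apply, Finset.sum_eq_single x (fun x' _ hx' => h x' hx'.symm) (by simp)] at this
      simpa using this
    refine not_common_eigenvector π hπ hw0 ?_
    rintro (t | t)
    · by_cases ht : x = t
      · exact ⟨1, by rw [← ht, h1, one_smul]⟩
      · exact ⟨0, by rw [h t ht, zero_smul]⟩
    · rw [apply_eq_ite_of_apply_eq hr.orth_right hyw t]
      split_ifs
      · exact ⟨1, (one_smul _ _).symm⟩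
      · exact ⟨0, (zero_smul _ _).symm⟩
  let X : Fin 2 → U := ![x, x']
  have hX : Function.Injective X := injective_pair hx'
  have hXw : ∀ i, π.hom (p (Sum.inl (X i))) w ≠ 0 := by
    intro i
    fin_cases i
    · exact hxw
    · exact hxw'
  -- Normalising the components of w itself fixes the phases: both coefficients of w become positive
  -- reals.
  let ev : Fin 2 → π.H := fun i =>
    ((‖π.hom (p (Sum.inl (X i))) w‖⁻¹ : ℝ) : ℂ) • π.hom (p (Sum.inl (X i))) w
  have hev : Orthonormal ℂ ev := by
    constructor
    · intro i
      simp only [ev]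
      rw [norm_smul]
      simp [hXw i]
    · intro i j hij
      simp only [ev]
      rw [inner_smul_left, inner_smul_right, adjoint_hom_p, ← mul_apply_eq_comp,
        hr.orth_left _ _ (hX.ne hij)]
      simp
  have hevw : ∀ i, inner ℂ (ev i) w = (‖π.hom (p (Sum.inl (X i))) w‖ : ℂ) := by
    intro i
    have h1 : inner ℂ (π.hom (p (Sum.inl (X i))) w) w =
        (‖π.hom (p (Sum.inl (X i))) w‖ : ℂ) ^ 2 := by
      rw [← hr.idem_left, mul_apply_eq_comp, adjoint_hom_p, inner_self_eq_norm_sq_to_K,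
        ← mul_apply_eq_comp, hr.idem_left]
      rfl
    simp only [ev]
    rw [inner_smul_left, h1, Complex.conj_ofReal, Complex.ofReal_inv, sq, ← mul_assoc,
      inv_mul_cancel₀ (by simpa using hXw i), one_mul]
  have hev2 : ∀ i, π.hom (p (Sum.inl (X i))) (ev i) = ev i := by
    intro i
    simp only [ev]
    rw [map_smul, ← mul_apply_eq_comp, hr.idem_left]
  let e : OrthonormalBasis (Fin 2) ℂ π.H :=
    (basisOfOrthonormalOfCardEqFinrank hev (by simp [hπ])).toOrthonormalBasis (by
      rw [coe_basisOfOrthonormalOfCardEqFinrank]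
      exact hev)
  have he : ⇑e = ev := by simp [e]
  set c := ‖π.hom (p (Sum.inl (X 0))) w‖ with hc
  set s := ‖π.hom (p (Sum.inl (X 1))) w‖ with hs
  have hc0 : 0 < c := norm_pos_iff.2 (hXw 0)
  have hs0 : 0 < s := norm_pos_iff.2 (hXw 1)
  have hwe : w = (c : ℂ) • e 0 + (s : ℂ) • e 1 := by
    conv_lhs => rw [← e.sum_repr' w]
    rw [Fin.sum_univ_two, he, hevw, hevw]
  have hcs : c ^ 2 + s ^ 2 = 1 := by
    have := e.sum_sq_norm_inner_right w
    rw [Fin.sum_univ_two, he, hevw, hevw, hw1] at this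
    simpa [← hc, ← hs] using this
  have hc1 : c < 1 := by nlinarith
  have hcos : Real.cos (Real.arccos c) = c := Real.cos_arccos (by linarith) hc1.le
  have hsin : Real.sin (Real.arccos c) = s := by
    rw [Real.sin_arccos, ← hcs, add_sub_cancel_left, Real.sqrt_sq hs0.le]
  have hθ : Real.arccos c ∈ Set.Ioo 0 (Real.pi / 2) :=
    ⟨Real.arccos_pos.2 hc1, Real.arccos_lt_pi_div_two.2 hc0⟩
  let f := rotBasis e (Real.arccos c)
  have hf : ⇑f = rotVec e c s := by rw [coe_rotBasis, hcos, hsin]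
  have hf0 : f 0 = w := by
    rw [hf, hwe]
    rfl
  -- a second right vertex
  have hQf1 : ∀ t, ∃ μ : ℂ, π.hom (p (Sum.inr t)) (f 1) = μ • f 1 := by
    intro t
    refine ⟨inner ℂ (f 1) (π.hom (p (Sum.inr t)) (f 1)), ?_⟩
    -- Each right projection preserves the line of w, hence also its orthogonal complement, the line
    -- of `f 1`.
    have h1 : inner ℂ (f 0) (π.hom (p (Sum.inr t)) (f 1)) = 0 := by
      rw [← adjoint_hom_p, hf0, apply_eq_ite_of_apply_eq hr.orth_right hyw t]
      split_ifs
      · rw [← hf0]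
        exact f.orthonormal.2 (by decide)
      · simp
    conv_lhs => rw [← f.sum_repr' (π.hom (p (Sum.inr t)) (f 1))]
    rw [Fin.sum_univ_two, h1, zero_smul, zero_add]
  obtain ⟨y', hy'w⟩ := exists_apply_eq_of_forall_smul hr.idem_right hr.sum_right
    (f.orthonormal.ne_zero 1) hQf1
  have hy' : y ≠ y' := by
    rintro rfl
    -- If both basis vectors lay in the range of `p_y`, all right projections would be scalar and `e
    -- 0` a common eigenvector.
    have hid : π.hom (p (Sum.inr y)) = 1 := by
      refine f.ext_clm fun i => ?_
      fin_cases i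
      · simp only [Fin.zero_eta, hf0, hyw]
        rfl
      · exact hy'w
    refine not_common_eigenvector π hπ (e.orthonormal.ne_zero 0) ?_
    rintro (t | t)
    · rw [he, apply_eq_ite_of_apply_eq hr.orth_left (hev2 0) t]
      split_ifs
      · exact ⟨1, (one_smul _ _).symm⟩
      · exact ⟨0, (zero_smul _ _).symm⟩
    · rw [apply_eq_ite_of_apply_eq hr.orth_right (y := y) (by rw [hid]; rfl) t]
      split_ifs
      · exact ⟨1, (one_smul _ _).symm⟩
      · exact ⟨0, (zero_smul _ _).symm⟩
  let Y : Fin 2 → V := ![y, y']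
  have hY : Function.Injective Y := injective_pair hy'
  have hfev : ∀ j, π.hom (p (Sum.inr (Y j))) (f j) = f j := by
    intro j
    fin_cases j
    · simp only [Fin.zero_eta, hf0]
      exact hyw
    · exact hy'w
  have hadj : ∀ i j, G.Adj (X i) (Y j) := fun i j =>
    adj_of_basisFamily π.hom (hev2 i) (hfev j) (by
      rw [← he]
      exact inner_rotBasis_ne_zero e hθ i j)
  refine ⟨⟨X, Y, hX, hY, hadj⟩, ⟨Real.arccos c, hθ⟩, rfl, rfl, equiv_basisRep π (e := e) (f := f)
    _ _ _ _ (eq_basisFamily hr.orth_left e _ ?_) (eq_basisFamily hr.orth_right f _ hfev) ?_⟩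
  · intro i
    rw [he]
    exact hev2 i
  · rw [coe_rotBasis, coe_rotBasis]
    refine (map_rotVec (e.equiv (stdBasis 2) (Equiv.refl _)).toLinearEquiv.toLinearMap e _ _).trans ?_
    congr 1
    funext i
    simp

end BipartiteGraph.CStar

/-! ### The hull-kernel topology in terms of kernels. -/

namespace CStarSpecLETwo

variable {A : Type*} [CStarAlgebra A]

/-- The kernel of a point of `Spec_{≤2}`. -/
def kernel (σ : CStarSpecLETwo A) : Set A := (CStarSpec.toPrim σ.1).1

theorem isClosed_iff {C : Set (CStarSpecLETwo A)} :
    IsClosed C ↔ ∃ S : Set A, C = {σ | S ⊆ kernel σ} := by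
  have h1 : ∀ {D : Set (PrimitiveIdeal A)}, IsClosed D ↔ D ∈ Set.range PrimitiveIdeal.hull := by
    intro D
    rw [← isOpen_compl_iff]
    show Dᶜᶜ ∈ _ ↔ _
    rw [compl_compl]
  have h2 : Topology.IsInducing fun σ : CStarSpecLETwo A => CStarSpec.toPrim σ.1 :=
    (Topology.IsInducing.mk rfl : Topology.IsInducing (CStarSpec.toPrim (A := A))).comp
      Topology.IsInducing.subtypeVal
  rw [h2.isClosed_iff]
  constructor
  · rintro ⟨D, hD, rfl⟩
    obtain ⟨S, rfl⟩ := h1.1 hD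
    exact ⟨S, rfl⟩
  · rintro ⟨S, rfl⟩
    exact ⟨PrimitiveIdeal.hull S, h1.2 ⟨S, rfl⟩, rfl⟩

theorem isOpen_setOf_notMem_kernel (a : A) : IsOpen {σ : CStarSpecLETwo A | a ∉ kernel σ} := by
  rw [← isClosed_compl_iff, isClosed_iff]
  refine ⟨{a}, ?_⟩
  ext σ
  simp

theorem exists_notMem_kernel {O : Set (CStarSpecLETwo A)} (hO : IsOpen O) {σ : CStarSpecLETwo A}
    (hσ : σ ∈ O) : ∃ a ∉ kernel σ, {τ : CStarSpecLETwo A | a ∉ kernel τ} ⊆ O := by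
  obtain ⟨S, hS⟩ := isClosed_iff.1 (isClosed_compl_iff.2 hO)
  have h1 : ¬ S ⊆ kernel σ := fun h => (hS.symm ▸ h : σ ∈ Oᶜ) hσ
  obtain ⟨a, ha, ha'⟩ := Set.not_subset.1 h1
  refine ⟨a, ha', fun τ hτ => ?_⟩
  by_contra h
  have : τ ∈ {σ | S ⊆ kernel σ} := hS ▸ h
  exact hτ (this ha)

end CStarSpecLETwo

theorem IrreducibleRep.norm_hom_eq_of_equiv {A : Type*} [CStarAlgebra A] {π ρ : IrreducibleRep A}
    (h : UnitarilyEquiv π ρ) (a : A) : ‖π.hom a‖ = ‖ρ.hom a‖ := by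
  obtain ⟨T, hT⟩ := h
  apply le_antisymm
  · refine ContinuousLinearMap.opNorm_le_bound _ (norm_nonneg _) fun x => ?_
    rw [← T.norm_map, hT, ← T.norm_map x]
    exact ContinuousLinearMap.le_opNorm _ _
  · refine ContinuousLinearMap.opNorm_le_bound _ (norm_nonneg _) fun x => ?_
    rw [← T.apply_symm_apply x, ← hT, T.norm_map, T.norm_map]
    exact ContinuousLinearMap.le_opNorm _ _

theorem continuous_rotVec {H : Type*} [NormedAddCommGroup H] [InnerProductSpace ℂ H]
    (e : Fin 2 → H) (j : Fin 2) :
    Continuous fun θ : ℝ => rotVec e (Real.cos θ) (Real.sin θ) j := by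
  fin_cases j
  · simp only [rotVec, Fin.zero_eta, Matrix.cons_val_zero]
    exact ((Complex.continuous_ofReal.comp Real.continuous_cos).smul continuous_const).add
      ((Complex.continuous_ofReal.comp Real.continuous_sin).smul continuous_const)
  · simp only [rotVec, Fin.mk_one, Matrix.cons_val_one]
    exact ((Complex.continuous_ofReal.comp Real.continuous_sin).smul continuous_const).sub
      ((Complex.continuous_ofReal.comp Real.continuous_cos).smul continuous_const)

open InnerProductSpace in
theorem Continuous.rankOne_self {X H : Type*} [TopologicalSpace X] [NormedAddCommGroup H]
    [InnerProductSpace ℂ H] {g : X → H} (hg : Continuous g) :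
    Continuous fun t => rankOne ℂ (g t) (g t) := by
  have h : ∀ t, rankOne ℂ (g t) (g t) = (innerSL ℂ (g t)).smulRight (g t) := fun _ => rfl
  simp only [h]
  exact ((ContinuousLinearMap.smulRightL ℂ H H).continuous.comp
    ((innerSL ℂ).continuous.comp hg)).clm_apply hg

theorem cfc_zero_of_map_zero {B : Type*} [CStarAlgebra B] {f : ℝ → ℝ} (hf : Continuous f)
    (h0 : f 0 = 0) : cfc f (0 : B) = 0 := by
  simpa using cfc_smul_of_isIdempotentElem (B := B) (P := 0) (by simp) (by simp) 0 hf h0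

-- The norms of p_x p_y p_x as coordinates on `Spec_{≤2}`.

universe u₁ u₂

namespace BipartiteGraph.CStar

open CStarSpecLETwo

variable {U : Type u₁} {V : Type u₂} [Fintype U] [Fintype V] {G : BipartiteGraph U V}

/-- The point of `Spec_{≤2}` given by an edge. -/
noncomputable def edgePt (e : G.Edge) : CStarSpecLETwo G.CStar :=
  ⟨⟦edgeRep e⟧, Or.inl (finrank_stdSpace 1)⟩

/-- The point of `Spec_{≤2}` given by a square and an angle. -/
noncomputable def squarePt (s : G.Square) (θ : Set.Ioo 0 (Real.pi / 2)) :
    CStarSpecLETwo G.CStar :=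
  ⟨⟦squareRep s θ⟧, Or.inr (finrank_stdSpace 2)⟩

/-- The norm of `p_x p_y p_x` at a point of the spectrum. -/
noncomputable def lam (x : U) (y : V) (σ : CStarSpecLETwo G.CStar) : ℝ :=
  Quotient.lift (fun π : IrreducibleRep G.CStar => ‖π.hom (cornerElt G x y)‖)
    (fun _ _ h => IrreducibleRep.norm_hom_eq_of_equiv h _) σ.1

/-- Some product of a left and a right projection is nonzero, because all of them add up to 1. The
last clause keeps the freedom to base the square at any corner with nonzero coordinate. -/
theorem eq_edgePt_or_eq_squarePt (σ : CStarSpecLETwo G.CStar) :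
    (∃ e, σ = edgePt e) ∨ ((∃ s θ, σ = squarePt s θ) ∧ ∀ x y, lam x y σ ≠ 0 →
      ∃ (s : G.Square) (θ : _), s.left 0 = x ∧ s.right 0 = y ∧ σ = squarePt s θ) := by
  obtain ⟨σ, hσ⟩ := σ
  induction σ using Quotient.inductionOn with
  | h π =>
    rcases hσ with hσ | hσ
    · obtain ⟨e, he⟩ := exists_equiv_edgeRep π hσ
      exact Or.inl ⟨e, Subtype.ext (Quotient.sound he)⟩
    · right
      have key : ∀ x y, π.hom (p (Sum.inl x) * p (Sum.inr y)) ≠ 0 →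
          ∃ (s : G.Square) (θ : _), s.left 0 = x ∧ s.right 0 = y ∧
            (⟨⟦π⟧, Or.inr hσ⟩ : CStarSpecLETwo G.CStar) = squarePt s θ := by
        intro x y hxy
        obtain ⟨s, θ, h1, h2, h3⟩ := exists_equiv_squareRep π hσ hxy
        exact ⟨s, θ, h1, h2, Subtype.ext (Quotient.sound h3)⟩
      constructor
      · by_contra! h
        have h1 : ∀ x y, π.hom (p (Sum.inl x) * p (Sum.inr y)) = 0 := by
          intro x y
          by_contra h2
          obtain ⟨s, θ, -, -, h3⟩ := key x y h2
          exact h s θ h3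
        have h2 : (∑ x, p (Sum.inl x)) * ∑ y, p (Sum.inr y) = (1 : G.CStar) := by
          rw [sum_p_inl, sum_p_inr, one_mul]
        have h3 := congrArg π.hom h2
        rw [Finset.sum_mul_sum, map_one, map_sum] at h3
        simp only [map_sum, h1, Finset.sum_const_zero] at h3
        exact zero_ne_one h3
      · intro x y hxy
        refine key x y fun h => hxy ?_
        show ‖π.hom (cornerElt G x y)‖ = 0
        rw [cornerElt, map_mul, h, zero_mul, norm_zero]

section Values

open InnerProductSpace

theorem norm_basisHom_cornerElt {ι H : Type*} [Fintype ι] [NormedAddCommGroup H]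
    [InnerProductSpace ℂ H] [CompleteSpace H] (e f : OrthonormalBasis ι ℂ H) {u : ι → U} {v : ι → V}
    (hadj : ∀ i j, G.Adj (u i) (v j)) (hu : Function.Injective u) (hv : Function.Injective v)
    (i j : ι) :
    ‖basisHom e f u v hadj (cornerElt G (u i) (v j))‖ = ‖inner ℂ (e i) (f j)‖ ^ 2 := by
  rw [basisHom_cornerElt e f hadj hu hv, norm_smul, norm_rankOne, e.orthonormal.1]
  simp

theorem lam_edgePt_self (e : G.Edge) : lam e.1.1 e.1.2 (edgePt e) = 1 := by
  refine (norm_basisHom_cornerElt (stdBasis.{max u₁ u₂} 1) (stdBasis.{max u₁ u₂} 1) (u := fun _ => e.1.1)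
    (v := fun _ => e.1.2) (fun _ _ => e.2) (Function.injective_of_subsingleton _)
    (Function.injective_of_subsingleton _) 0 0).trans ?_
  rw [inner_self_eq_norm_sq_to_K, (stdBasis.{max u₁ u₂} 1).orthonormal.1]
  simp

theorem lam_edgePt_of_ne {e : G.Edge} {x : U} {y : V} (h : e.1 ≠ (x, y)) :
    lam x y (edgePt e) = 0 := by
  refine norm_eq_zero.2 (basisHom_cornerElt_of_notMem (stdBasis.{max u₁ u₂} 1) (stdBasis.{max u₁ u₂} 1)
    (u := fun _ => e.1.1) (v := fun _ => e.1.2) (fun _ _ => e.2) ?_)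
  by_contra! hc
  obtain ⟨⟨_, h1⟩, ⟨_, h2⟩⟩ := hc
  exact h (Prod.ext h1 h2)

theorem lam_squarePt (s : G.Square) (θ : Set.Ioo 0 (Real.pi / 2)) (i j : Fin 2) :
    lam (s.left i) (s.right j) (squarePt s θ) =
      if i = j then Real.cos θ ^ 2 else Real.sin θ ^ 2 := by
  refine (norm_basisHom_cornerElt (stdBasis.{max u₁ u₂} 2) (rotBasis (stdBasis.{max u₁ u₂} 2) θ) s.adj s.left_inj
    s.right_inj i j).trans ?_
  rw [norm_inner_symm, coe_rotBasis, inner_rotVec (stdBasis.{max u₁ u₂} 2).orthonormal, Complex.norm_real,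
    Real.norm_eq_abs, sq_abs]
  fin_cases i <;> fin_cases j <;> simp

theorem lam_squarePt_of_notMem {s : G.Square} {θ : Set.Ioo 0 (Real.pi / 2)} {x : U} {y : V}
    (h : (∀ i, s.left i ≠ x) ∨ ∀ j, s.right j ≠ y) : lam x y (squarePt s θ) = 0 :=
  norm_eq_zero.2 (basisHom_cornerElt_of_notMem (stdBasis.{max u₁ u₂} 2) (rotBasis (stdBasis.{max u₁ u₂} 2) θ) s.adj h)

/-- The image of p_x p_y p_x is zero or r times a rank-one projection, on which the functional
calculus of g is multiplication by g(r). -/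
theorem basisHom_cfc {ι H : Type*} [Fintype ι] [NormedAddCommGroup H]
    [InnerProductSpace ℂ H] [CompleteSpace H] (e f : OrthonormalBasis ι ℂ H) {u : ι → U} {v : ι → V}
    (hadj : ∀ i j, G.Adj (u i) (v j))
    (hu : Function.Injective u) (hv : Function.Injective v) {g : ℝ → ℝ} (hg : Continuous g)
    (h0 : g 0 = 0) (x : U) (y : V) :
    basisHom e f u v hadj (cfc g (cornerElt G x y)) = 0 ↔
      g ‖basisHom e f u v hadj (cornerElt G x y)‖ = 0 := by
  have hmap : basisHom e f u v hadj (cfc g (cornerElt G x y)) =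
      cfc g (basisHom e f u v hadj (cornerElt G x y)) :=
    StarAlgHomClass.map_cfc (S := ℂ) (basisHom e f u v hadj) g (cornerElt G x y)
      hg.continuousOn (continuous_hom _) (isSelfAdjoint_cornerElt x y)
      ((isSelfAdjoint_cornerElt x y).map _)
  rw [hmap]
  by_cases hx : ∃ i, u i = x
  swap
  · push Not at hx
    rw [basisHom_cornerElt_of_notMem e f hadj (Or.inl hx)]
    simp [cfc_zero_of_map_zero hg h0, h0]
  by_cases hy : ∃ j, v j = y
  swap
  · push Not at hy
    rw [basisHom_cornerElt_of_notMem e f hadj (Or.inr hy)]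
    simp [cfc_zero_of_map_zero hg h0, h0]
  obtain ⟨i, rfl⟩ := hx
  obtain ⟨j, rfl⟩ := hy
  rw [norm_basisHom_cornerElt e f hadj hu hv, basisHom_cornerElt e f hadj hu hv,
    cfc_smul_of_isIdempotentElem _ _ _ hg h0]
  · have hne : rankOne ℂ (e i) (e i) ≠ 0 :=
      rankOne_ne_zero (e.orthonormal.ne_zero i) (e.orthonormal.ne_zero i)
    rw [smul_eq_zero, or_iff_left hne]
  · rw [← basisFamily_of_injective hu]
    exact isSelfAdjoint_basisFamily u e _
  · rw [← basisFamily_of_injective hu]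
    exact basisFamily_mul_self e u _

theorem cfc_mem_kernel_iff {g : ℝ → ℝ} (hg : Continuous g) (h0 : g 0 = 0) (x : U) (y : V)
    (σ : CStarSpecLETwo G.CStar) :
    cfc g (cornerElt G x y) ∈ kernel σ ↔ g (lam x y σ) = 0 := by
  rcases eq_edgePt_or_eq_squarePt σ with ⟨e, rfl⟩ | ⟨⟨s, θ, rfl⟩, -⟩
  · exact basisHom_cfc (stdBasis.{max u₁ u₂} 1) (stdBasis.{max u₁ u₂} 1) (fun _ _ => e.2)
      (Function.injective_of_subsingleton _) (Function.injective_of_subsingleton _) hg h0 x y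
  · exact basisHom_cfc (stdBasis.{max u₁ u₂} 2) (rotBasis (stdBasis.{max u₁ u₂} 2) θ) s.adj s.left_inj s.right_inj hg h0 x y

/-- The distance to the complement of I is continuous, vanishes exactly off I, and vanishes at 0 as
`cfc_mem_kernel_iff` requires. The restriction `0 ∉ I` is essential: along an arc tending to an
edge, the coordinate at the opposite edge tends to 1 but is 0 in the limit. -/
theorem isOpen_lam_preimage (x : U) (y : V) {I : Set ℝ} (hI : IsOpen I) (h0 : (0 : ℝ) ∉ I) :
    IsOpen {σ : CStarSpecLETwo G.CStar | lam x y σ ∈ I} := by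
  have hne : (Iᶜ).Nonempty := ⟨0, h0⟩
  have hz : ∀ r, Metric.infDist r Iᶜ = 0 ↔ r ∉ I := fun r => by
    rw [← hI.isClosed_compl.mem_iff_infDist_zero hne, Set.mem_compl_iff]
  have := isOpen_setOf_notMem_kernel (cfc (fun r => Metric.infDist r Iᶜ) (cornerElt G x y))
  simp only [cfc_mem_kernel_iff (Metric.continuous_infDist_pt Iᶜ) ((hz 0).2 h0), hz, not_not]
    at this
  exact this

end Values

/-! ### Limits of the arcs of two-dimensional points. -/

section Limits

open InnerProductSpace Filter Topology

/-- The angle runs over all reals so as to include the ends of the arc, where the representation is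
reducible. Limits in the algebra are covered because *-homomorphisms are contractive, uniformly in
θ. -/
theorem continuous_basisHom_rotBasis {H : Type*} [NormedAddCommGroup H] [InnerProductSpace ℂ H]
    [CompleteSpace H] (e : OrthonormalBasis (Fin 2) ℂ H) (s : G.Square) (a : G.CStar) :
    Continuous fun θ : ℝ =>
      basisHom e (rotBasis e θ) s.left s.right s.adj a := by
  have hgen : ∀ x : U ⊕ V, Continuous fun θ : ℝ =>
      basisHom e (rotBasis e θ) s.left s.right s.adj (p x) := by
    rintro (x | y)
    · simp only [basisHom_inl]
      exact continuous_const
    · simp only [basisHom_inr, basisFamily, coe_rotBasis]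
      refine continuous_finsetSum _ fun j _ => ?_
      split_ifs
      · exact (continuous_rotVec e j).rankOne_self
      · exact continuous_const
  refine induction (P := fun a => Continuous fun θ : ℝ =>
    basisHom e (rotBasis e θ) s.left s.right s.adj a) ?_ ?_ ?_ ?_ ?_ a
  · refine isClosed_of_closure_subset fun a ha => ?_
    refine continuous_of_uniform_approx_of_continuous fun u hu => ?_
    obtain ⟨ε, hε, hεu⟩ := Metric.mem_uniformity_dist.1 hu
    obtain ⟨b, hb, hab⟩ := Metric.mem_closure_iff.1 ha ε hε
    refine ⟨_, hb, fun θ => hεu ?_⟩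
    rw [dist_eq_norm, ← map_sub]
    exact (NonUnitalStarAlgHom.norm_apply_le _ _).trans_lt (by rwa [← dist_eq_norm])
  · simp only [map_one]
    exact continuous_const
  · intro a b ha hb
    simp only [map_add]
    exact ha.add hb
  · intro c a ha
    simp only [map_smul]
    exact ha.const_smul c
  · intro x a ha
    simp only [map_mul]
    exact (hgen x).mul ha

/-- A basic neighbourhood of σ is given by an element a outside its kernel; then a does not vanish
at θ₀, hence not at nearby angles. -/
theorem tendsto_squarePt (s : G.Square) (θ₀ : ℝ) {σ : CStarSpecLETwo G.CStar}
    (h : ∀ a, basisHom (stdBasis.{max u₁ u₂} 2) (rotBasis (stdBasis.{max u₁ u₂} 2) θ₀) s.left s.right s.adj a = 0 →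
      a ∈ kernel σ) :
    Tendsto (squarePt s) (comap (fun θ : Set.Ioo 0 (Real.pi / 2) => (θ : ℝ)) (𝓝 θ₀)) (𝓝 σ) := by
  rw [tendsto_nhds]
  intro O hO hσ
  obtain ⟨a, ha, haO⟩ := exists_notMem_kernel hO hσ
  have h1 : ∀ᶠ θ in 𝓝 θ₀,
      basisHom (stdBasis.{max u₁ u₂} 2) (rotBasis (stdBasis.{max u₁ u₂} 2) θ) s.left s.right s.adj a ≠ 0 :=
    (continuous_basisHom_rotBasis (stdBasis.{max u₁ u₂} 2) s a).continuousAt.eventually_ne fun h0 => ha (h a h0)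
  exact mem_comap.2 ⟨_, h1, fun θ hθ => haO hθ⟩

theorem continuous_squarePt (s : G.Square) : Continuous (squarePt s) := by
  rw [continuous_iff_continuousAt]
  intro θ
  rw [ContinuousAt, nhds_subtype_eq_comap]
  exact tendsto_squarePt s θ fun a ha => ha

/-- When the i-th and j-th basis vectors are proportional, their common line is a subrepresentation,
namely that of the edge. The operator T embeds it. -/
theorem mem_kernel_edgePt_of_basisHom (s : G.Square) (θ₀ : ℝ) (i j : Fin 2) {c : ℂ}
    (hc : stdBasis.{max u₁ u₂} 2 i = c • rotBasis (stdBasis.{max u₁ u₂} 2) θ₀ j) {a : G.CStar}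
    (ha : basisHom (stdBasis.{max u₁ u₂} 2) (rotBasis (stdBasis.{max u₁ u₂} 2) θ₀) s.left s.right s.adj a = 0) :
    a ∈ kernel (edgePt ⟨(s.left i, s.right j), s.adj i j⟩) := by
  classical
  set e : G.Edge := ⟨(s.left i, s.right j), s.adj i j⟩
  let T : StdSpace.{max u₁ u₂} 1 →L[ℂ] StdSpace.{max u₁ u₂} 2 := rankOne ℂ (stdBasis.{max u₁ u₂} 2 i) (stdBasis.{max u₁ u₂} 1 0)
  have hT : T (stdBasis.{max u₁ u₂} 1 0) = stdBasis.{max u₁ u₂} 2 i := by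
    simp only [T]
    rw [rankOne_apply, inner_self_eq_norm_sq_to_K, (stdBasis.{max u₁ u₂} 1).orthonormal.1]
    simp
  have hT' : ∀ z, T z = 0 → z = 0 := by
    intro z hz
    simp only [T] at hz
    rw [rankOne_apply, smul_eq_zero, or_iff_left ((stdBasis.{max u₁ u₂} 2).orthonormal.ne_zero i)] at hz
    rw [← (stdBasis.{max u₁ u₂} 1).sum_repr' z]
    simp [hz]
  let E : G.CStar →⋆ₐ[ℂ] (StdSpace.{max u₁ u₂} 1 →L[ℂ] StdSpace.{max u₁ u₂} 1) :=
    basisHom (stdBasis.{max u₁ u₂} 1) (stdBasis.{max u₁ u₂} 1) (fun _ => e.1.1) (fun _ => e.1.2)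
      (fun _ _ => e.2)
  have hint := intertwine E
    (basisHom (stdBasis.{max u₁ u₂} 2) (rotBasis (stdBasis.{max u₁ u₂} 2) θ₀) s.left s.right s.adj) T ?_
  · refine ContinuousLinearMap.ext fun z => hT' _ ?_
    exact (hint a z).trans (by rw [ha]; rfl)
  · intro x z
    obtain ⟨d, rfl⟩ : ∃ d : ℂ, d • stdBasis.{max u₁ u₂} 1 0 = z :=
      ⟨inner ℂ (stdBasis.{max u₁ u₂} 1 0) z, by simpa using (stdBasis.{max u₁ u₂} 1).sum_repr' z⟩
    simp only [map_smul]
    congr 1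
    rcases x with x | y
    · have h1 : E (p (Sum.inl x)) (stdBasis.{max u₁ u₂} 1 0) =
          if s.left i = x then stdBasis.{max u₁ u₂} 1 0 else 0 :=
        (congrArg (fun S : StdSpace.{max u₁ u₂} 1 →L[ℂ] StdSpace.{max u₁ u₂} 1 => S (stdBasis.{max u₁ u₂} 1 0))
          (basisHom_inl (stdBasis.{max u₁ u₂} 1) (stdBasis.{max u₁ u₂} 1) (fun _ _ => e.2) x)).trans
          (basisFamily_apply_self _ (stdBasis.{max u₁ u₂} 1).orthonormal x 0)
      rw [hT, basisHom_inl (stdBasis.{max u₁ u₂} 2), basisFamily_apply_self _ (stdBasis.{max u₁ u₂} 2).orthonormal]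
      refine (congrArg T h1).trans ?_
      split_ifs
      · exact hT
      · exact map_zero T
    · have h1 : E (p (Sum.inr y)) (stdBasis.{max u₁ u₂} 1 0) =
          if s.right j = y then stdBasis.{max u₁ u₂} 1 0 else 0 :=
        (congrArg (fun S : StdSpace.{max u₁ u₂} 1 →L[ℂ] StdSpace.{max u₁ u₂} 1 => S (stdBasis.{max u₁ u₂} 1 0))
          (basisHom_inr (stdBasis.{max u₁ u₂} 1) (stdBasis.{max u₁ u₂} 1) (fun _ _ => e.2) y)).trans
          (basisFamily_apply_self _ (stdBasis.{max u₁ u₂} 1).orthonormal y 0)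
      rw [hT, hc, basisHom_inr (stdBasis.{max u₁ u₂} 2), map_smul, basisFamily_apply_self _ (rotBasis _ _).orthonormal,
        smul_ite, ← hc, smul_zero]
      refine (congrArg T h1).trans ?_
      split_ifs
      · exact hT
      · exact map_zero T

/-- The ends of the path of two-dimensional points of a square: opposite edges at either end. -/
theorem tendsto_squarePt_edgePt (s : G.Square) (i j : Fin 2) :
    Tendsto (squarePt s) (comap (fun θ : Set.Ioo 0 (Real.pi / 2) => (θ : ℝ))
      (𝓝 (if i = j then 0 else Real.pi / 2)))
      (𝓝 (edgePt ⟨(s.left i, s.right j), s.adj i j⟩)) := by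
  have hc : ∃ c : ℂ, stdBasis.{max u₁ u₂} 2 i =
      c • rotBasis (stdBasis.{max u₁ u₂} 2) (if i = j then 0 else Real.pi / 2) j := by
    rw [coe_rotBasis]
    fin_cases i <;> fin_cases j
    · exact ⟨1, by simp [rotVec]⟩
    · exact ⟨1, by simp [rotVec]⟩
    · exact ⟨1, by simp [rotVec]⟩
    -- The sign comes from using a reflection: at angle 0 the second vector is the negative of the
    -- original one.
    · exact ⟨-1, by simp [rotVec]⟩
  obtain ⟨c, hc⟩ := hc
  exact tendsto_squarePt s _ fun a ha => mem_kernel_edgePt_of_basisHom s _ i j hc ha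

end Limits

end BipartiteGraph.CStar

/-! ### Topological traces of edges and squares. -/

section TopologicalInvariants

open Topology

/-- A point that is isolated or cannot be separated from some other point. -/
def IsIsolatedOrNonseparated {X : Type*} [TopologicalSpace X] (x : X) : Prop :=
  IsOpen {x} ∨ ∃ y, y ≠ x ∧ ¬ Disjoint (𝓝 x) (𝓝 y)

/-- The topological relation between the one-dimensional points given by the four edges of a
square. -/
structure IsTopSquare {X : Type*} [TopologicalSpace X] (a b c d : X) : Prop where
  ne₁ : a ≠ b
  ne₂ : c ≠ d
  ne₃ : a ≠ c
  ne₄ : a ≠ d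
  nonsep₁ : ¬ Disjoint (𝓝 a) (𝓝 b)
  nonsep₂ : ¬ Disjoint (𝓝 c) (𝓝 d)
  arc : ∃ C : Set X, IsPreconnected C ∧ (∀ x ∈ C, ¬ IsIsolatedOrNonseparated x) ∧
    a ∈ closure C ∧ b ∈ closure C ∧ c ∈ closure C ∧ d ∈ closure C

variable {X Y : Type*} [TopologicalSpace X] [TopologicalSpace Y]

theorem Homeomorph.disjoint_nhds (φ : X ≃ₜ Y) {x y : X} (h : Disjoint (𝓝 x) (𝓝 y)) :
    Disjoint (𝓝 (φ x)) (𝓝 (φ y)) := by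
  rw [← φ.map_nhds_eq, ← φ.map_nhds_eq]
  exact (Filter.disjoint_map φ.injective).2 h

theorem Homeomorph.disjoint_nhds_iff (φ : X ≃ₜ Y) {x y : X} :
    Disjoint (𝓝 (φ x)) (𝓝 (φ y)) ↔ Disjoint (𝓝 x) (𝓝 y) :=
  ⟨fun h => by simpa using φ.symm.disjoint_nhds h, φ.disjoint_nhds⟩

theorem IsIsolatedOrNonseparated.map (φ : X ≃ₜ Y) {x : X} (h : IsIsolatedOrNonseparated x) :
    IsIsolatedOrNonseparated (φ x) := by
  rcases h with h | ⟨y, hy, h⟩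
  · left
    rw [← Set.image_singleton]
    exact φ.isOpenMap _ h
  · exact Or.inr ⟨φ y, φ.injective.ne hy, fun h' => h (φ.disjoint_nhds_iff.1 h')⟩

theorem Homeomorph.isIsolatedOrNonseparated_iff (φ : X ≃ₜ Y) {x : X} :
    IsIsolatedOrNonseparated (φ x) ↔ IsIsolatedOrNonseparated x :=
  ⟨fun h => by simpa using h.map φ.symm, fun h => h.map φ⟩

theorem IsTopSquare.map (φ : X ≃ₜ Y) {a b c d : X} (h : IsTopSquare a b c d) :
    IsTopSquare (φ a) (φ b) (φ c) (φ d) := by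
  obtain ⟨C, hC, hC', ha, hb, hc, hd⟩ := h.arc
  refine ⟨φ.injective.ne h.ne₁, φ.injective.ne h.ne₂, φ.injective.ne h.ne₃, φ.injective.ne h.ne₄,
    fun h' => h.nonsep₁ (φ.disjoint_nhds_iff.1 h'), fun h' => h.nonsep₂ (φ.disjoint_nhds_iff.1 h'),
    φ '' C, hC.image _ φ.continuous.continuousOn, ?_, ?_⟩
  · rintro _ ⟨x, hx, rfl⟩
    rw [φ.isIsolatedOrNonseparated_iff]
    exact hC' x hx
  · rw [← φ.image_closure]
    exact ⟨Set.mem_image_of_mem _ ha, Set.mem_image_of_mem _ hb, Set.mem_image_of_mem _ hc,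
      Set.mem_image_of_mem _ hd⟩

theorem Homeomorph.isTopSquare_iff (φ : X ≃ₜ Y) {a b c d : X} :
    IsTopSquare (φ a) (φ b) (φ c) (φ d) ↔ IsTopSquare a b c d :=
  ⟨fun h => by simpa using h.map φ.symm, fun h => h.map φ⟩

end TopologicalInvariants

theorem eq_or_eq_of_mem_range_of_ne {W : Type*} {l : Fin 2 → W} {a b c : W} (ha : a ∈ Set.range l)
    (hb : b ∈ Set.range l) (hc : c ∈ Set.range l) (hab : a ≠ b) : c = a ∨ c = b := by
  obtain ⟨i, rfl⟩ := ha
  obtain ⟨j, rfl⟩ := hb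
  obtain ⟨k, rfl⟩ := hc
  have hij : i ≠ j := fun h => hab (congrArg l h)
  have : k = i ∨ k = j := by omega
  exact this.imp (congrArg l) (congrArg l)

theorem eq_of_range_eq_of_apply_zero {W : Type*} {l l' : Fin 2 → W} (hl : Function.Injective l)
    (h : Set.range l = Set.range l') (h0 : l 0 = l' 0) : l = l' := by
  funext i
  fin_cases i
  · exact h0
  · obtain ⟨j, hj⟩ : l 1 ∈ Set.range l' := h ▸ Set.mem_range_self 1
    fin_cases j
    · exact absurd (hl (hj.symm.trans h0.symm)) (by decide)
    · exact hj.symm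

/-! ### Recovering edges and squares from the topology. -/

namespace BipartiteGraph

variable {U V : Type*} [Fintype U] [Fintype V] {G : BipartiteGraph U V}

namespace Square

/-- The edges of a square. -/
def edge (s : G.Square) (i j : Fin 2) : G.Edge := ⟨(s.left i, s.right j), s.adj i j⟩

/-- The vertex pairs of a square. -/
def support (s : G.Square) : Set (U × V) := Set.range s.left ×ˢ Set.range s.right

omit [Fintype U] [Fintype V] in
theorem ncard_support (s : G.Square) : s.support.ncard = 4 := by
  rw [support, Set.ncard_prod, ← Set.image_univ, ← Set.image_univ,
    Set.ncard_image_of_injective _ s.left_inj, Set.ncard_image_of_injective _ s.right_inj]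
  simp

omit [Fintype U] [Fintype V] in
theorem ext_of_support {s s' : G.Square} (h : s.support = s'.support) (hl : s.left 0 = s'.left 0)
    (hr : s.right 0 = s'.right 0) : s = s' := by
  have h1 := (Set.prod_eq_prod_iff_of_nonempty
    ((Set.range_nonempty s.left).prod (Set.range_nonempty s.right))).1 h
  have h2 := eq_of_range_eq_of_apply_zero s.left_inj h1.1 hl
  have h3 := eq_of_range_eq_of_apply_zero s.right_inj h1.2 hr
  cases s
  cases s'
  subst h2 h3
  rfl

end Square

namespace CStar

open CStarSpecLETwo Topology Filter

theorem edgePt_injective : Function.Injective (edgePt : G.Edge → CStarSpecLETwo G.CStar) := by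
  intro e f h
  by_contra hne
  have h1 := lam_edgePt_of_ne (e := e) (x := f.1.1) (y := f.1.2) fun h => hne (Subtype.ext h)
  rw [h, lam_edgePt_self] at h1
  exact one_ne_zero h1

theorem lam_edgePt_eq_zero_or_one (x : U) (y : V) (e : G.Edge) :
    lam x y (edgePt e) = 0 ∨ lam x y (edgePt e) = 1 := by
  by_cases h : e.1 = (x, y)
  · right
    obtain ⟨⟨x', y'⟩, he⟩ := e
    obtain ⟨rfl, rfl⟩ := Prod.mk.inj h
    exact lam_edgePt_self ⟨(x', y'), he⟩
  · exact Or.inl (lam_edgePt_of_ne h)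

theorem eq_edge_of_lam_edgePt_ne_zero {x : U} {y : V} {e : G.Edge} (h : lam x y (edgePt e) ≠ 0) :
    e.1 = (x, y) := by
  by_contra h'
  exact h (lam_edgePt_of_ne h')

/-- The vertex pairs at which a point of the spectrum does not vanish. -/
def supp (σ : CStarSpecLETwo G.CStar) : Set (U × V) := {z | lam z.1 z.2 σ ≠ 0}

theorem cos_sq_mem_Ioo (θ : Set.Ioo 0 (Real.pi / 2)) : Real.cos θ ^ 2 ∈ Set.Ioo (0 : ℝ) 1 := by
  have h1 : 0 < Real.cos θ :=
    Real.cos_pos_of_mem_Ioo ⟨by linarith [θ.2.1, Real.pi_pos], θ.2.2⟩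
  have h2 : 0 < Real.sin θ :=
    Real.sin_pos_of_pos_of_lt_pi θ.2.1 (by linarith [θ.2.2, Real.pi_pos])
  exact ⟨by positivity, by nlinarith [Real.sin_sq_add_cos_sq θ]⟩

theorem cos_sq_injective {θ θ' : Set.Ioo 0 (Real.pi / 2)}
    (h : Real.cos θ ^ 2 = Real.cos θ' ^ 2) : θ = θ' := by
  have hp : ∀ θ : Set.Ioo 0 (Real.pi / 2), 0 ≤ Real.cos θ := fun θ =>
    Real.cos_nonneg_of_mem_Icc ⟨by linarith [θ.2.1, Real.pi_pos], θ.2.2.le⟩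
  have h1 := (sq_eq_sq₀ (hp θ) (hp θ')).1 h
  have hm : ∀ θ : Set.Ioo 0 (Real.pi / 2), (θ : ℝ) ∈ Set.Icc 0 Real.pi := fun θ =>
    ⟨θ.2.1.le, by linarith [θ.2.2, Real.pi_pos]⟩
  exact Subtype.ext (Real.injOn_cos (hm θ) (hm θ') h1)

theorem lam_squarePt_mem_Ioo (s : G.Square) (θ : Set.Ioo 0 (Real.pi / 2)) (i j : Fin 2) :
    lam (s.left i) (s.right j) (squarePt s θ) ∈ Set.Ioo (0 : ℝ) 1 := by
  rw [lam_squarePt]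
  have h := cos_sq_mem_Ioo θ
  split_ifs
  · exact h
  · rw [Real.sin_sq]
    exact ⟨by linarith [h.2], by linarith [h.1]⟩

theorem supp_squarePt (s : G.Square) (θ : Set.Ioo 0 (Real.pi / 2)) :
    supp (squarePt s θ) = s.support := by
  ext ⟨x, y⟩
  constructor
  · intro h
    constructor
    · by_contra hx
      exact h (lam_squarePt_of_notMem (Or.inl fun i hi => hx ⟨i, hi⟩))
    · by_contra hy
      exact h (lam_squarePt_of_notMem (Or.inr fun i hi => hy ⟨i, hi⟩))
  · rintro ⟨⟨i, rfl⟩, ⟨j, rfl⟩⟩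
    exact (lam_squarePt_mem_Ioo s θ i j).1.ne'

theorem lam_mem_Ioo_of_mem_supp {σ : CStarSpecLETwo G.CStar} (hσ : σ ∉ Set.range edgePt)
    {z : U × V} (hz : z ∈ supp σ) : lam z.1 z.2 σ ∈ Set.Ioo (0 : ℝ) 1 := by
  rcases eq_edgePt_or_eq_squarePt σ with ⟨e, rfl⟩ | ⟨⟨s, θ, rfl⟩, -⟩
  · exact absurd ⟨e, rfl⟩ hσ
  · rw [supp_squarePt] at hz
    obtain ⟨x, y⟩ := z
    obtain ⟨⟨i, rfl⟩, ⟨j, rfl⟩⟩ := hz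
    exact lam_squarePt_mem_Ioo s θ i j

theorem notMem_range_edgePt_of_lam {σ : CStarSpecLETwo G.CStar} {x : U} {y : V}
    (h : lam x y σ ∈ Set.Ioo (0 : ℝ) 1) : σ ∉ Set.range edgePt := by
  rintro ⟨e, rfl⟩
  rcases lam_edgePt_eq_zero_or_one x y e with h1 | h1
  · exact h.1.ne' h1
  · exact h.2.ne h1

theorem squarePt_notMem_range (s : G.Square) (θ : Set.Ioo 0 (Real.pi / 2)) :
    squarePt s θ ∉ Set.range edgePt :=
  notMem_range_edgePt_of_lam (lam_squarePt_mem_Ioo s θ 0 0)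

theorem exists_square_of_notMem_range {σ : CStarSpecLETwo G.CStar} (hσ : σ ∉ Set.range edgePt) :
    ∃ s : G.Square, supp σ = s.support := by
  rcases eq_edgePt_or_eq_squarePt σ with ⟨e, rfl⟩ | ⟨⟨s, θ, rfl⟩, -⟩
  · exact absurd ⟨e, rfl⟩ hσ
  · exact ⟨s, supp_squarePt s θ⟩

/-- Supports of two-dimensional points all have four elements. -/
theorem supp_eq_of_subset {σ τ : CStarSpecLETwo G.CStar} (hσ : σ ∉ Set.range edgePt)
    (hτ : τ ∉ Set.range edgePt) (h : supp σ ⊆ supp τ) : supp σ = supp τ := by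
  obtain ⟨s, hs⟩ := exists_square_of_notMem_range hσ
  obtain ⟨t, ht⟩ := exists_square_of_notMem_range hτ
  refine Set.eq_of_subset_of_ncard_le h ?_ (Set.toFinite _)
  rw [hs, ht, s.ncard_support, t.ncard_support]

/-- Both points can be based at z, so they come from the same square, and the squared cosine
determines the angle. -/
theorem eq_of_supp_eq {σ τ : CStarSpecLETwo G.CStar} (hσ : σ ∉ Set.range edgePt)
    (hτ : τ ∉ Set.range edgePt) (h : supp σ = supp τ) {z : U × V} (hz : z ∈ supp σ)
    (hl : lam z.1 z.2 σ = lam z.1 z.2 τ) : σ = τ := by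
  rcases eq_edgePt_or_eq_squarePt σ with ⟨e, rfl⟩ | ⟨-, h1⟩
  · exact absurd ⟨e, rfl⟩ hσ
  rcases eq_edgePt_or_eq_squarePt τ with ⟨e, rfl⟩ | ⟨-, h2⟩
  · exact absurd ⟨e, rfl⟩ hτ
  obtain ⟨s, θ, hs, hs', rfl⟩ := h1 z.1 z.2 hz
  obtain ⟨s', θ', ht, ht', rfl⟩ := h2 z.1 z.2 (h ▸ hz : z ∈ supp τ)
  rw [supp_squarePt, supp_squarePt] at h
  obtain rfl := Square.ext_of_support h (hs.trans ht.symm) (hs'.trans ht'.symm)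
  rw [← hs, ← hs', lam_squarePt, lam_squarePt, if_pos rfl, if_pos rfl] at hl
  rw [cos_sq_injective hl]

/-- The points that take values strictly between `0` and `1` at given vertex pairs. -/
def intermediate (G : BipartiteGraph U V) (S : Set (U × V)) : Set (CStarSpecLETwo G.CStar) :=
  ⋂ z ∈ S, {σ | lam z.1 z.2 σ ∈ Set.Ioo (0 : ℝ) 1}

theorem isOpen_intermediate (S : Set (U × V)) : IsOpen (intermediate G S) :=
  Set.Finite.isOpen_biInter S.toFinite fun z _ => isOpen_lam_preimage z.1 z.2 isOpen_Ioo (by simp)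

theorem mem_intermediate_supp {σ : CStarSpecLETwo G.CStar} (hσ : σ ∉ Set.range edgePt) :
    σ ∈ intermediate G (supp σ) :=
  Set.mem_iInter₂.2 fun _ hz => lam_mem_Ioo_of_mem_supp hσ hz

theorem supp_nonempty {σ : CStarSpecLETwo G.CStar} (hσ : σ ∉ Set.range edgePt) :
    (supp σ).Nonempty := by
  obtain ⟨s, hs⟩ := exists_square_of_notMem_range hσ
  rw [hs]
  exact (Set.range_nonempty s.left).prod (Set.range_nonempty s.right)

theorem supp_eq_of_mem_intermediate {σ τ : CStarSpecLETwo G.CStar} (hσ : σ ∉ Set.range edgePt)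
    (h : τ ∈ intermediate G (supp σ)) : supp σ = supp τ := by
  have h1 := Set.mem_iInter₂.1 h
  obtain ⟨z, hz⟩ := supp_nonempty hσ
  exact supp_eq_of_subset hσ (notMem_range_edgePt_of_lam (h1 z hz)) fun w hw => (h1 w hw).1.ne'

theorem disjoint_nhds_of_lam {σ τ : CStarSpecLETwo G.CStar} {x x' : U} {y y' : V} {I J : Set ℝ}
    (hI : IsOpen I) (hJ : IsOpen J) (hI0 : (0 : ℝ) ∉ I) (hJ0 : (0 : ℝ) ∉ J)
    (hσ : lam x y σ ∈ I) (hτ : lam x' y' τ ∈ J)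
    (h : ∀ ρ : CStarSpecLETwo G.CStar, lam x y ρ ∈ I → lam x' y' ρ ∉ J) :
    Disjoint (𝓝 σ) (𝓝 τ) :=
  Filter.disjoint_iff.2 ⟨_, (isOpen_lam_preimage x y hI hI0).mem_nhds hσ, _,
    (isOpen_lam_preimage x' y' hJ hJ0).mem_nhds hτ, Set.disjoint_left.2 h⟩

theorem disjoint_nhds_of_lam_lt {σ τ : CStarSpecLETwo G.CStar} {x : U} {y : V}
    (h0 : 0 < lam x y σ) (h : lam x y σ < lam x y τ) : Disjoint (𝓝 σ) (𝓝 τ) := by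
  obtain ⟨c, hc, hc'⟩ := exists_between h
  refine disjoint_nhds_of_lam (isOpen_Ioo (a := 0) (b := c)) (isOpen_Ioi (a := c)) (by simp) ?_
    ⟨h0, hc⟩ hc' fun ρ h1 h2 => lt_asymm h1.2 h2
  simpa using (h0.trans hc).le

/-- With equal supports a coordinate separates the points; with different supports the
`intermediate` sets do, since membership determines the support. -/
theorem disjoint_nhds_of_notMem_range {σ τ : CStarSpecLETwo G.CStar} (hσ : σ ∉ Set.range edgePt)
    (hτ : τ ∉ Set.range edgePt) (hne : σ ≠ τ) : Disjoint (𝓝 σ) (𝓝 τ) := by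
  by_cases h : supp σ = supp τ
  · obtain ⟨z, hz⟩ := supp_nonempty hσ
    have h1 : lam z.1 z.2 σ ≠ lam z.1 z.2 τ := fun h1 => hne (eq_of_supp_eq hσ hτ h hz h1)
    rcases h1.lt_or_gt with h1 | h1
    · exact disjoint_nhds_of_lam_lt (lam_mem_Ioo_of_mem_supp hσ hz).1 h1
    · exact (disjoint_nhds_of_lam_lt (lam_mem_Ioo_of_mem_supp hτ (h ▸ hz)).1 h1).symm
  · refine Filter.disjoint_iff.2 ⟨_, (isOpen_intermediate _).mem_nhds (mem_intermediate_supp hσ), _,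
      (isOpen_intermediate _).mem_nhds (mem_intermediate_supp hτ), Set.disjoint_left.2 ?_⟩
    intro ρ h1 h2
    exact h ((supp_eq_of_mem_intermediate hσ h1).trans (supp_eq_of_mem_intermediate hτ h2).symm)

theorem lam_eq_or_eq_one_sub (s : G.Square) (θ : Set.Ioo 0 (Real.pi / 2)) {z w : U × V}
    (hz : z ∈ supp (squarePt s θ)) (hw : w ∈ supp (squarePt s θ)) :
    lam w.1 w.2 (squarePt s θ) = lam z.1 z.2 (squarePt s θ) ∨
      lam w.1 w.2 (squarePt s θ) = 1 - lam z.1 z.2 (squarePt s θ) := by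
  rw [supp_squarePt] at hz hw
  obtain ⟨x, y⟩ := z
  obtain ⟨x', y'⟩ := w
  obtain ⟨⟨i, rfl⟩, ⟨j, rfl⟩⟩ := hz
  obtain ⟨⟨i', rfl⟩, ⟨j', rfl⟩⟩ := hw
  rw [lam_squarePt, lam_squarePt, Real.sin_sq]
  split_ifs <;> simp

theorem disjoint_nhds_edgePt {σ : CStarSpecLETwo G.CStar} (hσ : σ ∉ Set.range edgePt)
    (f : G.Edge) : Disjoint (𝓝 σ) (𝓝 (edgePt f)) := by
  obtain ⟨z, hz⟩ := supp_nonempty hσ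
  obtain ⟨h0, h1⟩ := lam_mem_Ioo_of_mem_supp hσ hz
  set t := lam z.1 z.2 σ
  -- All nonzero coordinates of a two-dimensional point are r or 1 - r. If one lies in (δ, 1 - δ),
  -- none exceeds 1 - δ, as the coordinate at f does near `edgePt f`.
  obtain ⟨δ, hδ, hδ'⟩ := exists_between (lt_min h0 (sub_pos.2 h1))
  obtain ⟨hδt, hδt'⟩ := lt_min_iff.1 hδ'
  refine disjoint_nhds_of_lam (x := z.1) (y := z.2) (x' := f.1.1) (y' := f.1.2) (isOpen_Ioo (a := δ) (b := 1 - δ))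
    (isOpen_Ioi (a := 1 - δ)) (fun h => lt_asymm hδ h.1) ?_ 
    (⟨hδt, by linarith⟩ : t ∈ Set.Ioo δ (1 - δ)) ?_ ?_
  · rw [Set.mem_Ioi]
    linarith
  · rw [lam_edgePt_self, Set.mem_Ioi]
    linarith
  · intro ρ hρ hρ'
    rw [Set.mem_Ioi] at hρ'
    rcases eq_edgePt_or_eq_squarePt ρ with ⟨e, rfl⟩ | ⟨⟨s, θ, rfl⟩, -⟩
    · exact notMem_range_edgePt_of_lam ⟨hδ.trans hρ.1, by linarith [hρ.2]⟩ ⟨e, rfl⟩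
    · rcases lam_eq_or_eq_one_sub s θ (z := z) (w := f.1) (hδ.trans hρ.1).ne'
        (show lam f.1.1 f.1.2 _ ≠ 0 by linarith) with h | h
      · linarith [hρ.2]
      · linarith [hρ.1]

/-- The arc is continuous and injective, so its preimage would be an open point of the real line. -/
theorem not_isOpen_singleton_squarePt (s : G.Square) (θ : Set.Ioo 0 (Real.pi / 2)) :
    ¬ IsOpen {squarePt s θ} := by
  intro h
  have h1 := isOpen_Ioo.isOpenMap_subtype_val _ (h.preimage (continuous_squarePt s))
  have h2 : Subtype.val '' (squarePt s ⁻¹' {squarePt s θ}) = {(θ : ℝ)} := by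
    refine Set.eq_singleton_iff_unique_mem.2 ⟨⟨θ, rfl, rfl⟩, ?_⟩
    rintro _ ⟨θ', h', rfl⟩
    have h3 := congrArg (lam (s.left 0) (s.right 0)) (show squarePt s θ' = squarePt s θ from h')
    rw [lam_squarePt, lam_squarePt, if_pos rfl, if_pos rfl] at h3
    rw [cos_sq_injective h3]
  rw [h2] at h1
  exact not_isOpen_singleton _ h1

theorem neBot_comap_ite (P : Prop) [Decidable P] :
    (comap (fun θ : Set.Ioo 0 (Real.pi / 2) => (θ : ℝ))
      (𝓝 (if P then 0 else Real.pi / 2))).NeBot := by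
  rw [← mem_closure_iff_comap_neBot, closure_Ioo (by positivity)]
  split_ifs
  · exact ⟨le_rfl, by positivity⟩
  · exact ⟨by positivity, le_rfl⟩

/-- Both edges are limits of the arc along the same proper filter. -/
theorem not_disjoint_nhds_edge (s : G.Square) {i j i' j' : Fin 2} (h : i = j ↔ i' = j') :
    ¬ Disjoint (𝓝 (edgePt (s.edge i j))) (𝓝 (edgePt (s.edge i' j'))) := by
  intro hd
  have h1 := tendsto_squarePt_edgePt s i j
  have h2 := tendsto_squarePt_edgePt s i' j'
  simp only [← h] at h2
  have := neBot_comap_ite (i = j)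
  exact (map_neBot (f := comap _ _)).ne (eq_bot_mono (le_inf h1 h2) hd.eq_bot)

theorem mem_closure_range_squarePt (s : G.Square) (i j : Fin 2) :
    edgePt (s.edge i j) ∈ closure (Set.range (squarePt s)) := by
  have := neBot_comap_ite (i = j)
  exact mem_closure_of_tendsto (tendsto_squarePt_edgePt s i j)
    (Eventually.of_forall fun θ => ⟨θ, rfl⟩)

/-- Otherwise the sets where the coordinates at e and at f exceed 1/2 are disjoint: a common point
is two-dimensional, and only opposite corners of a square can both exceed 1/2, adjacent ones having
sum 1. -/
theorem exists_square_of_not_disjoint_nhds {e f : G.Edge} (hef : e ≠ f)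
    (h : ¬ Disjoint (𝓝 (edgePt e)) (𝓝 (edgePt f))) :
    ∃ s : G.Square, e = s.edge 0 0 ∧ f = s.edge 1 1 := by
  by_contra! hs
  refine h (disjoint_nhds_of_lam (x := e.1.1) (y := e.1.2) (x' := f.1.1) (y' := f.1.2)
    (isOpen_Ioi (a := 1 / 2)) (isOpen_Ioi (a := 1 / 2)) (by norm_num) (by norm_num)
    (by rw [lam_edgePt_self]; norm_num) (by rw [lam_edgePt_self]; norm_num) ?_)
  intro ρ h1 h2
  rw [Set.mem_Ioi] at h1 h2
  have h1' : lam e.1.1 e.1.2 ρ ≠ 0 := by linarith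
  have h2' : lam f.1.1 f.1.2 ρ ≠ 0 := by linarith
  rcases eq_edgePt_or_eq_squarePt ρ with ⟨g, rfl⟩ | ⟨-, hc⟩
  · exact hef (Subtype.ext ((eq_edge_of_lam_edgePt_ne_zero h1').symm.trans
      (eq_edge_of_lam_edgePt_ne_zero h2')))
  · obtain ⟨s, θ, hl, hr, rfl⟩ := hc _ _ h1'
    have h3 : f.1 ∈ s.support := supp_squarePt s θ ▸ (h2' : f.1 ∈ supp _)
    obtain ⟨⟨i, hi⟩, ⟨j, hj⟩⟩ := h3
    have he : e = s.edge 0 0 := Subtype.ext (Prod.ext hl.symm hr.symm)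
    have hf : f = s.edge i j := Subtype.ext (Prod.ext hi.symm hj.symm)
    rw [← hl, ← hr, lam_squarePt, if_pos rfl] at h1
    rw [← hi, ← hj, lam_squarePt, Real.sin_sq] at h2
    fin_cases i <;> fin_cases j
    · exact hef (he.trans hf.symm)
    · norm_num at h2
      linarith
    · norm_num at h2
      linarith
    · exact hs s he hf

/-- An edge in a square is inseparable from the opposite edge, and an edge in no square is isolated
by its own coordinate. Two-dimensional points lie on arcs and are separated from everything else. -/
theorem isIsolatedOrNonseparated_iff {σ : CStarSpecLETwo G.CStar} :
    IsIsolatedOrNonseparated σ ↔ σ ∈ Set.range edgePt := by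
  constructor
  · intro h
    by_contra hσ
    rcases h with h | ⟨τ, hτ, h⟩
    · rcases eq_edgePt_or_eq_squarePt σ with ⟨e, rfl⟩ | ⟨⟨s, θ, rfl⟩, -⟩
      · exact hσ ⟨e, rfl⟩
      · exact not_isOpen_singleton_squarePt s θ h
    · by_cases hτ' : τ ∈ Set.range edgePt
      · obtain ⟨f, rfl⟩ := hτ'
        exact h (disjoint_nhds_edgePt hσ f)
      · exact h (disjoint_nhds_of_notMem_range hσ hτ' hτ.symm)
  · rintro ⟨e, rfl⟩
    by_cases hs : ∃ s : G.Square, s.left 0 = e.1.1 ∧ s.right 0 = e.1.2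
    · obtain ⟨s, hl, hr⟩ := hs
      have he : e = s.edge 0 0 := Subtype.ext (Prod.ext hl.symm hr.symm)
      refine Or.inr ⟨edgePt (s.edge 1 1), edgePt_injective.ne ?_, ?_⟩
      · rw [he]
        exact fun h => absurd (s.left_inj (congrArg (fun e : G.Edge => e.1.1) h)) (by decide)
      · rw [he]
        exact not_disjoint_nhds_edge s (by simp)
    · left
      have h1 : {edgePt e} = {σ | lam e.1.1 e.1.2 σ ∈ Set.Ioi (0 : ℝ)} := by
        refine (Set.eq_singleton_iff_unique_mem.2 ⟨?_, fun ρ hρ => ?_⟩).symm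
        · show (0 : ℝ) < _
          rw [lam_edgePt_self]
          exact one_pos
        · have hρ' : lam e.1.1 e.1.2 ρ ≠ 0 := (Set.mem_Ioi.1 hρ).ne'
          rcases eq_edgePt_or_eq_squarePt ρ with ⟨g, rfl⟩ | ⟨-, hc⟩
          · rw [show g = e from Subtype.ext (eq_edge_of_lam_edgePt_ne_zero hρ')]
          · obtain ⟨s, θ, hl, hr, -⟩ := hc _ _ hρ'
            exact absurd ⟨s, hl, hr⟩ hs
      rw [h1]
      exact isOpen_lam_preimage _ _ isOpen_Ioi (by simp)

/-- Supports are locally constant among two-dimensional points: C is covered by two disjoint open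
sets and so stays over one square. An edge point in the closure has a neighbourhood with positive
coordinate there, which meets C. -/
theorem exists_square_of_isPreconnected {C : Set (CStarSpecLETwo G.CStar)} (hC : IsPreconnected C)
    (hC' : ∀ σ ∈ C, σ ∉ Set.range edgePt) (hne : C.Nonempty) :
    ∃ s : G.Square, ∀ e : G.Edge, edgePt e ∈ closure C → e.1 ∈ s.support := by
  obtain ⟨σ, hσ⟩ := hne
  obtain ⟨s, hs⟩ := exists_square_of_notMem_range (hC' σ hσ)
  let O : Set (CStarSpecLETwo G.CStar) :=
    ⋃ z ∈ (supp σ)ᶜ, {τ | lam z.1 z.2 τ ∈ Set.Ioo (0 : ℝ) 1}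
  have hO : IsOpen O :=
    isOpen_biUnion fun z _ => isOpen_lam_preimage z.1 z.2 isOpen_Ioo (by simp)
  have hsub : C ⊆ intermediate G (supp σ) := by
    refine hC.subset_left_of_subset_union (isOpen_intermediate _) hO ?_ ?_
      ⟨σ, hσ, mem_intermediate_supp (hC' σ hσ)⟩
    · rw [Set.disjoint_left]
      intro τ h1 h2
      obtain ⟨z, hz, h3⟩ := Set.mem_iUnion₂.1 h2
      rw [supp_eq_of_mem_intermediate (hC' σ hσ) h1] at hz
      exact hz h3.1.ne'
    · intro τ hτ
      by_cases h : supp τ ⊆ supp σ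
      · left
        rw [← supp_eq_of_subset (hC' τ hτ) (hC' σ hσ) h]
        exact mem_intermediate_supp (hC' τ hτ)
      · right
        obtain ⟨z, hz, hz'⟩ := Set.not_subset.1 h
        exact Set.mem_iUnion₂.2 ⟨z, hz', lam_mem_Ioo_of_mem_supp (hC' τ hτ) hz⟩
  refine ⟨s, fun e he => ?_⟩
  obtain ⟨τ, h1, h2⟩ := mem_closure_iff.1 he _
    (isOpen_lam_preimage e.1.1 e.1.2 (isOpen_Ioi (a := 0)) (by simp))
    (by show (0 : ℝ) < _; rw [lam_edgePt_self]; exact one_pos)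
  rw [← hs, supp_eq_of_mem_intermediate (hC' σ hσ) (hsub h2)]
  exact (Set.mem_Ioi.1 h1).ne'

theorem isTopSquare_edgePt_iff (e f g h : G.Edge) :
    IsTopSquare (edgePt e) (edgePt f) (edgePt g) (edgePt h) ↔ IsSquare e.1 f.1 g.1 h.1 := by
  constructor
  · intro H
    obtain ⟨C, hC, hC', he, hf, hg, hh⟩ := H.arc
    obtain ⟨s₀, hs₀⟩ := exists_square_of_isPreconnected hC
      (fun σ hσ h => hC' σ hσ (isIsolatedOrNonseparated_iff.2 h)) (closure_nonempty_iff.1 ⟨_, he⟩)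
    obtain ⟨s, hs, hs'⟩ := exists_square_of_not_disjoint_nhds
      (fun h => H.ne₁ (congrArg edgePt h)) H.nonsep₁
    obtain ⟨t, ht, ht'⟩ := exists_square_of_not_disjoint_nhds
      (fun h => H.ne₂ (congrArg edgePt h)) H.nonsep₂
    have e1 : e.1.1 ≠ f.1.1 := by
      rw [hs, hs']
      exact s.left_inj.ne (by decide)
    have e2 : e.1.2 ≠ f.1.2 := by
      rw [hs, hs']
      exact s.right_inj.ne (by decide)
    have g1 : g.1.1 ≠ h.1.1 := by
      rw [ht, ht']
      exact t.left_inj.ne (by decide)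
    have g2 : g.1.2 ≠ h.1.2 := by
      rw [ht, ht']
      exact t.right_inj.ne (by decide)
    -- All four edges lie in one square and each pair differs on both sides; since neither g nor h
    -- is e, they form the other diagonal pair.
    have hge : ¬ (g.1.1 = e.1.1 ∧ g.1.2 = e.1.2) := fun h =>
      H.ne₃ (congrArg edgePt (Subtype.ext (Prod.ext h.1 h.2))).symm
    have hhe : ¬ (h.1.1 = e.1.1 ∧ h.1.2 = e.1.2) := fun h =>
      H.ne₄ (congrArg edgePt (Subtype.ext (Prod.ext h.1 h.2))).symm
    have l1 := eq_or_eq_of_mem_range_of_ne (hs₀ e he).1 (hs₀ f hf).1 (hs₀ g hg).1 e1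
    have l2 := eq_or_eq_of_mem_range_of_ne (hs₀ e he).1 (hs₀ f hf).1 (hs₀ h hh).1 e1
    have r1 := eq_or_eq_of_mem_range_of_ne (hs₀ e he).2 (hs₀ f hf).2 (hs₀ g hg).2 e2
    have r2 := eq_or_eq_of_mem_range_of_ne (hs₀ e he).2 (hs₀ f hf).2 (hs₀ h hh).2 e2
    refine ⟨e1, e2, ?_⟩
    rw [Prod.ext_iff, Prod.ext_iff, Prod.ext_iff, Prod.ext_iff]
    dsimp only
    grind
  · rintro ⟨h1, h2, h3⟩
    have hadj : G.Adj e.1.1 f.1.2 ∧ G.Adj f.1.1 e.1.2 := by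
      rcases h3 with ⟨hg, hh⟩ | ⟨hh, hg⟩
      · exact ⟨by simpa [hg] using g.2, by simpa [hh] using h.2⟩
      · exact ⟨by simpa [hh] using h.2, by simpa [hg] using g.2⟩
    let s : G.Square :=
      { left := ![e.1.1, f.1.1]
        right := ![e.1.2, f.1.2]
        left_inj := injective_pair h1
        right_inj := injective_pair h2
        adj := by
          intro i j
          fin_cases i <;> fin_cases j
          · exact e.2
          · exact hadj.1
          · exact hadj.2
          · exact f.2 }
    have harc : ∃ C : Set (CStarSpecLETwo G.CStar), IsPreconnected C ∧
        (∀ x ∈ C, ¬ IsIsolatedOrNonseparated x) ∧ ∀ i j, edgePt (s.edge i j) ∈ closure C := by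
      have := Subtype.preconnectedSpace (isPreconnected_Ioo (a := 0) (b := Real.pi / 2))
      refine ⟨_, isPreconnected_range (continuous_squarePt s), ?_, mem_closure_range_squarePt s⟩
      rintro _ ⟨θ, rfl⟩
      rw [isIsolatedOrNonseparated_iff]
      exact squarePt_notMem_range s θ
    obtain ⟨C, hC, hC', hcl⟩ := harc
    have hinj : ∀ i j i' j', edgePt (s.edge i j) = edgePt (s.edge i' j') → i = i' ∧ j = j' := by
      intro i j i' j' h
      have h' := edgePt_injective h
      exact ⟨s.left_inj (congrArg (fun e : G.Edge => e.1.1) h'),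
        s.right_inj (congrArg (fun e : G.Edge => e.1.2) h')⟩
    have he : e = s.edge 0 0 := rfl
    have hf : f = s.edge 1 1 := rfl
    have hgh : (g = s.edge 0 1 ∧ h = s.edge 1 0) ∨ (g = s.edge 1 0 ∧ h = s.edge 0 1) := by
      rcases h3 with ⟨hg, hh⟩ | ⟨hh, hg⟩
      · exact Or.inl ⟨Subtype.ext hg, Subtype.ext hh⟩
      · exact Or.inr ⟨Subtype.ext hg, Subtype.ext hh⟩
    rw [he, hf]
    rcases hgh with ⟨hg, hh⟩ | ⟨hg, hh⟩
    · rw [hg, hh]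
      exact ⟨fun h => absurd (hinj _ _ _ _ h) (by decide), fun h => absurd (hinj _ _ _ _ h) (by decide),
        fun h => absurd (hinj _ _ _ _ h) (by decide), fun h => absurd (hinj _ _ _ _ h) (by decide),
        not_disjoint_nhds_edge s (by simp), not_disjoint_nhds_edge s (by simp), C, hC, hC', hcl _ _,
        hcl _ _, hcl _ _, hcl _ _⟩
    · rw [hg, hh]
      exact ⟨fun h => absurd (hinj _ _ _ _ h) (by decide), fun h => absurd (hinj _ _ _ _ h) (by decide),
        fun h => absurd (hinj _ _ _ _ h) (by decide), fun h => absurd (hinj _ _ _ _ h) (by decide),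
        not_disjoint_nhds_edge s (by simp), not_disjoint_nhds_edge s (by simp), C, hC, hC', hcl _ _,
        hcl _ _, hcl _ _, hcl _ _⟩

end CStar

open CStar in
/-- Homeomorphic spaces of one- and two-dimensional irreducible representations give isomorphic
`C*`-algebras. -/
theorem nonempty_starAlgEquiv_of_homeomorph {U' V' : Type*} [Fintype U'] [Fintype V']
    {G' : BipartiteGraph U' V'} (φ : CStarSpecLETwo G.CStar ≃ₜ CStarSpecLETwo G'.CStar) :
    Nonempty (G.CStar ≃⋆ₐ[ℂ] G'.CStar) := by
  have hφ : ∀ σ, φ σ ∈ Set.range (edgePt (G := G')) ↔ σ ∈ Set.range (edgePt (G := G)) := fun σ => by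
    rw [← isIsolatedOrNonseparated_iff, ← isIsolatedOrNonseparated_iff,
      φ.isIsolatedOrNonseparated_iff]
  -- Edge points are topologically distinguished, so φ restricts to a map of edges.
  choose ψ hψ using fun e : G.Edge => (hφ (edgePt e)).2 ⟨e, rfl⟩
  have hb : Function.Bijective ψ := by
    constructor
    · intro e f hef
      exact edgePt_injective (φ.injective ((hψ e).symm.trans (hef ▸ hψ f)))
    · intro f
      obtain ⟨e, he⟩ := (hφ (φ.symm (edgePt f))).1 (by rw [φ.apply_symm_apply]; exact ⟨f, rfl⟩)
      refine ⟨e, edgePt_injective ?_⟩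
      rw [hψ, he, φ.apply_symm_apply]
  refine nonempty_starAlgEquiv_of_edgeEquiv (Equiv.ofBijective ψ hb) fun e f g h => ?_
  rw [← isTopSquare_edgePt_iff, ← isTopSquare_edgePt_iff, Equiv.ofBijective_apply,
    Equiv.ofBijective_apply, Equiv.ofBijective_apply, Equiv.ofBijective_apply, hψ, hψ, hψ, hψ,
    φ.isTopSquare_iff]

end BipartiteGraph

-- Isomorphic algebras have homeomorphic `Spec_{≤2}`.

universe w w'

namespace IrreducibleRep

variable {A : Type w} [CStarAlgebra A] {B : Type w'} [CStarAlgebra B] {H : Type w'}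
  [NormedAddCommGroup H] [InnerProductSpace ℂ H] [CompleteSpace H] [Nontrivial H]

/-- An irreducible representation, carried over to an isomorphic Hilbert space and an isomorphic
algebra. -/
noncomputable def transport (π : IrreducibleRep A) (α : A ≃⋆ₐ[ℂ] B) (T : π.H ≃ₗᵢ[ℂ] H) :
    IrreducibleRep B where
  H := H
  hom := (StarAlgEquiv.toStarAlgHom T.conjStarAlgEquiv).comp
    (π.hom.comp (StarAlgEquiv.toStarAlgHom α.symm))
  irreducible K hcl hK := by
    have hcl' : IsClosed ((K.comap T.toLinearEquiv.toLinearMap : Submodule ℂ π.H) : Set π.H) :=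
      hcl.preimage T.continuous
    have h1 : Function.Surjective T.toLinearEquiv.toLinearMap := T.surjective
    rcases π.irreducible _ hcl' (fun a x hx => by
      have := hK (α a) (T x) hx
      simpa using this) with h | h
    · left
      rw [← Submodule.map_comap_eq_of_surjective h1 K, h, Submodule.map_bot]
    · right
      rw [← Submodule.map_comap_eq_of_surjective h1 K, h, Submodule.map_top,
        LinearMap.range_eq_top.2 h1]

theorem transport_hom_apply (π : IrreducibleRep A) (α : A ≃⋆ₐ[ℂ] B) (T : π.H ≃ₗᵢ[ℂ] H) (a : A)
    (x : π.H) : T (π.hom a x) = (π.transport α T).hom (α a) (T x) := by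
  show _ = T (π.hom (α.symm (α a)) (T.symm (T x)))
  rw [StarAlgEquiv.symm_apply_apply, LinearIsometryEquiv.symm_apply_apply]

end IrreducibleRep

namespace CStarSpecLETwo

variable {A : Type w} [CStarAlgebra A] {B : Type w'} [CStarAlgebra B]

/-- A point of `Spec_{≤2}(A)` and a point of `Spec_{≤2}(B)` correspond to each other under an
isomorphism `A ≃ B`. -/
def Corresponds (α : A ≃⋆ₐ[ℂ] B) (σ : CStarSpecLETwo A) (τ : CStarSpecLETwo B) : Prop :=
  ∃ (π : IrreducibleRep A) (ρ : IrreducibleRep B), σ.1 = ⟦π⟧ ∧ τ.1 = ⟦ρ⟧ ∧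
    ∃ T : π.H ≃ₗᵢ[ℂ] ρ.H, ∀ a x, T (π.hom a x) = ρ.hom (α a) (T x)

variable {α : A ≃⋆ₐ[ℂ] B} {σ : CStarSpecLETwo A} {τ τ' : CStarSpecLETwo B}

theorem Corresponds.symm (h : Corresponds α σ τ) : Corresponds α.symm τ σ := by
  obtain ⟨π, ρ, hπ, hρ, T, hT⟩ := h
  refine ⟨ρ, π, hρ, hπ, T.symm, fun b x => ?_⟩
  rw [LinearIsometryEquiv.symm_apply_eq, hT, LinearIsometryEquiv.apply_symm_apply,
    StarAlgEquiv.apply_symm_apply]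

theorem Corresponds.unique (h : Corresponds α σ τ) (h' : Corresponds α σ τ') : τ = τ' := by
  obtain ⟨π, ρ, hπ, hρ, T, hT⟩ := h
  obtain ⟨π', ρ', hπ', hρ', T', hT'⟩ := h'
  obtain ⟨S, hS⟩ : π ≈ π' := Quotient.exact (hπ.symm.trans hπ')
  refine Subtype.ext (hρ.trans ((Quotient.sound ?_).trans hρ'.symm))
  refine ⟨(T.symm.trans S).trans T', fun b x => ?_⟩
  obtain ⟨a, rfl⟩ : ∃ a, α a = b := α.surjective b
  obtain ⟨y, rfl⟩ := T.surjective x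
  rw [← hT]
  simp [hS, hT']

theorem Corresponds.mem_kernel_iff (h : Corresponds α σ τ) (a : A) :
    α a ∈ kernel τ ↔ a ∈ kernel σ := by
  obtain ⟨π, ρ, hπ, hρ, T, hT⟩ := h
  have h1 : a ∈ kernel σ ↔ π.hom a = 0 := by
    rw [kernel, hπ]
    rfl
  have h2 : α a ∈ kernel τ ↔ ρ.hom (α a) = 0 := by
    rw [kernel, hρ]
    rfl
  rw [h1, h2]
  constructor
  · intro h0
    refine ContinuousLinearMap.ext fun x => T.injective ?_
    rw [hT, h0]
    simp
  · intro h0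
    refine ContinuousLinearMap.ext fun x => ?_
    obtain ⟨y, rfl⟩ := T.surjective x
    rw [← hT, h0]
    simp

/-- The two algebras may live in different universes and so may their Hilbert spaces; finite
dimension allows passing to a standard space in the universe of B. -/
theorem exists_corresponds (α : A ≃⋆ₐ[ℂ] B) (σ : CStarSpecLETwo A) : ∃ τ, Corresponds α σ τ := by
  obtain ⟨σ, hσ⟩ := σ
  induction σ using Quotient.inductionOn with
  | h π =>
    change Module.finrank ℂ π.H = 1 ∨ Module.finrank ℂ π.H = 2 at hσ
    have hpos : 0 < Module.finrank ℂ π.H := by omega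
    have : FiniteDimensional ℂ π.H := Module.finite_of_finrank_pos hpos
    let T : π.H ≃ₗᵢ[ℂ] StdSpace.{w'} (Module.finrank ℂ π.H) :=
      (stdOrthonormalBasis ℂ π.H).equiv (stdBasis.{w'} _) (Equiv.refl _)
    have : Nontrivial (StdSpace.{w'} (Module.finrank ℂ π.H)) :=
      Module.nontrivial_of_finrank_pos (R := ℂ) (by rwa [finrank_stdSpace])
    refine ⟨⟨⟦π.transport α T⟧, ?_⟩, π, π.transport α T, rfl, rfl, T, fun a x => ?_⟩
    · change Module.finrank ℂ (StdSpace.{w'} (Module.finrank ℂ π.H)) = 1 ∨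
        Module.finrank ℂ (StdSpace.{w'} (Module.finrank ℂ π.H)) = 2
      rwa [finrank_stdSpace]
    · exact π.transport_hom_apply α T a x

/-- The map between the spaces of one- and two-dimensional irreducible representations that is
induced by an isomorphism. -/
noncomputable def transport (α : A ≃⋆ₐ[ℂ] B) (σ : CStarSpecLETwo A) : CStarSpecLETwo B :=
  (exists_corresponds α σ).choose

theorem corresponds_transport (α : A ≃⋆ₐ[ℂ] B) (σ : CStarSpecLETwo A) :
    Corresponds α σ (transport α σ) :=
  (exists_corresponds α σ).choose_spec

theorem continuous_transport (α : A ≃⋆ₐ[ℂ] B) : Continuous (transport α) := by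
  refine continuous_iff_isClosed.2 fun C hC => ?_
  obtain ⟨S, rfl⟩ := isClosed_iff.1 hC
  refine isClosed_iff.2 ⟨α ⁻¹' S, ?_⟩
  ext σ
  constructor
  · intro h a ha
    exact ((corresponds_transport α σ).mem_kernel_iff a).1 (h ha)
  · intro h b hb
    obtain ⟨a, rfl⟩ : ∃ a, α a = b := α.surjective b
    exact ((corresponds_transport α σ).mem_kernel_iff a).2 (h hb)

theorem transport_symm_transport (α : A ≃⋆ₐ[ℂ] B) (σ : CStarSpecLETwo A) :
    transport α.symm (transport α σ) = σ :=
  (corresponds_transport α.symm (transport α σ)).unique (corresponds_transport α σ).symm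

/-- Isomorphic `C*`-algebras have homeomorphic spaces of one- and two-dimensional irreducible
representations. -/
noncomputable def homeomorph (α : A ≃⋆ₐ[ℂ] B) : CStarSpecLETwo A ≃ₜ CStarSpecLETwo B where
  toFun := transport α
  invFun := transport α.symm
  left_inv := transport_symm_transport α
  right_inv := transport_symm_transport α.symm
  continuous_toFun := continuous_transport α
  continuous_invFun := continuous_transport α.symm

end CStarSpecLETwo

theorem mainTheorem1 {U V U' V' : Type*} [Fintype U] [Fintype V] [Fintype U'] [Fintype V']
    (G : BipartiteGraph U V) (G' : BipartiteGraph U' V') :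
    Nonempty (G.CStar ≃⋆ₐ[ℂ] G'.CStar) ↔
      Nonempty (CStarSpecLETwo G.CStar ≃ₜ CStarSpecLETwo G'.CStar) :=
  ⟨fun ⟨α⟩ => ⟨CStarSpecLETwo.homeomorph α⟩,
    fun ⟨φ⟩ => BipartiteGraph.nonempty_starAlgEquiv_of_homeomorph φ⟩
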